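/- We work over $\mathbb{C}$. A fan $(N,\Sigma)$ is a lattice $N$ (free abelian group of finite rank) with a finite fan $\Sigma$ of strongly convex rational polyhedral cones in $N_{\mathbb{R}}$; $X_\Sigma$ denotes its toric variety, and a map of fans (a lattice homomorphism sending every cone into a cone) induces a toric morphism. Fix integers $n,k\ge 1$ and positive integers $a_0,\dots,a_n$ with $\gcd(a_0,\dots,\widehat{a_i},\dots,a_n)=1$ for every $i$. The weighted projective space $\mathbb{P}(a_0,\dots,a_n)$ is the toric variety of the lattice $\mathbb{Z}^{n+1}/\mathbb{Z}(a_0,\dots,a_n)$ with the fan of cones spanned by the images of the proper subsets of the standard basis; $\mathbb{P}^k=\mathbb{P}(1,\dots,1)$. A locally trivial toric fibration $F\xrightarrow{i}X\xrightarrow{\pi}B$ consists of toric varieties $F,X,B$ given by fans and of morphisms $i,\pi$ induced by maps of fans, such that $i$ identifies $F$ with the (scheme-theoretic) fibre of $\pi$ over the identity element of the torus of $B$, and such that for every affine open toric subvariety $U\subseteq B$ there is an isomorphism $\pi^{-1}(U)\cong U\times F$ over $U$. For integers $d_0,\dots,d_n$, let $X(a,d)$ be the toric variety of the lattice $$N(a,d)=(\mathbb{Z}^{n+1}\oplus\mathbb{Z}^{k+1})\big/\big\langle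 (a_0,\dots,a_n,0,\dots,0),\ (-d_0,\dots,-d_n,1,\dots,1)\big\rangle$$ with the fan of cones spanned by the images of those sets of standard basis vectors that contain neither all of the standard basis $e_0,\dots,e_n$ of $\mathbb{Z}^{n+1}$ nor all of the standard basis $f_0,\dots,f_k$ of $\mathbb{Z}^{k+1}$. The inclusion of $\mathbb{Z}^{n+1}$ and the projection to $\mathbb{Z}^{k+1}$ induce maps of fans, which give $\mathbb{P}(a_0,\dots,a_n)\to X(a,d)\to\mathbb{P}^k$. Theorem. Let $\mathbb{P}(a_0,\dots,a_n)\xrightarrow{i}X\xrightarrow{\pi}\mathbb{P}^k$ be a locally trivial toric fibration. Then there are integers $d_0,\dots,d_n$ and an isomorphism between the fan of $X$ and the fan of $X(a,d)$ that is compatible with the maps of fans from the fan of $\mathbb{P}(a_0,\dots,a_n)$ and to the fan of $\mathbb{P}^k$; in particular $X\cong X(a,d)$ as toric fibrations over $\mathbb{P}^k$ with fibre $\mathbb{P}(a_0,\dots,a_n)$. -/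

import Mathlib

open CategoryTheory CategoryTheory.Limits AlgebraicGeometry
open scoped TensorProduct

namespace Toric

/-- The real vector space `N_ℝ = ℝ ⊗ N` of a lattice `N`. -/
abbrev RealSpace (N : Type) [AddCommGroup N] : Type := ℝ ⊗[ℤ] N

section Cones

variable {N : Type} [AddCommGroup N] {N' : Type} [AddCommGroup N']

/-- A lattice vector, as a vector of `N_ℝ`. -/
noncomputable def vec (v : N) : RealSpace N := (1 : ℝ) ⊗ₜ[ℤ] v

/-- The real linear form on `N_ℝ` given by an element `m` of the dual lattice. -/
noncomputable def realForm (m : Module.Dual ℤ N) : RealSpace N →ₗ[ℝ] ℝ :=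
  Module.Dual.baseChange ℝ m

/-- The cone in `N_ℝ` spanned by a set of lattice vectors. -/
noncomputable def coneSpan (s : Set N) : PointedCone ℝ (RealSpace N) :=
  PointedCone.hull ℝ (vec '' s)

/-- `τ` is a face of `σ`: `τ = σ ∩ m^⊥` for some lattice point `m` of the dual cone of `σ`
(for rational polyhedral cones every face has this form). -/
def IsFace (τ σ : PointedCone ℝ (RealSpace N)) : Prop :=
  ∃ m : Module.Dual ℤ N, (∀ x ∈ σ, 0 ≤ realForm m x) ∧ ∀ x, x ∈ τ ↔ x ∈ σ ∧ realForm m x = 0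

lemma realForm_tmul (m : Module.Dual ℤ N) (r : ℝ) (v : N) :
    realForm m (r ⊗ₜ[ℤ] v) = (m v : ℝ) * r := by
  simp [realForm]

lemma realForm_vec (m : Module.Dual ℤ N) (v : N) : realForm m (vec v) = m v := by
  simp [vec, realForm_tmul]

lemma realForm_add (m m' : Module.Dual ℤ N) (x : RealSpace N) :
    realForm (m + m') x = realForm m x + realForm m' x := by
  refine TensorProduct.induction_on x (by simp) (fun r v => by simp [realForm_tmul, add_mul]) ?_
  intro x y hx hy
  rw [map_add, map_add, map_add, hx, hy]
  ring

lemma realForm_zero (x : RealSpace N) : realForm (0 : Module.Dual ℤ N) x = 0 := by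
  simp [realForm]

lemma realForm_neg (m : Module.Dual ℤ N) (x : RealSpace N) :
    realForm (-m) x = -realForm m x := by
  have h := realForm_add m (-m) x
  rw [add_neg_cancel, realForm_zero] at h
  linarith

lemma realForm_nsmul (k : ℕ) (m : Module.Dual ℤ N) (x : RealSpace N) :
    realForm (k • m) x = k * realForm m x := by
  induction k with
  | zero => simp [realForm_zero]
  | succ k ih => rw [succ_nsmul, realForm_add, ih]; push_cast; ring

lemma realForm_comp (m : Module.Dual ℤ N') (f : N →ₗ[ℤ] N') (x : RealSpace N) :
    realForm (m ∘ₗ f) x = realForm m (f.baseChange ℝ x) := by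
  refine TensorProduct.induction_on x (by simp) (fun r v => by simp [realForm_tmul]) ?_
  intro x y hx hy
  rw [map_add, map_add, map_add, hx, hy]

/-- Elements of a cone are nonnegative combinations of its generators: induction principle. -/
lemma coneSpan_induction {s : Set N} {p : RealSpace N → Prop} (hv : ∀ v ∈ s, p (vec v))
    (h0 : p 0) (hadd : ∀ x y, p x → p y → p (x + y))
    (hsmul : ∀ (c : ℝ), 0 ≤ c → ∀ x, p x → p (c • x)) {x : RealSpace N} (hx : x ∈ coneSpan s) :
    p x := by
  refine Submodule.span_induction (p := fun x _ => p x) ?_ h0 (fun x y _ _ => hadd x y)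
    (fun c x _ h => hsmul c.1 c.2 x h) hx
  rintro _ ⟨v, hvs, rfl⟩
  exact hv v hvs

lemma vec_mem_coneSpan {s : Set N} {v : N} (hv : v ∈ s) : vec v ∈ coneSpan s :=
  PointedCone.subset_hull ⟨v, hv, rfl⟩

lemma coneSpan_mono {s t : Set N} (h : s ⊆ t) : coneSpan s ≤ coneSpan t :=
  Submodule.span_mono (Set.image_mono h)

lemma realForm_nonneg_of_coneSpan {s : Set N} {m : Module.Dual ℤ N} (h : ∀ v ∈ s, 0 ≤ m v)
    {x : RealSpace N} (hx : x ∈ coneSpan s) : 0 ≤ realForm m x := by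
  refine coneSpan_induction (p := fun x => 0 ≤ realForm m x) ?_ ?_ ?_ ?_ hx
  · intro v hv; rw [realForm_vec]; exact_mod_cast h v hv
  · simp
  · intro x y hx hy; rw [map_add]; exact add_nonneg hx hy
  · intro c hc x hx; rw [map_smul]; exact mul_nonneg hc hx

/-- If `m` is nonnegative on `s`, the face of `coneSpan s` cut out by `m` is spanned by the
generators on which `m` vanishes. -/
lemma mem_coneSpan_zero_iff {s : Set N} {m : Module.Dual ℤ N} (h : ∀ v ∈ s, 0 ≤ m v)
    (x : RealSpace N) :
    x ∈ coneSpan {v ∈ s | m v = 0} ↔ x ∈ coneSpan s ∧ realForm m x = 0 := by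
  constructor
  · intro hx
    refine ⟨coneSpan_mono (Set.sep_subset _ _) hx, ?_⟩
    refine coneSpan_induction (p := fun x => realForm m x = 0) ?_ ?_ ?_ ?_ hx
    · intro v hv; rw [realForm_vec, hv.2]; simp
    · simp
    · intro x y hx hy; rw [map_add, hx, hy, add_zero]
    · intro c hc x hx; rw [map_smul, hx, smul_zero]
  · rintro ⟨hx, h0⟩
    have key : realForm m x = 0 → x ∈ coneSpan {v ∈ s | m v = 0} := by
      refine (coneSpan_induction (p := fun x => 0 ≤ realForm m x ∧
        (realForm m x = 0 → x ∈ coneSpan {v ∈ s | m v = 0})) ?_ ?_ ?_ ?_ hx).2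
      · intro v hv
        rw [realForm_vec]
        refine ⟨by exact_mod_cast h v hv, fun h0 => vec_mem_coneSpan ⟨hv, by exact_mod_cast h0⟩⟩
      · exact ⟨by simp, fun _ => Submodule.zero_mem _⟩
      · rintro x y ⟨hx, hx'⟩ ⟨hy, hy'⟩
        rw [map_add]
        exact ⟨add_nonneg hx hy, fun h => Submodule.add_mem _ (hx' (by linarith))
          (hy' (by linarith))⟩
      · rintro c hc x ⟨hx, hx'⟩
        rw [map_smul, smul_eq_mul]
        refine ⟨mul_nonneg hc hx, fun h => ?_⟩
        rcases mul_eq_zero.1 h with h | h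
        · rw [h, zero_smul]; exact Submodule.zero_mem _
        · exact PointedCone.smul_mem _ hc (hx' h)
    exact key h0

lemma coneSpan_empty : coneSpan (∅ : Set N) = ⊥ := by
  simp [coneSpan]

end Cones

/-- A fan: a lattice `N` (a free abelian group of finite rank) together with a finite, nonempty
collection of strongly convex rational polyhedral cones in `N_ℝ` such that every face of a cone of
the collection is in the collection, and the intersection of two cones is a face of each.
As every strongly convex rational polyhedral cone has the face `{0}`, nonemptiness is expressed by
saying that the zero cone belongs to the fan. -/
structure Fan : Type 1 where
  /-- the lattice of one-parameter subgroups -/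
  N : Type
  [addCommGroup : AddCommGroup N]
  [free : Module.Free ℤ N]
  [finite : Module.Finite ℤ N]
  /-- the cones of the fan -/
  cones : Set (PointedCone ℝ (RealSpace N))
  finite_cones : cones.Finite
  bot_mem : ⊥ ∈ cones
  rational : ∀ σ ∈ cones, ∃ s : Set N, s.Finite ∧ σ = coneSpan s
  strongly_convex : ∀ σ ∈ cones, ∀ x ∈ σ, -x ∈ σ → x = 0
  face_mem : ∀ σ ∈ cones, ∀ τ, IsFace τ σ → τ ∈ cones
  inter_isFace : ∀ σ ∈ cones, ∀ τ ∈ cones, IsFace (σ ⊓ τ) σ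

attribute [instance] Fan.addCommGroup Fan.free Fan.finite

namespace Fan

/-- A map of fans: a homomorphism of lattices such that each cone of the source is mapped into
some cone of the target. -/
@[ext]
structure Hom (X Y : Fan) where
  /-- the map of lattices -/
  lin : X.N →ₗ[ℤ] Y.N
  map_cone : ∀ σ ∈ X.cones, ∃ τ ∈ Y.cones, ∀ x ∈ σ, lin.baseChange ℝ x ∈ τ

instance : Category Fan where
  Hom := Hom
  id X := ⟨LinearMap.id, fun σ hσ => ⟨σ, hσ, fun x hx => by simpa using hx⟩⟩
  comp f g := ⟨g.lin ∘ₗ f.lin, fun σ hσ => by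
    obtain ⟨τ, hτ, h⟩ := f.map_cone σ hσ
    obtain ⟨ρ, hρ, h'⟩ := g.map_cone τ hτ
    exact ⟨ρ, hρ, fun x hx => by
      rw [LinearMap.baseChange_comp]; exact h' _ (h x hx)⟩⟩

@[simp] lemma id_lin (X : Fan) : Hom.lin (𝟙 X) = LinearMap.id := rfl

@[simp] lemma comp_lin {X Y Z : Fan} (f : X ⟶ Y) (g : Y ⟶ Z) :
    Hom.lin (f ≫ g) = Hom.lin g ∘ₗ Hom.lin f := rfl

@[ext] lemma hom_ext {X Y : Fan} {f g : X ⟶ Y} (h : Hom.lin f = Hom.lin g) : f = g :=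
  Hom.ext h

end Fan

section Charts

variable {N : Type} [AddCommGroup N] {N' : Type} [AddCommGroup N'] {N'' : Type} [AddCommGroup N'']

/-- The semigroup `S_σ = σ^∨ ∩ M` of a cone `σ`, where `M` is the dual lattice. -/
noncomputable def dualMonoid (σ : PointedCone ℝ (RealSpace N)) :
    AddSubmonoid (Module.Dual ℤ N) where
  carrier := {m | ∀ x ∈ σ, 0 ≤ realForm m x}
  zero_mem' := fun x _ => (realForm_zero x).ge
  add_mem' := fun h h' x hx => by rw [realForm_add]; exact add_nonneg (h x hx) (h' x hx)

lemma mem_dualMonoid {σ : PointedCone ℝ (RealSpace N)} {m : Module.Dual ℤ N} :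
    m ∈ dualMonoid σ ↔ ∀ x ∈ σ, 0 ≤ realForm m x := Iff.rfl

/-- The semigroup algebra `ℂ[S_σ]`. -/
abbrev CoordRing (σ : PointedCone ℝ (RealSpace N)) : Type := AddMonoidAlgebra ℂ (dualMonoid σ)

/-- The affine toric variety `U_σ = Spec ℂ[S_σ]`. -/
noncomputable abbrev chart (σ : PointedCone ℝ (RealSpace N)) : Scheme.{0} :=
  Spec (CommRingCat.of (CoordRing σ))

/-- Pulling back characters along a map of lattices that maps `σ` into `τ`. -/
noncomputable def dualMonoidMap (f : N →ₗ[ℤ] N') {σ : PointedCone ℝ (RealSpace N)}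
    {τ : PointedCone ℝ (RealSpace N')} (h : ∀ x ∈ σ, f.baseChange ℝ x ∈ τ) :
    dualMonoid τ →+ dualMonoid σ where
  toFun m := ⟨m.1 ∘ₗ f, fun x hx => by rw [realForm_comp]; exact m.2 _ (h x hx)⟩
  map_zero' := Subtype.ext (LinearMap.zero_comp f)
  map_add' m m' := Subtype.ext (LinearMap.add_comp f m'.1 m.1)

/-- The ring homomorphism `ℂ[S_τ] → ℂ[S_σ]`, `χ^m ↦ χ^(m ∘ f)`. -/
noncomputable def coordMap (f : N →ₗ[ℤ] N') {σ : PointedCone ℝ (RealSpace N)}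
    {τ : PointedCone ℝ (RealSpace N')} (h : ∀ x ∈ σ, f.baseChange ℝ x ∈ τ) :
    CoordRing τ →+* CoordRing σ :=
  AddMonoidAlgebra.mapDomainRingHom ℂ (dualMonoidMap f h)

/-- The morphism `U_σ ⟶ U_τ` induced by a map of lattices that maps `σ` into `τ`. -/
noncomputable def chartMap (f : N →ₗ[ℤ] N') {σ : PointedCone ℝ (RealSpace N)}
    {τ : PointedCone ℝ (RealSpace N')} (h : ∀ x ∈ σ, f.baseChange ℝ x ∈ τ) :
    chart σ ⟶ chart τ :=
  Spec.map (CommRingCat.ofHom (coordMap f h))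

lemma chartMap_comp (f : N →ₗ[ℤ] N') (g : N' →ₗ[ℤ] N'') {σ : PointedCone ℝ (RealSpace N)}
    {τ : PointedCone ℝ (RealSpace N')} {ρ : PointedCone ℝ (RealSpace N'')}
    (h : ∀ x ∈ σ, f.baseChange ℝ x ∈ τ) (h' : ∀ x ∈ τ, g.baseChange ℝ x ∈ ρ)
    (h'' : ∀ x ∈ σ, (g ∘ₗ f).baseChange ℝ x ∈ ρ) :
    chartMap f h ≫ chartMap g h' = chartMap (g ∘ₗ f) h'' := by
  rw [chartMap, chartMap, chartMap, ← Spec.map_comp, ← CommRingCat.ofHom_comp, coordMap, coordMap,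
    coordMap, ← AddMonoidAlgebra.mapDomainRingHom_comp]
  rfl

lemma chartMap_id {σ : PointedCone ℝ (RealSpace N)}
    (h : ∀ x ∈ σ, (LinearMap.id : N →ₗ[ℤ] N).baseChange ℝ x ∈ σ) :
    chartMap LinearMap.id h = 𝟙 (chart σ) := by
  have : dualMonoidMap LinearMap.id h = AddMonoidHom.id _ := rfl
  rw [chartMap, coordMap, this, AddMonoidAlgebra.mapDomainRingHom_id]
  exact Spec.map_id _

/-- The inclusion of charts `U_σ ⟶ U_τ` for cones `σ ⊆ τ`. -/
noncomputable def chartIncl {σ τ : PointedCone ℝ (RealSpace N)} (h : σ ≤ τ) : chart σ ⟶ chart τ :=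
  chartMap LinearMap.id (fun x hx => by simpa using h hx)

lemma chartMap_chartIncl (f : N →ₗ[ℤ] N') {σ : PointedCone ℝ (RealSpace N)}
    {τ ρ : PointedCone ℝ (RealSpace N')} (h : ∀ x ∈ σ, f.baseChange ℝ x ∈ τ) (h' : τ ≤ ρ)
    (h'' : ∀ x ∈ σ, f.baseChange ℝ x ∈ ρ) :
    chartMap f h ≫ chartIncl h' = chartMap f h'' := by
  rw [chartIncl, chartMap_comp f LinearMap.id h _ h'']
  simp only [LinearMap.id_comp]

lemma chartIncl_chartMap (f : N →ₗ[ℤ] N') {σ τ : PointedCone ℝ (RealSpace N)}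
    {ρ : PointedCone ℝ (RealSpace N')} (h : σ ≤ τ) (h' : ∀ x ∈ τ, f.baseChange ℝ x ∈ ρ)
    (h'' : ∀ x ∈ σ, f.baseChange ℝ x ∈ ρ) :
    chartIncl h ≫ chartMap f h' = chartMap f h'' := by
  rw [chartIncl, chartMap_comp LinearMap.id f _ h' h'']
  simp only [LinearMap.comp_id]

/-- The structure morphism of a chart. -/
noncomputable def chartStr (σ : PointedCone ℝ (RealSpace N)) :
    chart σ ⟶ Spec (CommRingCat.of ℂ) :=
  Spec.map (CommRingCat.ofHom (algebraMap ℂ (CoordRing σ)))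

lemma chartMap_str (f : N →ₗ[ℤ] N') {σ : PointedCone ℝ (RealSpace N)}
    {τ : PointedCone ℝ (RealSpace N')} (h : ∀ x ∈ σ, f.baseChange ℝ x ∈ τ) :
    chartMap f h ≫ chartStr τ = chartStr σ := by
  rw [chartMap, chartStr, chartStr, ← Spec.map_comp, ← CommRingCat.ofHom_comp, coordMap,
    AddMonoidAlgebra.mapDomainRingHom_comp_algebraMap]

/-- For a rational polyhedral cone `σ` and its face `τ = σ ∩ m^⊥`, the algebra `ℂ[S_τ]` is the
localization of `ℂ[S_σ]` at `χ^m`. -/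
lemma isLocalization_face {s : Set N} (hs : s.Finite) {σ τ : PointedCone ℝ (RealSpace N)}
    (hσ : σ = coneSpan s) (m : dualMonoid σ) (hτ : ∀ x, x ∈ τ ↔ x ∈ σ ∧ realForm m.1 x = 0)
    (h : ∀ x ∈ τ, (LinearMap.id : N →ₗ[ℤ] N).baseChange ℝ x ∈ σ) :
    @IsLocalization.Away _ _ (AddMonoidAlgebra.single m (1 : ℂ) : CoordRing σ) (CoordRing τ) _
      (coordMap LinearMap.id h).toAlgebra := by
  let _ := (coordMap LinearMap.id h).toAlgebra
  have halg : ∀ (m' : dualMonoid σ) (c : ℂ), algebraMap (CoordRing σ) (CoordRing τ)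
      (AddMonoidAlgebra.single m' c) = AddMonoidAlgebra.single (dualMonoidMap LinearMap.id h m') c := by
    intro m' c
    change coordMap LinearMap.id h _ = _
    simp [coordMap]
  have hinj : Function.Injective (algebraMap (CoordRing σ) (CoordRing τ)) := by
    change Function.Injective (AddMonoidAlgebra.mapDomain (dualMonoidMap LinearMap.id h))
    refine AddMonoidAlgebra.mapDomain_injective ?_
    intro m₁ m₂ h12
    exact Subtype.ext (congrArg (fun x : dualMonoid τ => x.1) h12)
  have hm0 : -m.1 ∈ dualMonoid τ := by
    intro x hx
    rw [realForm_neg, ((hτ x).1 hx).2, neg_zero]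
  refine (isLocalization_iff _ _).2 ⟨?_, ?_, ?_⟩
  · rintro ⟨_, k, rfl⟩
    rw [map_pow]
    refine IsUnit.pow k ?_
    refine IsUnit.of_mul_eq_one (AddMonoidAlgebra.single (⟨-m.1, hm0⟩ : dualMonoid τ) (1 : ℂ)) ?_
    rw [halg, AddMonoidAlgebra.single_mul_single, AddMonoidAlgebra.one_def, one_mul]
    congr 1
    exact Subtype.ext (add_neg_cancel m.1)
  · have key : ∀ z : CoordRing τ, ∃ k : ℕ, ∃ y : CoordRing σ, z * algebraMap (CoordRing σ)
        (CoordRing τ) (AddMonoidAlgebra.single m (1 : ℂ) ^ k) = algebraMap _ _ y := by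
      intro z
      induction z using AddMonoidAlgebra.induction_on with
      | of m' =>
        let k : ℕ := ∑ v ∈ hs.toFinset, (m'.1 v).natAbs
        have hk : m'.1 + k • m.1 ∈ dualMonoid σ := by
          intro x hx
          rw [hσ] at hx
          refine realForm_nonneg_of_coneSpan (fun v hv => ?_) hx
          have hvσ : vec v ∈ σ := hσ ▸ vec_mem_coneSpan hv
          have h0 : 0 ≤ m.1 v := by
            have := m.2 _ hvσ
            rw [realForm_vec] at this
            exact_mod_cast this
          have hle : (m'.1 v).natAbs ≤ k :=
            Finset.single_le_sum (f := fun v => (m'.1 v).natAbs) (fun _ _ => Nat.zero_le _)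
              (hs.mem_toFinset.2 hv)
          rw [LinearMap.add_apply, LinearMap.smul_apply, nsmul_eq_mul]
          rcases h0.eq_or_lt with h0 | h0
          · have hvτ : vec v ∈ τ := (hτ _).2 ⟨hvσ, by rw [realForm_vec, ← h0]; simp⟩
            have := m'.2 _ hvτ
            rw [realForm_vec] at this
            rw [← h0, mul_zero, add_zero]
            exact_mod_cast this
          · have h1 : (k : ℤ) ≤ k * m.1 v := le_mul_of_one_le_right (by positivity) h0
            have h2 : -((m'.1 v).natAbs : ℤ) ≤ m'.1 v := by omega
            have h3 : ((m'.1 v).natAbs : ℤ) ≤ k := by exact_mod_cast hle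
            linarith
        refine ⟨k, AddMonoidAlgebra.single ⟨_, hk⟩ 1, ?_⟩
        rw [AddMonoidAlgebra.single_pow, halg, halg, one_pow]
        change AddMonoidAlgebra.single m' 1 * _ = _
        rw [AddMonoidAlgebra.single_mul_single, one_mul]
        congr 1
      | add x y hx hy =>
        obtain ⟨k, x', hx⟩ := hx
        obtain ⟨l, y', hy⟩ := hy
        refine ⟨k + l, x' * AddMonoidAlgebra.single m (1 : ℂ) ^ l +
          y' * AddMonoidAlgebra.single m (1 : ℂ) ^ k, ?_⟩
        rw [map_add, map_mul, map_mul, ← hx, ← hy, pow_add, map_mul]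
        ring
      | smul r x hx =>
        obtain ⟨k, y, hy⟩ := hx
        refine ⟨k, AddMonoidAlgebra.single 0 r * y, ?_⟩
        rw [map_mul, ← hy, halg, map_zero, ← mul_assoc]
        congr 1
        ext i
        rw [AddMonoidAlgebra.coeff_single_zero_mul]
        simp
    intro z
    obtain ⟨k, y, h⟩ := key z
    exact ⟨(y, ⟨_, k, rfl⟩), h⟩
  · intro x y hxy
    exact ⟨1, by rw [hinj hxy]⟩

lemma chartIncl_face {s : Set N} (hs : s.Finite) {σ τ : PointedCone ℝ (RealSpace N)}
    (hσ : σ = coneSpan s) (m : dualMonoid σ) (hτ : ∀ x, x ∈ τ ↔ x ∈ σ ∧ realForm m.1 x = 0)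
    (h : τ ≤ σ) :
    IsOpenImmersion (chartIncl h) ∧ Set.range (chartIncl h) =
      (PrimeSpectrum.basicOpen (AddMonoidAlgebra.single m (1 : ℂ) : CoordRing σ) :
        Set (PrimeSpectrum (CoordRing σ))) := by
  have h' : ∀ x ∈ τ, (LinearMap.id : N →ₗ[ℤ] N).baseChange ℝ x ∈ σ := fun x hx => by
    simpa using h hx
  let _ := (coordMap LinearMap.id h').toAlgebra
  have := isLocalization_face hs hσ m hτ h'
  exact ⟨IsOpenImmersion.of_isLocalization (S := CoordRing τ)
    (AddMonoidAlgebra.single m (1 : ℂ) : CoordRing σ),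
    PrimeSpectrum.localization_away_comap_range (CoordRing τ) _⟩

end Charts
namespace Fan

lemma inf_mem (X : Fan) {σ τ : PointedCone ℝ (RealSpace X.N)} (hσ : σ ∈ X.cones)
    (hτ : τ ∈ X.cones) : σ ⊓ τ ∈ X.cones :=
  X.face_mem σ hσ _ (X.inter_isFace σ hσ τ hτ)

lemma isFace_of_le (X : Fan) {σ τ : PointedCone ℝ (RealSpace X.N)} (hσ : σ ∈ X.cones)
    (hτ : τ ∈ X.cones) (h : τ ≤ σ) : IsFace τ σ := by
  have := X.inter_isFace σ hσ τ hτ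
  rwa [inf_eq_right.2 h] at this

/-- The diagram of affine charts `U_σ`, for the cones `σ` of a fan, and their inclusions. -/
noncomputable def diagram (X : Fan) : X.cones ⥤ Scheme.{0} where
  obj σ := chart σ.1
  map h := chartIncl h.le
  map_id σ := chartMap_id _
  map_comp h h' := by
    symm
    exact chartMap_comp _ _ _ _ (fun x hx => by simpa using h'.le (h.le hx))

lemma diagram_face (X : Fan) {σ τ : X.cones} (h : τ ⟶ σ) :
    ∃ m : dualMonoid σ.1, (∀ x, x ∈ τ.1 ↔ x ∈ σ.1 ∧ realForm m.1 x = 0) ∧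
      IsOpenImmersion (X.diagram.map h) ∧ Set.range (X.diagram.map h) =
      (PrimeSpectrum.basicOpen (AddMonoidAlgebra.single m (1 : ℂ) : CoordRing σ.1) :
        Set (PrimeSpectrum (CoordRing σ.1))) := by
  obtain ⟨s, hs, hσ⟩ := X.rational σ.1 σ.2
  obtain ⟨m, hm, hτ⟩ := X.isFace_of_le σ.2 τ.2 h.le
  exact ⟨⟨m, hm⟩, hτ, chartIncl_face hs hσ ⟨m, hm⟩ hτ h.le⟩

instance (X : Fan) {σ τ : X.cones} (h : τ ⟶ σ) : IsOpenImmersion (X.diagram.map h) := by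
  obtain ⟨m, -, h, -⟩ := X.diagram_face h
  exact h

instance (X : Fan) : (X.diagram ⋙ Scheme.forget).IsLocallyDirected where
  cond := by
    intro i j k fi fj xi xj hij
    let l : X.cones := ⟨i.1 ⊓ j.1, X.inf_mem i.2 j.2⟩
    let fli : l ⟶ i := homOfLE (show l.1 ≤ i.1 from inf_le_left)
    let flj : l ⟶ j := homOfLE (show l.1 ≤ j.1 from inf_le_right)
    have hij' : X.diagram.map fi xi = X.diagram.map fj xj := hij
    obtain ⟨m, hm, -, hri⟩ := X.diagram_face fi
    obtain ⟨m', hm', -, hrj⟩ := X.diagram_face fj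
    obtain ⟨s, hs, hk⟩ := X.rational k.1 k.2
    have hl : ∀ x, x ∈ l.1 ↔ x ∈ k.1 ∧ realForm (m + m').1 x = 0 := by
      intro x
      change x ∈ i.1 ∧ x ∈ j.1 ↔ _
      rw [hm, hm', AddSubmonoid.coe_add, realForm_add]
      constructor
      · rintro ⟨⟨h, h1⟩, -, h2⟩
        exact ⟨h, by rw [h1, h2, add_zero]⟩
      · rintro ⟨h, h'⟩
        have h1 := m.2 x h
        have h2 := m'.2 x h
        exact ⟨⟨h, by linarith⟩, h, by linarith⟩
    have hrl : Set.range (X.diagram.map (fli ≫ fi)) =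
        (PrimeSpectrum.basicOpen (AddMonoidAlgebra.single (m + m') (1 : ℂ) : CoordRing k.1) :
          Set (PrimeSpectrum (CoordRing k.1))) :=
      (chartIncl_face hs hk (m + m') hl (fli ≫ fi).le).2
    have hmem : X.diagram.map fi xi ∈ Set.range (X.diagram.map (fli ≫ fi)) := by
      have h1 : X.diagram.map fi xi ∈ Set.range (X.diagram.map fi) := ⟨xi, rfl⟩
      have h2 : X.diagram.map fi xi ∈ Set.range (X.diagram.map fj) := ⟨xj, hij'.symm⟩
      rw [hri] at h1
      rw [hrj] at h2
      rw [hrl]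
      have h3 : (AddMonoidAlgebra.single (m + m') (1 : ℂ) : CoordRing k.1) =
          AddMonoidAlgebra.single m (1 : ℂ) * AddMonoidAlgebra.single m' (1 : ℂ) := by
        rw [AddMonoidAlgebra.single_mul_single, one_mul]
      rw [h3, PrimeSpectrum.basicOpen_mul]
      exact ⟨h1, h2⟩
    obtain ⟨x, hx⟩ := hmem
    refine ⟨l, fli, flj, x, ?_, ?_⟩
    · apply (X.diagram.map fi).isOpenEmbedding.injective
      rw [Functor.map_comp] at hx
      simpa using hx
    · apply (X.diagram.map fj).isOpenEmbedding.injective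
      rw [Subsingleton.elim (fli ≫ fi) (flj ≫ fj), Functor.map_comp, hij'] at hx
      simpa using hx

/-- The toric variety `X_Σ` over `ℂ` of a fan `Σ`, obtained by gluing the affine toric
varieties `U_σ`, `σ ∈ Σ`, along the open subschemes `U_(σ ∩ τ)`. -/
noncomputable def variety (X : Fan) : Scheme.{0} := colimit X.diagram

/-- The inclusion of the affine chart `U_σ`. -/
noncomputable def chartι (X : Fan) (σ : X.cones) : chart σ.1 ⟶ X.variety :=
  colimit.ι X.diagram σ

instance (X : Fan) (σ : X.cones) : IsOpenImmersion (X.chartι σ) :=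
  inferInstanceAs (IsOpenImmersion (colimit.ι X.diagram σ))

/-- The affine open toric subvariety `U_σ` of `X_Σ`. -/
noncomputable def affineOpen (X : Fan) (σ : X.cones) : X.variety.Opens :=
  (X.chartι σ).opensRange

lemma chartIncl_chartι (X : Fan) {σ τ : X.cones} (h : σ.1 ≤ τ.1) :
    chartIncl h ≫ X.chartι τ = X.chartι σ :=
  colimit.w X.diagram (homOfLE h : σ ⟶ τ)

lemma variety_hom_ext (X : Fan) {Z : Scheme.{0}} {f g : X.variety ⟶ Z}
    (h : ∀ σ, X.chartι σ ≫ f = X.chartι σ ≫ g) : f = g :=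
  colimit.hom_ext h

/-- The structure morphism of `X_Σ` over `ℂ`. -/
noncomputable def str (X : Fan) : X.variety ⟶ Spec (CommRingCat.of ℂ) :=
  colimit.desc X.diagram
    { pt := _
      ι := { app := fun σ => chartStr σ.1
             naturality := fun _ _ _ => (chartMap_str _ _).trans (Category.comp_id _).symm } }

lemma chartι_str (X : Fan) (σ : X.cones) : X.chartι σ ≫ X.str = chartStr σ.1 :=
  colimit.ι_desc _ σ

lemma chartMap_chartι_eq {X Y : Fan} (f : X.N →ₗ[ℤ] Y.N) {σ : PointedCone ℝ (RealSpace X.N)}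
    (τ τ' : Y.cones) (h : ∀ x ∈ σ, f.baseChange ℝ x ∈ τ.1)
    (h' : ∀ x ∈ σ, f.baseChange ℝ x ∈ τ'.1) :
    chartMap f h ≫ Y.chartι τ = chartMap f h' ≫ Y.chartι τ' := by
  obtain ⟨ρ, h1, h2, hρ⟩ : ∃ ρ : Y.cones, ρ.1 ≤ τ.1 ∧ ρ.1 ≤ τ'.1 ∧
      ∀ x ∈ σ, f.baseChange ℝ x ∈ ρ.1 :=
    ⟨⟨τ.1 ⊓ τ'.1, Y.inf_mem τ.2 τ'.2⟩, inf_le_left, inf_le_right, fun x hx => ⟨h x hx, h' x hx⟩⟩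
  rw [← chartMap_chartIncl f hρ h1 h, ← chartMap_chartIncl f hρ h2 h', Category.assoc,
    Category.assoc, chartIncl_chartι, chartIncl_chartι]

/-- A cone of the target containing the image of the cone `σ` under a map of fans. -/
noncomputable def targetCone {X Y : Fan} (f : X ⟶ Y) (σ : X.cones) : Y.cones :=
  ⟨_, (f.map_cone σ.1 σ.2).choose_spec.1⟩

lemma map_mem_targetCone {X Y : Fan} (f : X ⟶ Y) (σ : X.cones) :
    ∀ x ∈ σ.1, f.lin.baseChange ℝ x ∈ (targetCone f σ).1 :=
  (f.map_cone σ.1 σ.2).choose_spec.2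

/-- The restriction to `U_σ` of the toric morphism induced by a map of fans. -/
noncomputable def toricMapOn {X Y : Fan} (f : X ⟶ Y) (σ : X.cones) : chart σ.1 ⟶ Y.variety :=
  chartMap f.lin (map_mem_targetCone f σ) ≫ Y.chartι (targetCone f σ)

lemma chartIncl_toricMapOn {X Y : Fan} (f : X ⟶ Y) {σ τ : X.cones} (h : σ.1 ≤ τ.1) :
    chartIncl h ≫ toricMapOn f τ = toricMapOn f σ := by
  have h' : ∀ x ∈ σ.1, f.lin.baseChange ℝ x ∈ (targetCone f τ).1 :=
    fun x hx => map_mem_targetCone f τ x (h hx)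
  rw [toricMapOn, toricMapOn, ← Category.assoc, chartIncl_chartMap f.lin h _ h']
  exact chartMap_chartι_eq f.lin _ _ _ _

/-- The toric morphism induced by a map of fans: if `f` maps `σ` into `τ`, it restricts to the
morphism `U_σ ⟶ U_τ` given by `χ^m ↦ χ^(m ∘ f)`. -/
noncomputable def toricMap {X Y : Fan} (f : X ⟶ Y) : X.variety ⟶ Y.variety :=
  colimit.desc X.diagram
    { pt := Y.variety
      ι :=
      { app := fun σ => toricMapOn f σ
        naturality := fun _ _ h =>
          (chartIncl_toricMapOn f h.le).trans (Category.comp_id _).symm } }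

lemma chartι_toricMap {X Y : Fan} (f : X ⟶ Y) (σ : X.cones) (τ : Y.cones)
    (h : ∀ x ∈ σ.1, f.lin.baseChange ℝ x ∈ τ.1) :
    X.chartι σ ≫ toricMap f = chartMap f.lin h ≫ Y.chartι τ :=
  (colimit.ι_desc _ σ).trans (chartMap_chartι_eq f.lin _ _ _ h)

lemma toricMap_id (X : Fan) : toricMap (𝟙 X) = 𝟙 X.variety := by
  refine X.variety_hom_ext fun σ => ?_
  rw [chartι_toricMap (𝟙 X) σ σ (fun x hx => by simpa using hx), Category.comp_id]
  exact (congrArg (· ≫ X.chartι σ) (chartMap_id _)).trans (Category.id_comp _)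

lemma toricMap_comp {X Y Z : Fan} (f : X ⟶ Y) (g : Y ⟶ Z) :
    toricMap (f ≫ g) = toricMap f ≫ toricMap g := by
  refine X.variety_hom_ext fun σ => ?_
  obtain ⟨τ, hτ, h⟩ := f.map_cone σ.1 σ.2
  obtain ⟨ρ, hρ, h'⟩ := g.map_cone τ hτ
  have h'' : ∀ x ∈ σ.1, (Hom.lin g ∘ₗ Hom.lin f).baseChange ℝ x ∈ ρ := fun x hx => by
    rw [LinearMap.baseChange_comp]; exact h' _ (h x hx)
  rw [chartι_toricMap (f ≫ g) σ ⟨ρ, hρ⟩ h'', ← Category.assoc, chartι_toricMap f σ ⟨τ, hτ⟩ h,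
    Category.assoc, chartι_toricMap g ⟨τ, hτ⟩ ⟨ρ, hρ⟩ h', ← Category.assoc]
  exact congrArg (· ≫ Z.chartι ⟨ρ, hρ⟩) (chartMap_comp _ _ h h' h'').symm

lemma toricMap_str {X Y : Fan} (f : X ⟶ Y) : toricMap f ≫ Y.str = X.str := by
  refine X.variety_hom_ext fun σ => ?_
  obtain ⟨τ, hτ, h⟩ := f.map_cone σ.1 σ.2
  rw [← Category.assoc, chartι_toricMap f σ ⟨τ, hτ⟩ h, Category.assoc, chartι_str, chartι_str,
    chartMap_str]

/-- The functor sending a fan to its toric variety over `ℂ` and a map of fans to its toric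
morphism; in particular isomorphic fans have isomorphic toric varieties. -/
noncomputable def toricVariety : Fan ⥤ Over (Spec (CommRingCat.of ℂ)) where
  obj X := Over.mk X.str
  map f := Over.homMk (toricMap f) (toricMap_str f)
  map_id X := by
    ext1
    exact toricMap_id X
  map_comp f g := by
    ext1
    exact toricMap_comp f g

/-- The zero cone of a fan. -/
def zeroCone (X : Fan) : X.cones := ⟨⊥, X.bot_mem⟩

/-- The torus `T_N = Spec ℂ[M]`, the affine toric variety of the zero cone. -/
noncomputable abbrev torus (X : Fan) : Scheme.{0} := chart X.zeroCone.1

/-- The inclusion of the torus into the toric variety. -/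
noncomputable abbrev torusι (X : Fan) : X.torus ⟶ X.variety := X.chartι X.zeroCone

/-- The identity element of the torus, as a `ℂ`-point of the toric variety: `χ^m ↦ 1`. -/
noncomputable def identityPoint (X : Fan) : Spec (CommRingCat.of ℂ) ⟶ X.variety :=
  Spec.map (CommRingCat.ofHom
    (AddMonoidAlgebra.lift ℂ ℂ (dualMonoid X.zeroCone.1) 1 : CoordRing X.zeroCone.1 →+* ℂ)) ≫
    X.torusι

/-- A locally trivial toric fibration `F ⟶ X ⟶ B`, the maps being induced by the maps of fans
`i` and `π`: the variety of `F` is, via `i`, the fibre over the identity element of the torus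
of `B`, and for every affine open toric subvariety `U_σ` of `B` there is an isomorphism
`π⁻¹(U_σ) ≅ F × U_σ` over `U_σ`, that is, a morphism `r : π⁻¹(U_σ) ⟶ F` that exhibits `π⁻¹(U_σ)`,
with `r` and `π`, as the product of `F` and `U_σ` over `ℂ`. -/
structure IsLocallyTrivialFibration {F X B : Fan} (i : F ⟶ X) (π : X ⟶ B) : Prop where
  fiber : IsPullback (toricMap i) F.str (toricMap π) B.identityPoint
  locally_trivial : ∀ σ : B.cones, ∃ r : (toricMap π ⁻¹ᵁ B.affineOpen σ).toScheme ⟶ F.variety,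
    IsPullback r (toricMap π ∣_ B.affineOpen σ) F.str ((B.affineOpen σ).ι ≫ B.str)

end Fan

/-- The fan whose cones are spanned by the subfamilies, indexed by `S ∈ 𝒮`, of a finite family `u`
of lattice vectors. -/
noncomputable def fanOfFamily {N ι : Type} [AddCommGroup N] [Module.Free ℤ N] [Module.Finite ℤ N]
    [Finite ι] (u : ι → N) (𝒮 : Set (Set ι)) (hempty : ∅ ∈ 𝒮)
    (hdown : ∀ S ∈ 𝒮, ∀ T, T ⊆ S → T ∈ 𝒮)
    (hsep : ∀ S ∈ 𝒮, ∀ T ∈ 𝒮, ∃ m : Module.Dual ℤ N, (∀ i ∈ S, i ∉ T → 0 < m (u i)) ∧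
      (∀ i ∈ T, i ∉ S → m (u i) < 0) ∧ ∀ i ∈ S, i ∈ T → m (u i) = 0) : Fan where
  N := N
  cones := {σ | ∃ S ∈ 𝒮, σ = coneSpan (u '' S)}
  finite_cones := by
    refine (Set.Finite.image (fun S => coneSpan (u '' S)) (Set.toFinite 𝒮)).subset ?_
    rintro _ ⟨S, hS, rfl⟩
    exact ⟨S, hS, rfl⟩
  bot_mem := ⟨∅, hempty, by rw [Set.image_empty, coneSpan_empty]⟩
  rational := by
    rintro _ ⟨S, -, rfl⟩
    exact ⟨_, Set.toFinite _, rfl⟩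
  strongly_convex := by
    rintro _ ⟨S, hS, rfl⟩ x hx hx'
    obtain ⟨m, h1, -, -⟩ := hsep S hS ∅ hempty
    have hpos : ∀ v ∈ u '' S, 0 < m v := by
      rintro _ ⟨i, hi, rfl⟩
      exact h1 i hi (Set.notMem_empty i)
    have hnn : ∀ v ∈ u '' S, 0 ≤ m v := fun v hv => (hpos v hv).le
    have ha := realForm_nonneg_of_coneSpan hnn hx
    have hb := realForm_nonneg_of_coneSpan hnn hx'
    rw [map_neg] at hb
    have hmem := (mem_coneSpan_zero_iff hnn x).2 ⟨hx, by linarith⟩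
    have hem : {v ∈ u '' S | m v = 0} = ∅ := by
      ext v
      simp only [Set.mem_ofPred_eq, Set.mem_empty_iff_false, iff_false, not_and]
      exact fun hv => (hpos v hv).ne'
    rw [hem, coneSpan_empty] at hmem
    exact hmem
  face_mem := by
    rintro _ ⟨S, hS, rfl⟩ τ ⟨m, hm, hτ⟩
    have hnn : ∀ v ∈ u '' S, 0 ≤ m v := fun v hv => by
      have := hm _ (vec_mem_coneSpan hv)
      rw [realForm_vec] at this
      exact_mod_cast this
    refine ⟨{i ∈ S | m (u i) = 0}, hdown S hS _ (Set.sep_subset _ _), ?_⟩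
    have : u '' {i ∈ S | m (u i) = 0} = {v ∈ u '' S | m v = 0} := by
      ext v
      constructor
      · rintro ⟨i, ⟨hi, h0⟩, rfl⟩
        exact ⟨⟨i, hi, rfl⟩, h0⟩
      · rintro ⟨⟨i, hi, rfl⟩, h0⟩
        exact ⟨i, ⟨hi, h0⟩, rfl⟩
    rw [this]
    ext x
    rw [hτ, mem_coneSpan_zero_iff hnn]
  inter_isFace := by
    rintro _ ⟨S, hS, rfl⟩ _ ⟨T, hT, rfl⟩
    obtain ⟨m, h1, h2, h3⟩ := hsep S hS T hT
    have hS' : ∀ v ∈ u '' S, 0 ≤ m v := by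
      rintro _ ⟨i, hi, rfl⟩
      by_cases hiT : i ∈ T
      · exact (h3 i hi hiT).ge
      · exact (h1 i hi hiT).le
    have hT' : ∀ v ∈ u '' T, 0 ≤ (-m) v := by
      rintro _ ⟨i, hi, rfl⟩
      rw [LinearMap.neg_apply]
      by_cases hiS : i ∈ S
      · rw [h3 i hiS hi, neg_zero]
      · have := h2 i hi hiS
        omega
    refine ⟨m, fun x hx => realForm_nonneg_of_coneSpan hS' hx, fun x => ⟨?_, ?_⟩⟩
    · rintro ⟨hxS, hxT⟩
      have ha := realForm_nonneg_of_coneSpan hS' hxS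
      have hb := realForm_nonneg_of_coneSpan hT' hxT
      rw [realForm_neg] at hb
      exact ⟨hxS, by linarith⟩
    · rintro ⟨hx, h0⟩
      refine ⟨hx, ?_⟩
      refine coneSpan_mono ?_ ((mem_coneSpan_zero_iff hS' x).2 ⟨hx, h0⟩)
      rintro _ ⟨⟨i, hi, rfl⟩, h0⟩
      by_contra hiT
      exact (h1 i hi fun h => hiT ⟨i, h, rfl⟩).ne' h0

/-- Well-formed weights: positive integers `a_0, …, a_n` such that any `n` of them have greatest
common divisor `1` (in particular `n ≥ 1`). -/
structure WellFormed {n : ℕ} (a : Fin (n + 1) → ℕ) : Prop where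
  pos : ∀ i, 0 < a i
  gcd_eq_one : ∀ i, (Finset.univ.erase i).gcd a = 1

lemma wellFormed_one {k : ℕ} (hk : 0 < k) : WellFormed (fun _ : Fin (k + 1) => 1) where
  pos _ := one_pos
  gcd_eq_one i := by
    have : Nontrivial (Fin (k + 1)) := Fin.nontrivial_iff_two_le.2 (by omega)
    obtain ⟨j, hj⟩ := exists_ne i
    exact Nat.dvd_one.1 (Finset.gcd_dvd (f := fun _ : Fin (k + 1) => 1) (b := j) (by simpa using hj))

lemma WellFormed.dvd_of_forall_dvd {n : ℕ} {a : Fin (n + 1) → ℕ} (ha : WellFormed a) {c α : ℤ}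
    (h : ∀ i, c ∣ α * a i) : c ∣ α := by
  have h1 : ∀ i, c.natAbs ∣ α.natAbs * a i := fun i => by
    have := Int.natAbs_dvd_natAbs.2 (h i)
    rwa [Int.natAbs_mul, Int.natAbs_natCast] at this
  have h2 : c.natAbs ∣ (Finset.univ.erase (0 : Fin (n + 1))).gcd fun i => α.natAbs * a i :=
    Finset.dvd_gcd fun i _ => h1 i
  rw [Finset.gcd_mul_left, ha.gcd_eq_one 0, mul_one, normalize_eq] at h2
  exact Int.natAbs_dvd_natAbs.1 h2

lemma free_quotient {L : Type} [AddCommGroup L] [Module.Finite ℤ L] (K : Submodule ℤ L)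
    (h : ∀ (c : ℤ) (x : L), c ≠ 0 → c • x ∈ K → x ∈ K) : Module.Free ℤ (L ⧸ K) := by
  have : Module.IsTorsionFree ℤ (L ⧸ K) := by
    refine Module.IsTorsionFree.of_smul_eq_zero fun c => ?_
    intro y hy
    obtain ⟨x, rfl⟩ := K.mkQ_surjective y
    by_cases hc : c = 0
    · exact Or.inl hc
    · rw [← map_smul, Submodule.mkQ_apply, Submodule.Quotient.mk_eq_zero] at hy
      exact Or.inr ((Submodule.Quotient.mk_eq_zero K).2 (h c x hc hy))
  exact Module.free_of_finite_type_torsion_free'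

lemma exists_separating {ι : Type} [Fintype ι] {a : ι → ℕ} (ha : ∀ i, 0 < a i) {S T : Set ι}
    (hS : ∃ i, i ∉ S) (hT : ∃ i, i ∉ T) : ∃ w : ι → ℤ, (∀ i ∈ S, i ∉ T → 0 < w i) ∧
      (∀ i ∈ T, i ∉ S → w i < 0) ∧ (∀ i ∈ S, i ∈ T → w i = 0) ∧ ∑ i, w i * a i = 0 := by
  classical
  have hpos : ∀ R : Set ι, (∃ i, i ∉ R) → 0 < ∑ i, if i ∈ R then (0 : ℤ) else a i := by
    rintro R ⟨i, hi⟩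
    refine Finset.sum_pos' (fun j _ => by split_ifs <;> positivity) ⟨i, Finset.mem_univ i, ?_⟩
    rw [if_neg hi]
    exact_mod_cast ha i
  set A := ∑ i, if i ∈ S then (0 : ℤ) else a i with hA
  set B := ∑ i, if i ∈ T then (0 : ℤ) else a i with hB
  have hA0 : 0 < A := hpos S hS
  have hB0 : 0 < B := hpos T hT
  refine ⟨fun i => A * (if i ∈ T then 0 else 1) - B * (if i ∈ S then 0 else 1), ?_, ?_, ?_, ?_⟩
  · intro i hi hi'
    simpa [hi, hi'] using hA0
  · intro i hi hi'
    simpa [hi, hi'] using hB0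
  · intro i hi hi'
    simp [hi, hi']
  · have : ∀ i, (A * (if i ∈ T then 0 else 1) - B * (if i ∈ S then 0 else 1)) * (a i : ℤ) =
        A * (if i ∈ T then 0 else (a i : ℤ)) - B * (if i ∈ S then 0 else (a i : ℤ)) := by
      intro i
      split_ifs <;> ring
    simp only [this]
    rw [Finset.sum_sub_distrib, ← Finset.mul_sum, ← Finset.mul_sum, ← hA, ← hB]
    ring

lemma exists_separating_sum {ι : Type} [Fintype ι] {S T : Set ι}
    (hS : ∃ i, i ∉ S) (hT : ∃ i, i ∉ T) (D : ℤ) : ∃ w : ι → ℤ, (∀ i ∈ S, i ∉ T → 0 < w i) ∧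
      (∀ i ∈ T, i ∉ S → w i < 0) ∧ (∀ i ∈ S, i ∈ T → w i = 0) ∧ ∑ i, w i = D := by
  classical
  obtain ⟨w, h1, h2, h3, h4⟩ := exists_separating (a := fun _ : ι => 1) (fun _ => one_pos) hS hT
  simp only [Nat.cast_one, mul_one] at h4
  obtain ⟨s, hs⟩ := hS
  obtain ⟨t, ht⟩ := hT
  rcases le_total 0 D with hD | hD
  · refine ⟨fun i => w i + if i = t then D else 0, ?_, ?_, ?_, ?_⟩
    · intro i hi hi'
      have := h1 i hi hi'
      dsimp only
      split_ifs <;> omega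
    · intro i hi hi'
      have := h2 i hi hi'
      have hne : i ≠ t := by rintro rfl; exact ht hi
      simpa [hne] using this
    · intro i hi hi'
      have hne : i ≠ t := by rintro rfl; exact ht hi'
      simpa [hne] using h3 i hi hi'
    · rw [Finset.sum_add_distrib, h4]
      simp
  · refine ⟨fun i => w i + if i = s then D else 0, ?_, ?_, ?_, ?_⟩
    · intro i hi hi'
      have hne : i ≠ s := by rintro rfl; exact hs hi
      simpa [hne] using h1 i hi hi'
    · intro i hi hi'
      have := h2 i hi hi'
      dsimp only
      split_ifs <;> omega
    · intro i hi hi'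
      have hne : i ≠ s := by rintro rfl; exact hs hi
      simpa [hne] using h3 i hi hi'
    · rw [Finset.sum_add_distrib, h4]
      simp

section WeightedProjectiveSpace

variable {n : ℕ}

/-- The subgroup of `ℤ^(n+1)` generated by the vector `(a_0, …, a_n)`. -/
def wpsRel (a : Fin (n + 1) → ℕ) : Submodule ℤ (Fin (n + 1) → ℤ) :=
  Submodule.span ℤ {fun i => (a i : ℤ)}

/-- The lattice `ℤ^(n+1) / ℤ (a_0, …, a_n)` of the weighted projective space. -/
abbrev WpsLattice (a : Fin (n + 1) → ℕ) : Type := (Fin (n + 1) → ℤ) ⧸ wpsRel a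

lemma wpsLattice_free {a : Fin (n + 1) → ℕ} (ha : WellFormed a) :
    Module.Free ℤ (WpsLattice a) := by
  refine free_quotient _ fun c x hc hx => ?_
  obtain ⟨α, hα⟩ := Submodule.mem_span_singleton.1 hx
  have hi : ∀ i, α * a i = c * x i := fun i => by simpa using congrFun hα i
  obtain ⟨β, rfl⟩ := ha.dvd_of_forall_dvd fun i => ⟨x i, hi i⟩
  refine Submodule.mem_span_singleton.2 ⟨β, funext fun i => ?_⟩
  have h := hi i
  rw [mul_assoc] at h
  simpa using mul_left_cancel₀ hc h

/-- The image in the lattice of the weighted projective space of the standard basis vector `e_i`. -/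
def wpsRay (a : Fin (n + 1) → ℕ) (i : Fin (n + 1)) : WpsLattice a :=
  (wpsRel a).mkQ (Pi.single i 1)

lemma wps_separating {a : Fin (n + 1) → ℕ} (ha : ∀ i, 0 < a i) {S T : Set (Fin (n + 1))}
    (hS : ∃ i, i ∉ S) (hT : ∃ i, i ∉ T) : ∃ m : Module.Dual ℤ (WpsLattice a),
      (∀ i ∈ S, i ∉ T → 0 < m (wpsRay a i)) ∧ (∀ i ∈ T, i ∉ S → m (wpsRay a i) < 0) ∧
      ∀ i ∈ S, i ∈ T → m (wpsRay a i) = 0 := by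
  obtain ⟨w, h1, h2, h3, h4⟩ := exists_separating ha hS hT
  let l : (Fin (n + 1) → ℤ) →ₗ[ℤ] ℤ := ∑ i, w i • LinearMap.proj i
  have hl : wpsRel a ≤ LinearMap.ker l := by
    rw [wpsRel, Submodule.span_singleton_le_iff_mem, LinearMap.mem_ker]
    simpa [l] using h4
  have hm : ∀ i, (wpsRel a).liftQ l hl (wpsRay a i) = w i := fun i => by
    simp [wpsRay, l, Pi.single_apply]
  exact ⟨(wpsRel a).liftQ l hl, by simpa only [hm] using h1, by simpa only [hm] using h2,
    by simpa only [hm] using h3⟩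

/-- The fan of the weighted projective space `ℙ(a_0, …, a_n)`: the cones spanned by the images of
proper subsets of the standard basis of `ℤ^(n+1)` in `ℤ^(n+1) / ℤ (a_0, …, a_n)`. -/
noncomputable def wps (a : Fin (n + 1) → ℕ) (ha : WellFormed a) : Fan :=
  haveI := wpsLattice_free ha
  fanOfFamily (wpsRay a) {S | ∃ i, i ∉ S} ⟨0, Set.notMem_empty 0⟩
    (fun _ ⟨i, hi⟩ _ hT => ⟨i, fun h => hi (hT h)⟩)
    fun _ hS _ hT => wps_separating ha.pos hS hT

/-- The fan of the projective space `ℙ^k = ℙ(1, …, 1)`. -/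
noncomputable def projectiveSpace (k : ℕ) (hk : 0 < k) : Fan :=
  wps (fun _ : Fin (k + 1) => 1) (wellFormed_one hk)

end WeightedProjectiveSpace

section Bundle

variable {n : ℕ}

/-- The subgroup of `ℤ^(n+1) ⊕ ℤ^(k+1)` generated by the vectors `(a_0, …, a_n, 0, …, 0)` and
`(-d_0, …, -d_n, 1, …, 1)`. -/
def bundleRel (a : Fin (n + 1) → ℕ) (k : ℕ) (d : Fin (n + 1) → ℤ) :
    Submodule ℤ ((Fin (n + 1) → ℤ) × (Fin (k + 1) → ℤ)) :=
  Submodule.span ℤ {(fun i => (a i : ℤ), 0), (-d, 1)}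

/-- The lattice of the toric weighted projective bundle. -/
abbrev BundleLattice (a : Fin (n + 1) → ℕ) (k : ℕ) (d : Fin (n + 1) → ℤ) : Type :=
  ((Fin (n + 1) → ℤ) × (Fin (k + 1) → ℤ)) ⧸ bundleRel a k d

lemma mem_bundleRel {a : Fin (n + 1) → ℕ} {k : ℕ} {d : Fin (n + 1) → ℤ}
    {x : (Fin (n + 1) → ℤ) × (Fin (k + 1) → ℤ)} : x ∈ bundleRel a k d ↔
      ∃ α β : ℤ, (∀ i, x.1 i = α * a i - β * d i) ∧ ∀ j, x.2 j = β := by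
  rw [bundleRel, Submodule.mem_span_pair]
  constructor
  · rintro ⟨α, β, rfl⟩
    exact ⟨α, β, fun i => by simp [sub_eq_add_neg], fun j => by simp⟩
  · rintro ⟨α, β, h1, h2⟩
    refine ⟨α, β, Prod.ext (funext fun i => ?_) (funext fun j => ?_)⟩
    · simp [h1, sub_eq_add_neg]
    · simp [h2]

lemma bundleLattice_free {a : Fin (n + 1) → ℕ} (ha : WellFormed a) (k : ℕ) (d : Fin (n + 1) → ℤ) :
    Module.Free ℤ (BundleLattice a k d) := by
  refine free_quotient _ fun c x hc hx => ?_
  obtain ⟨α, β, h1, h2⟩ := mem_bundleRel.1 hx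
  simp only [Prod.smul_fst, Prod.smul_snd, Pi.smul_apply, smul_eq_mul] at h1 h2
  obtain ⟨β', rfl⟩ : c ∣ β := ⟨x.2 0, (h2 0).symm⟩
  have hi : ∀ i, α * a i = c * (x.1 i + β' * d i) := fun i => by linear_combination -(h1 i)
  obtain ⟨α', rfl⟩ := ha.dvd_of_forall_dvd fun i => ⟨_, hi i⟩
  refine mem_bundleRel.2 ⟨α', β', fun i => ?_, fun j => mul_left_cancel₀ hc (h2 j)⟩
  refine mul_left_cancel₀ hc ?_
  linear_combination h1 i

/-- The images in the lattice of the toric weighted projective bundle of the standard basis vectors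
`e_i` of `ℤ^(n+1)` and `f_j` of `ℤ^(k+1)`. -/
def bundleRay (a : Fin (n + 1) → ℕ) (k : ℕ) (d : Fin (n + 1) → ℤ) :
    Fin (n + 1) ⊕ Fin (k + 1) → BundleLattice a k d
  | Sum.inl i => (bundleRel a k d).mkQ (Pi.single i 1, 0)
  | Sum.inr j => (bundleRel a k d).mkQ (0, Pi.single j 1)

lemma bundle_separating {a : Fin (n + 1) → ℕ} (ha : ∀ i, 0 < a i) (k : ℕ) (d : Fin (n + 1) → ℤ)
    {S T : Set (Fin (n + 1) ⊕ Fin (k + 1))}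
    (hS : (∃ i, Sum.inl i ∉ S) ∧ ∃ j, Sum.inr j ∉ S)
    (hT : (∃ i, Sum.inl i ∉ T) ∧ ∃ j, Sum.inr j ∉ T) :
    ∃ m : Module.Dual ℤ (BundleLattice a k d),
      (∀ i ∈ S, i ∉ T → 0 < m (bundleRay a k d i)) ∧
      (∀ i ∈ T, i ∉ S → m (bundleRay a k d i) < 0) ∧
      ∀ i ∈ S, i ∈ T → m (bundleRay a k d i) = 0 := by
  obtain ⟨w, h1, h2, h3, h4⟩ := exists_separating (S := Sum.inl ⁻¹' S) (T := Sum.inl ⁻¹' T)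
    ha hS.1 hT.1
  obtain ⟨z, g1, g2, g3, g4⟩ := exists_separating_sum (S := Sum.inr ⁻¹' S) (T := Sum.inr ⁻¹' T)
    hS.2 hT.2 (∑ i, w i * d i)
  let l : ((Fin (n + 1) → ℤ) × (Fin (k + 1) → ℤ)) →ₗ[ℤ] ℤ :=
    (∑ i, w i • LinearMap.proj i) ∘ₗ LinearMap.fst ℤ _ _ +
      (∑ j, z j • LinearMap.proj j) ∘ₗ LinearMap.snd ℤ _ _
  have hl : bundleRel a k d ≤ LinearMap.ker l := by
    rw [bundleRel, Submodule.span_le]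
    rintro x (rfl | rfl)
    · change l _ = 0
      simpa [l] using h4
    · change l _ = 0
      simp [l, g4]
  have hm : ∀ i, (bundleRel a k d).liftQ l hl (bundleRay a k d i) = Sum.elim w z i := by
    rintro (i | j) <;> simp [bundleRay, l, Pi.single_apply]
  refine ⟨(bundleRel a k d).liftQ l hl, ?_, ?_, ?_⟩ <;> simp only [hm]
  · rintro (i | j) h h'
    exacts [h1 i h h', g1 j h h']
  · rintro (i | j) h h'
    exacts [h2 i h h', g2 j h h']
  · rintro (i | j) h h'
    exacts [h3 i h h', g3 j h h']

/-- The fan of the toric weighted projective bundle over `ℙ^k` with weights `a` and twists `d`: the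
cones spanned by the images of the sets of standard basis vectors of `ℤ^(n+1) ⊕ ℤ^(k+1)` that
contain neither all of the `e_i` nor all of the `f_j`. -/
noncomputable def bundle (a : Fin (n + 1) → ℕ) (ha : WellFormed a) (k : ℕ)
    (d : Fin (n + 1) → ℤ) : Fan :=
  haveI := bundleLattice_free ha k d
  fanOfFamily (bundleRay a k d) {S | (∃ i, Sum.inl i ∉ S) ∧ ∃ j, Sum.inr j ∉ S}
    ⟨⟨0, Set.notMem_empty _⟩, 0, Set.notMem_empty _⟩
    (fun _ ⟨⟨i, hi⟩, j, hj⟩ _ hT => ⟨⟨i, fun h => hi (hT h)⟩, j, fun h => hj (hT h)⟩)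
    fun _ hS _ hT => bundle_separating ha.pos k d hS hT

/-- The map of lattices induced by the inclusion of the first factor of `ℤ^(n+1) ⊕ ℤ^(k+1)`. -/
def bundleInclLin (a : Fin (n + 1) → ℕ) (k : ℕ) (d : Fin (n + 1) → ℤ) :
    WpsLattice a →ₗ[ℤ] BundleLattice a k d :=
  (wpsRel a).mapQ (bundleRel a k d) (LinearMap.inl ℤ _ _) <| by
    rw [wpsRel, Submodule.span_singleton_le_iff_mem]
    exact Submodule.subset_span (Or.inl rfl)

/-- The map of lattices induced by the projection of `ℤ^(n+1) ⊕ ℤ^(k+1)` to the second factor. -/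
def bundleProjLin (a : Fin (n + 1) → ℕ) (k : ℕ) (d : Fin (n + 1) → ℤ) :
    BundleLattice a k d →ₗ[ℤ] WpsLattice (fun _ : Fin (k + 1) => 1) :=
  (bundleRel a k d).mapQ (wpsRel fun _ : Fin (k + 1) => 1) (LinearMap.snd ℤ _ _) <| by
    rw [bundleRel, Submodule.span_le]
    rintro x (rfl | rfl)
    · exact Submodule.zero_mem (wpsRel fun _ : Fin (k + 1) => 1)
    · have h : (1 : Fin (k + 1) → ℤ) ∈ wpsRel (fun _ : Fin (k + 1) => 1) :=
        Submodule.mem_span_singleton.2 ⟨1, by ext; simp⟩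
      exact h

lemma baseChange_mem_coneSpan {N N' : Type} [AddCommGroup N] [AddCommGroup N'] (f : N →ₗ[ℤ] N')
    {s : Set N} {t : Set N'} (h : ∀ v ∈ s, f v ∈ t ∨ f v = 0) :
    ∀ x ∈ coneSpan s, f.baseChange ℝ x ∈ coneSpan t := by
  intro x hx
  refine coneSpan_induction (p := fun x => f.baseChange ℝ x ∈ coneSpan t) ?_ ?_ ?_ ?_ hx
  · intro v hv
    have hfv : f.baseChange ℝ (vec v) = vec (f v) := by simp [vec]
    rw [hfv]
    rcases h v hv with h | h
    · exact vec_mem_coneSpan h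
    · rw [h]
      simp [vec]
  · simp
  · intro x y hx hy
    rw [map_add]
    exact Submodule.add_mem _ hx hy
  · intro c hc x hx
    rw [map_smul]
    exact PointedCone.smul_mem _ hc hx

/-- The inclusion of the fan of the fibre `ℙ(a_0, …, a_n)`. -/
noncomputable def bundleIncl (a : Fin (n + 1) → ℕ) (ha : WellFormed a) (k : ℕ)
    (d : Fin (n + 1) → ℤ) : wps a ha ⟶ bundle a ha k d :=
  Fan.Hom.mk (X := wps a ha) (Y := bundle a ha k d) (bundleInclLin a k d) <| by
    rintro _ ⟨S, ⟨i, hi⟩, rfl⟩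
    refine ⟨_, ⟨Sum.inl '' S, ⟨⟨i, by simpa using hi⟩, 0, by simp⟩, rfl⟩, ?_⟩
    refine baseChange_mem_coneSpan (bundleInclLin a k d) ?_
    rintro _ ⟨i, hi, rfl⟩
    exact Or.inl ⟨Sum.inl i, ⟨i, hi, rfl⟩, rfl⟩

/-- The projection to the fan of the base `ℙ^k`. -/
noncomputable def bundleProj (a : Fin (n + 1) → ℕ) (ha : WellFormed a) (k : ℕ) (hk : 0 < k)
    (d : Fin (n + 1) → ℤ) : bundle a ha k d ⟶ projectiveSpace k hk :=
  Fan.Hom.mk (X := bundle a ha k d) (Y := projectiveSpace k hk) (bundleProjLin a k d) <| by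
    rintro _ ⟨S, ⟨-, j, hj⟩, rfl⟩
    refine ⟨_, ⟨Sum.inr ⁻¹' S, ⟨j, hj⟩, rfl⟩, ?_⟩
    refine baseChange_mem_coneSpan (bundleProjLin a k d) ?_
    rintro _ ⟨i | j, hi, rfl⟩
    · refine Or.inr ?_
      change (wpsRel fun _ : Fin (k + 1) => 1).mkQ 0 = 0
      exact map_zero _
    · exact Or.inl ⟨j, hi, rfl⟩

end Bundle

end Toric

/-!
Why the theorem is true. The combinatorics is read off from curve germs: a ring homomorphism from
`ℂ[S_σ]` to `ℂ⟦T⟧` is a germ of a curve in the chart `U_σ`, and the orders of the characters along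
a germ that is generically in the torus form a lattice vector (`Fan.exists_torus_order`). A lattice
vector `w` in a cone `σ` gives the germ `χ^m ↦ T^(m w)`, the limit of its one-parameter subgroup.

Since the fibration is a product over each chart of the base (`Fan.LocalTriv`), germs in `X` can be
glued from germs in the fibre `F` and in the base and taken apart again. With `F = ℙ(a_0, …, a_n)`,
`B = ℙ^k`, and `u_s`, `f_l` the primitive generators of the rays of these, this gives:

* The sequence of lattices of `F`, `X`, `B` is exact on the left and in the middle, because `F` is
  the fibre over the identity of the torus (`incl_injective`, `exists_of_proj_eq_zero`).
* A ray of `X` in the kernel of `π` is some `i u_s`, because `F` is complete and `u_s` is primitive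
  (`ray_kernel`).
* A ray of `X` outside the kernel maps to some `f_l`, and exactly one ray `v_l` maps to `f_l`
  (`ray_proj`, `exists_ray`, `ray_unique`). Indeed, the germ of every lattice vector in the
  relative interior of the cone that has `π v` in its relative interior lifts to a germ in `X`,
  which is compared with the one of `v` (`LocalTriv.exists_mul_of_ray`).
* The fan of `X` is complete: the one-parameter subgroup of any `w` splits into torus points of `F`
  and `B` over the Laurent series, and these have limits (`complete`).

Now `∑ f_l = 0`, so that `∑ v_l` is `i (∑ d_s u_s)` for some integers `d_s`, and exactness
identifies the lattice of `X` with the one of the bundle with twists `d` (`exists_equiv`). The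
relations `∑ a_s u_s = 0` and `∑ f_l = 0` and strong convexity show that no cone of `X` contains
all `u_s` or all `v_l`, so each cone of `X` is a cone of the bundle (`exists_eq_coneSpan`); by
completeness of `X` and the separation of the cones of the bundle all of these occur
(`exists_cone_of_complete`).
-/

namespace Toric

/-! ### Linear alternatives over the integers and the rays of a fan -/

section Lattice

variable {N : Type} [AddCommGroup N]

lemma vec_add (v w : N) : vec (v + w) = vec v + vec w := TensorProduct.tmul_add _ _ _

lemma vec_zero : vec (0 : N) = 0 := TensorProduct.tmul_zero _ _

lemma vec_neg (v : N) : vec (-v) = -vec v := TensorProduct.tmul_neg _ _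

lemma vec_zsmul (c : ℤ) (v : N) : vec (c • v) = (c : ℝ) • vec v := by
  rw [vec, vec, TensorProduct.tmul_smul, ← Int.cast_smul_eq_zsmul ℝ]

lemma vec_nsmul (c : ℕ) (v : N) : vec (c • v) = (c : ℝ) • vec v := by
  simpa using vec_zsmul (c : ℤ) v

lemma baseChange_vec {N' : Type} [AddCommGroup N'] (f : N →ₗ[ℤ] N') (v : N) :
    f.baseChange ℝ (vec v) = vec (f v) := by
  simp [vec]

lemma vec_sum_mem {ι : Type} {σ : PointedCone ℝ (RealSpace N)} (s : Finset ι) (c : ι → ℕ)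
    (x : ι → N) (h : ∀ i ∈ s, vec (x i) ∈ σ) : vec (∑ i ∈ s, c i • x i) ∈ σ := by
  classical
  induction s using Finset.induction_on with
  | empty => rw [Finset.sum_empty, vec_zero]; exact Submodule.zero_mem _
  | insert i s hi ih =>
    rw [Finset.sum_insert hi, vec_add, vec_nsmul]
    exact Submodule.add_mem _ (PointedCone.smul_mem _ (Nat.cast_nonneg _) (h i (by simp)))
      (ih fun j hj => h j (by simp [hj]))

lemma vec_mem_of_nsmul_mem {σ : PointedCone ℝ (RealSpace N)} {c : ℕ} (hc : 0 < c) {v : N}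
    (h : vec (c • v) ∈ σ) : vec v ∈ σ := by
  have hc' : (0 : ℝ) < c := by exact_mod_cast hc
  have := PointedCone.smul_mem σ (inv_nonneg.2 hc'.le) h
  rwa [vec_nsmul, smul_smul, inv_mul_cancel₀ hc'.ne', one_smul] at this

lemma mem_coneSpan_singleton {v : N} {x : RealSpace N} :
    x ∈ coneSpan {v} ↔ ∃ r : ℝ, 0 ≤ r ∧ x = r • vec v := by
  constructor
  · intro hx
    refine coneSpan_induction (p := fun x => ∃ r : ℝ, 0 ≤ r ∧ x = r • vec v) ?_ ?_ ?_ ?_ hx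
    · rintro _ rfl; exact ⟨1, zero_le_one, by simp⟩
    · exact ⟨0, le_rfl, by simp⟩
    · rintro _ _ ⟨r, hr, rfl⟩ ⟨t, ht, rfl⟩; exact ⟨r + t, add_nonneg hr ht, by rw [add_smul]⟩
    · rintro c hc _ ⟨r, hr, rfl⟩; exact ⟨c * r, mul_nonneg hc hr, by rw [mul_smul]⟩
  · rintro ⟨r, hr, rfl⟩
    exact PointedCone.smul_mem _ hr (vec_mem_coneSpan rfl)

lemma coneSpan_le {s : Set N} {σ : PointedCone ℝ (RealSpace N)} (h : ∀ v ∈ s, vec v ∈ σ) :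
    coneSpan s ≤ σ := by
  refine Submodule.span_le.2 ?_
  rintro _ ⟨v, hv, rfl⟩
  exact h v hv

lemma mem_dualMonoid_coneSpan {s : Set N} {m : Module.Dual ℤ N} :
    m ∈ dualMonoid (coneSpan s) ↔ ∀ v ∈ s, 0 ≤ m v := by
  refine ⟨fun h v hv => ?_, fun h x hx => realForm_nonneg_of_coneSpan h hx⟩
  have := h _ (vec_mem_coneSpan hv)
  rw [realForm_vec] at this
  exact_mod_cast this

lemma apply_nonneg_of_mem {σ : PointedCone ℝ (RealSpace N)} {m : Module.Dual ℤ N}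
    (hm : m ∈ dualMonoid σ) {v : N} (hv : vec v ∈ σ) : 0 ≤ m v := by
  have := hm _ hv
  rw [realForm_vec] at this
  exact_mod_cast this

lemma mem_dualMonoid_bot (m : Module.Dual ℤ N) :
    m ∈ dualMonoid (⊥ : PointedCone ℝ (RealSpace N)) := by
  intro x hx
  rw [(Submodule.mem_bot _).1 hx, map_zero]

section Free

variable [Module.Free ℤ N]

lemma eq_of_forall_dual {v w : N} (h : ∀ m : Module.Dual ℤ N, m v = m w) : v = w := by
  rw [← sub_eq_zero]
  refine (Module.forall_dual_apply_eq_zero_iff ℤ _).1 fun m => ?_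
  rw [map_sub, h, sub_self]

lemma vec_injective : Function.Injective (vec : N → RealSpace N) := by
  intro v w h
  refine eq_of_forall_dual fun m => ?_
  have := congrArg (realForm m) h
  rw [realForm_vec, realForm_vec] at this
  exact_mod_cast this

/-- Farkas' lemma for lattice vectors: a positive multiple of `w` is a combination of the `x i`
with natural coefficients, or an integral linear form separates `w` from the `x i`. The induction
removes one generator `y`: the form obtained for the others is negative on `y` in the essential
case, and the remaining vectors are projected along `y` onto its kernel. -/
theorem farkas {ι : Type} (s : Finset ι) (x : ι → N) (w : N) :
    (∃ (c₀ : ℕ) (c : ι → ℕ), 0 < c₀ ∧ c₀ • w = ∑ i ∈ s, c i • x i) ∨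
      ∃ m : Module.Dual ℤ N, (∀ i ∈ s, 0 ≤ m (x i)) ∧ m w < 0 := by
  classical
  induction s using Finset.induction_on generalizing x w with
  | empty =>
    by_cases hw : w = 0
    · exact Or.inl ⟨1, 0, one_pos, by simp [hw]⟩
    · obtain ⟨m, hm⟩ : ∃ m : Module.Dual ℤ N, m w ≠ 0 := by
        by_contra! h
        exact hw ((Module.forall_dual_apply_eq_zero_iff ℤ _).1 h)
      rcases lt_or_gt_of_ne hm with h | h
      · exact Or.inr ⟨m, by simp, h⟩
      · exact Or.inr ⟨-m, by simp, by simpa using h⟩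
  | insert j s hj ih =>
    rcases ih x w with ⟨c₀, c, h0, h⟩ | ⟨m, hm, hw⟩
    · refine Or.inl ⟨c₀, Function.update c j 0, h0, ?_⟩
      rw [Finset.sum_insert hj, h, Function.update_self, zero_smul, zero_add]
      refine Finset.sum_congr rfl fun i hi => ?_
      rw [Function.update_of_ne (ne_of_mem_of_not_mem hi hj)]
    by_cases hy : 0 ≤ m (x j)
    · exact Or.inr ⟨m, by simpa [hy] using hm, hw⟩
    push Not at hy
    rcases ih (fun i => (-m (x j)) • x i + m (x i) • x j) ((-m (x j)) • w + m w • x j) with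
      ⟨c₀, c, h0, h⟩ | ⟨m', hm', hw'⟩
    · left
      have hA : (0 : ℤ) ≤ ∑ i ∈ s, (c i : ℤ) * m (x i) - c₀ * m w :=
        sub_nonneg.2 (le_trans (mul_nonpos_of_nonneg_of_nonpos (by positivity) hw.le)
          (Finset.sum_nonneg fun i hi => mul_nonneg (by positivity) (hm i hi)))
      refine ⟨c₀ * (-m (x j)).toNat, fun i => if i = j then
        (∑ i ∈ s, (c i : ℤ) * m (x i) - c₀ * m w).toNat else c i * (-m (x j)).toNat,
        mul_pos h0 (by omega), ?_⟩
      beta_reduce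
      rw [Finset.sum_insert hj, if_pos rfl]
      have h2 : ∑ i ∈ s, (if i = j then (∑ i ∈ s, (c i : ℤ) * m (x i) - c₀ * m w).toNat
          else c i * (-m (x j)).toNat) • x i = ∑ i ∈ s, ((c i : ℤ) * (-m (x j))) • x i := by
        refine Finset.sum_congr rfl fun i hi => ?_
        rw [if_neg (ne_of_mem_of_not_mem hi hj), ← natCast_zsmul]
        congr 1
        push_cast
        rw [Int.toNat_of_nonneg (by omega)]
      rw [h2, ← natCast_zsmul, ← natCast_zsmul (x j), Int.toNat_of_nonneg hA]
      push_cast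
      rw [Int.toNat_of_nonneg (by omega)]
      have h3 : (c₀ : ℤ) • ((-m (x j)) • w + m w • x j) =
          ∑ i ∈ s, (((c i : ℤ) * (-m (x j))) • x i + ((c i : ℤ) * m (x i)) • x j) := by
        rw [natCast_zsmul, h]
        refine Finset.sum_congr rfl fun i _ => ?_
        rw [← natCast_zsmul, smul_add, smul_smul, smul_smul]
      rw [Finset.sum_add_distrib, ← Finset.sum_smul, smul_add, smul_smul, smul_smul] at h3
      rw [sub_smul, eq_sub_of_add_eq h3]
      abel
    · refine Or.inr ⟨(-m (x j)) • m' + m' (x j) • m, ?_, ?_⟩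
      · intro i hi
        rcases Finset.mem_insert.1 hi with rfl | hi
        · simp only [LinearMap.add_apply, LinearMap.smul_apply, smul_eq_mul]
          linarith
        · have := hm' i hi
          simp only [map_add, map_smul, LinearMap.add_apply, LinearMap.smul_apply,
            smul_eq_mul] at this ⊢
          linarith
      · simp only [map_add, map_smul, LinearMap.add_apply, LinearMap.smul_apply,
          smul_eq_mul] at hw' ⊢
        linarith

/-- A nonzero vector of a lattice is a positive multiple of a primitive one, that is, of one on
which some integral linear form takes the value `1`. -/
lemma exists_primitive [Module.Finite ℤ N] {v : N} (hv : v ≠ 0) :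
    ∃ (g : ℕ) (v' : N) (m : Module.Dual ℤ N), 0 < g ∧ v = g • v' ∧ m v' = 1 := by
  let b := Module.Free.chooseBasis ℤ N
  let ev : Module.Dual ℤ N →ₗ[ℤ] ℤ := Module.Dual.eval ℤ N v
  obtain ⟨g, hg⟩ := (IsPrincipalIdealRing.principal (LinearMap.range ev)).principal
  have hmem : ∀ m : Module.Dual ℤ N, g ∣ m v := fun m => by
    have : m v ∈ LinearMap.range ev := ⟨m, rfl⟩
    rw [hg] at this
    exact Ideal.mem_span_singleton.1 this
  have hg0 : g ≠ 0 := by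
    rintro rfl
    refine hv (eq_of_forall_dual fun m => ?_)
    rw [map_zero, zero_dvd_iff.1 (hmem m)]
  have hdvd : ∀ i, ∃ c, b.repr v i = g * c := fun i => hmem (b.coord i)
  choose c hc using hdvd
  obtain ⟨m, hm⟩ : g ∈ LinearMap.range ev := by
    rw [hg]; exact Submodule.mem_span_singleton_self g
  have hm : m v = g := hm
  have hv' : v = g • ∑ i, c i • b i := by
    conv_lhs => rw [← b.sum_repr v]
    rw [Finset.smul_sum]
    exact Finset.sum_congr rfl fun i _ => by rw [hc, mul_smul]
  have h1 : m (∑ i, c i • b i) = 1 := by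
    rw [hv', map_smul, smul_eq_mul] at hm
    exact mul_left_cancel₀ hg0 (by rw [hm, mul_one])
  rcases le_total 0 g with h | h
  · refine ⟨g.toNat, _, m, by omega, ?_, h1⟩
    rw [← natCast_zsmul, Int.toNat_of_nonneg h]
    exact hv'
  · refine ⟨(-g).toNat, -∑ i, c i • b i, -m, by omega, ?_, by simpa using h1⟩
    rw [← natCast_zsmul, Int.toNat_of_nonneg (by omega), smul_neg, neg_smul, neg_neg]
    exact hv'

/-- An irredundant generator of a strongly convex cone spans a face. -/
lemma isFace_of_irredundant [DecidableEq N] {s : Finset N}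
    (hsc : ∀ x ∈ coneSpan (s : Set N), -x ∈ coneSpan (s : Set N) → x = 0)
    (hmin : ∀ u ∈ s, vec u ∉ coneSpan ((s.erase u : Finset N) : Set N)) {v : N} (hv : v ∈ s) :
    IsFace (coneSpan {v}) (coneSpan (s : Set N)) := by
  have hne : ∀ u ∈ s, vec u ≠ 0 := fun u hu h => hmin u hu (h ▸ Submodule.zero_mem _)
  have key : ∀ u ∈ s.erase v, ∃ m : Module.Dual ℤ N, (∀ y ∈ s, 0 ≤ m y) ∧ m v = 0 ∧ 0 < m u := by
    intro u hu
    have hus := Finset.mem_of_mem_erase hu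
    rcases farkas (Finset.univ : Finset (s ⊕ Unit)) (Sum.elim (fun y => (y : N)) fun _ => -v) (-u)
      with ⟨c₀, c, h0, h⟩ | ⟨m, hm, hw⟩
    · exfalso
      rw [Fintype.sum_sum_type, Fintype.sum_unique (ι := Unit)] at h
      simp only [Sum.elim_inl, Sum.elim_inr] at h
      set z : N := ∑ y ∈ (Finset.univ : Finset s).erase ⟨v, hv⟩, c (Sum.inl y) • (y : N) with hz
      rw [← Finset.add_sum_erase _ _ (Finset.mem_univ (⟨v, hv⟩ : s)), ← hz] at h
      have hzm : vec z ∈ coneSpan ((s.erase v : Finset N) : Set N) := by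
        refine vec_sum_mem _ _ _ fun y hy => vec_mem_coneSpan ?_
        rw [Finset.coe_erase]
        exact ⟨y.2, fun h => (Finset.mem_erase.1 hy).1 (Subtype.ext h)⟩
      have hum : vec u ∈ coneSpan ((s.erase v : Finset N) : Set N) := vec_mem_coneSpan hu
      -- the relation reads `c₀ u + z = (q - p) v`
      have hsub : coneSpan ((s.erase v : Finset N) : Set N) ≤ coneSpan (s : Set N) :=
        coneSpan_mono (by simp)
      set p := c (Sum.inl ⟨v, hv⟩)
      set q := c (Sum.inr default)
      have hrel : vec (c₀ • u + z + p • v) = vec (q • v) := by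
        congr 1
        rw [smul_neg, smul_neg, neg_eq_iff_eq_neg] at h
        rw [h]
        abel
      rw [vec_add, vec_add, vec_nsmul, vec_nsmul, vec_nsmul] at hrel
      rcases lt_or_ge p q with hpq | hpq
      · have hpq' : (0 : ℝ) < q - p := sub_pos.2 (by exact_mod_cast hpq)
        refine hmin v hv ?_
        have : vec v = ((q : ℝ) - p)⁻¹ • ((c₀ : ℝ) • vec u + vec z) := by
          rw [eq_inv_smul_iff₀ hpq'.ne', sub_smul, ← hrel]
          abel
        rw [this]
        exact PointedCone.smul_mem _ (inv_nonneg.2 hpq'.le)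
          (Submodule.add_mem _ (PointedCone.smul_mem _ (Nat.cast_nonneg _) hum) hzm)
      · have hpq' : (0 : ℝ) ≤ (p : ℝ) - q := sub_nonneg.2 (by exact_mod_cast hpq)
        have h0' : (0 : ℝ) < c₀ := by exact_mod_cast h0
        refine hne u hus (hsc _ (vec_mem_coneSpan hus) ?_)
        have : -vec u = (c₀ : ℝ)⁻¹ • (vec z + ((p : ℝ) - q) • vec v) := by
          rw [eq_inv_smul_iff₀ h0'.ne', sub_smul, ← hrel, smul_neg]
          abel
        rw [this]
        exact PointedCone.smul_mem _ (inv_nonneg.2 h0'.le) (Submodule.add_mem _ (hsub hzm)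
          (PointedCone.smul_mem _ hpq' (vec_mem_coneSpan hv)))
    · have h1 : ∀ y ∈ s, 0 ≤ m y := fun y hy => hm (Sum.inl ⟨y, hy⟩) (Finset.mem_univ _)
      have h2 := hm (Sum.inr ()) (Finset.mem_univ _)
      rw [Sum.elim_inr, map_neg] at h2
      rw [map_neg] at hw
      exact ⟨m, h1, le_antisymm (by omega) (h1 v hv), by omega⟩
  choose! m hm using key
  have hnn : ∀ y ∈ (s : Set N), 0 ≤ (∑ u ∈ s.erase v, m u) y := fun y hy => by
    rw [LinearMap.sum_apply]
    exact Finset.sum_nonneg fun u hu => (hm u hu).1 y hy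
  have hset : {y ∈ (s : Set N) | (∑ u ∈ s.erase v, m u) y = 0} = {v} := by
    ext y
    constructor
    · rintro ⟨hy, h0⟩
      by_contra hyv
      have hy' : y ∈ s.erase v := Finset.mem_erase.2 ⟨hyv, hy⟩
      rw [LinearMap.sum_apply, Finset.sum_eq_zero_iff_of_nonneg
        fun u hu => (hm u hu).1 y hy] at h0
      exact (hm y hy').2.2.ne' (h0 y hy')
    · rintro rfl
      refine ⟨hv, ?_⟩
      rw [LinearMap.sum_apply]
      exact Finset.sum_eq_zero fun u hu => (hm u hu).2.1
  refine ⟨_, fun x hx => realForm_nonneg_of_coneSpan hnn hx, fun x => ?_⟩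
  rw [← hset]
  exact mem_coneSpan_zero_iff hnn x

end Free

end Lattice

namespace Fan

/-- A primitive generator of a one-dimensional cone of the fan. -/
def IsRay (X : Fan) (v : X.N) : Prop :=
  coneSpan {v} ∈ X.cones ∧ ∃ m : Module.Dual ℤ X.N, m v = 1

lemma IsRay.ne_zero {X : Fan} {v : X.N} (hv : X.IsRay v) : v ≠ 0 := by
  rintro rfl
  obtain ⟨m, hm⟩ := hv.2
  simp at hm

/-- Two rays spanning the same half-line are equal. -/
lemma IsRay.eq_of_vec_mem {X : Fan} {v w : X.N} (hv : X.IsRay v) (hw : X.IsRay w)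
    (h : vec w ∈ coneSpan {v}) : w = v := by
  obtain ⟨r, hr, hr'⟩ := mem_coneSpan_singleton.1 h
  obtain ⟨m, hm⟩ := hv.2
  obtain ⟨m', hm'⟩ := hw.2
  have h1 : (m w : ℝ) = r := by
    rw [← realForm_vec, hr', map_smul, realForm_vec, hm]; simp
  have h2 : w = m w • v := vec_injective (by rw [hr', vec_zsmul, h1])
  have h3 : m w * m' v = 1 := by rw [← hm', h2]; simp [hm]
  have h4 : 0 ≤ m w := by exact_mod_cast h1 ▸ hr
  rcases Int.eq_one_or_neg_one_of_mul_eq_one h3 with h | h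
  · rw [h2, h, one_smul]
  · omega

/-- Every cone of a fan is spanned by rays of the fan. -/
theorem exists_rays (X : Fan) {σ : PointedCone ℝ (RealSpace X.N)} (hσ : σ ∈ X.cones) :
    ∃ s : Set X.N, σ = coneSpan s ∧ ∀ v ∈ s, X.IsRay v := by
  classical
  obtain ⟨s₀, hs₀, hσs₀⟩ := X.rational σ hσ
  have hex : ∃ c, ∃ s : Finset X.N, s.card = c ∧ σ = coneSpan (s : Set X.N) :=
    ⟨_, hs₀.toFinset, rfl, by rw [hs₀.coe_toFinset]; exact hσs₀⟩
  obtain ⟨s, hsc, hs⟩ := Nat.find_spec hex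
  have hmin : ∀ u ∈ s, vec u ∉ coneSpan ((s.erase u : Finset X.N) : Set X.N) := by
    intro u hu h
    refine Nat.find_min hex (m := (s.erase u).card) (by
      rw [← hsc]; exact Finset.card_erase_lt_of_mem hu) ⟨_, rfl, ?_⟩
    rw [hs]
    refine le_antisymm (coneSpan_le fun y hy => ?_) (coneSpan_mono (by simp))
    by_cases hyu : y = u
    · rw [hyu]; exact h
    · exact vec_mem_coneSpan (Finset.mem_erase.2 ⟨hyu, hy⟩)
  have hray : ∀ v ∈ s, ∃ v', X.IsRay v' ∧ vec v' ∈ σ ∧ vec v ∈ coneSpan {v'} := by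
    intro v hv
    have hv0 : v ≠ 0 := by
      rintro rfl
      exact hmin 0 hv (vec_zero (N := X.N) ▸ Submodule.zero_mem _)
    obtain ⟨g, v', m, hg, hvv, hm⟩ := exists_primitive hv0
    have h1 : vec v ∈ coneSpan {v'} := by
      rw [hvv, vec_nsmul]
      exact PointedCone.smul_mem _ (Nat.cast_nonneg _) (vec_mem_coneSpan rfl)
    have h2 : vec v' ∈ coneSpan {v} :=
      vec_mem_of_nsmul_mem hg (hvv ▸ vec_mem_coneSpan rfl)
    have h3 : coneSpan {v'} = coneSpan {v} :=
      le_antisymm (coneSpan_le fun y hy => by rw [Set.mem_singleton_iff.1 hy]; exact h2)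
        (coneSpan_le fun y hy => by rw [Set.mem_singleton_iff.1 hy]; exact h1)
    refine ⟨v', ⟨?_, m, hm⟩, ?_, h1⟩
    · rw [h3]
      refine X.face_mem σ hσ _ ?_
      have := isFace_of_irredundant (hs ▸ X.strongly_convex σ hσ) hmin hv
      rwa [← hs] at this
    · rw [hs]
      exact coneSpan_mono (by simpa using hv) h2
  choose! p hp using hray
  refine ⟨p '' s, le_antisymm ?_ (coneSpan_le ?_), ?_⟩
  · conv_lhs => rw [hs]
    refine coneSpan_le fun v hv => coneSpan_mono ?_ (hp v hv).2.2
    simpa using ⟨v, hv, rfl⟩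
  · rintro _ ⟨v, hv, rfl⟩
    exact (hp v hv).2.1
  · rintro _ ⟨v, hv, rfl⟩
    exact (hp v hv).1

/-- A cone of the fan containing a ray has the ray as a face. -/
lemma IsRay.isFace {X : Fan} {v : X.N} (hv : X.IsRay v) {σ : PointedCone ℝ (RealSpace X.N)}
    (hσ : σ ∈ X.cones) (h : vec v ∈ σ) : IsFace (coneSpan {v}) σ :=
  X.isFace_of_le hσ hv.1 (coneSpan_le fun y hy => by rw [Set.mem_singleton_iff.1 hy]; exact h)

end Fan

/-! ### Weighted projective spaces -/

section Wps

variable {n : ℕ} (a : Fin (n + 1) → ℕ) (ha : WellFormed a)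

/-- The image `u_i` of the standard basis vector `e_i`, as an element of the lattice of the fan
`wps a ha`. -/
def wpsVec (i : Fin (n + 1)) : (wps a ha).N := wpsRay a i

variable {a} {ha}

lemma wps_coneSpan_mem {S : Set (Fin (n + 1))} (hS : ∃ i, i ∉ S) :
    coneSpan (wpsVec a ha '' S) ∈ (wps a ha).cones := ⟨S, hS, rfl⟩

lemma wps_exists_of_mem {σ : PointedCone ℝ (RealSpace (wps a ha).N)} (hσ : σ ∈ (wps a ha).cones) :
    ∃ S : Set (Fin (n + 1)), (∃ i, i ∉ S) ∧ σ = coneSpan (wpsVec a ha '' S) := hσ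

lemma mkQ_eq_sum (x : Fin (n + 1) → ℤ) : (wpsRel a).mkQ x = ∑ i, x i • wpsRay a i := by
  conv_lhs => rw [← Finset.univ_sum_single x]
  rw [map_sum]
  refine Finset.sum_congr rfl fun i _ => ?_
  rw [wpsRay, ← map_smul, ← Pi.single_smul, smul_eq_mul, mul_one]

lemma wps_span (w : (wps a ha).N) : ∃ x : Fin (n + 1) → ℤ, w = ∑ i, x i • wpsVec a ha i := by
  obtain ⟨x, hx⟩ := (wpsRel a).mkQ_surjective w
  exact ⟨x, hx.symm.trans (mkQ_eq_sum x)⟩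

lemma wps_sum_eq_zero_iff (x : Fin (n + 1) → ℤ) :
    ∑ i, x i • wpsVec a ha i = 0 ↔ ∃ α : ℤ, ∀ i, x i = α * a i := by
  have h : ∑ i, x i • wpsVec a ha i = 0 ↔ (wpsRel a).mkQ x = 0 := by rw [mkQ_eq_sum]; rfl
  rw [h, Submodule.mkQ_apply, Submodule.Quotient.mk_eq_zero, wpsRel,
    Submodule.mem_span_singleton]
  constructor
  · rintro ⟨α, rfl⟩
    exact ⟨α, fun i => by simp⟩
  · rintro ⟨α, h⟩
    exact ⟨α, funext fun i => by simp [h]⟩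

lemma wps_sum_weights : ∑ i, (a i : ℤ) • wpsVec a ha i = 0 :=
  (wps_sum_eq_zero_iff _).2 ⟨1, fun i => by simp⟩

/-- Completeness of the fan of the weighted projective space: a positive multiple of each lattice
vector is a natural combination of the `u_i` in which some `u_j` does not occur. -/
lemma wps_complete (w : (wps a ha).N) : ∃ (j : Fin (n + 1)) (c : Fin (n + 1) → ℕ), c j = 0 ∧
    a j • w = ∑ i, c i • wpsVec a ha i := by
  obtain ⟨x, rfl⟩ := wps_span w
  -- the coefficient to be cancelled is the one for which `x j / a j` is minimal
  obtain ⟨j, -, hj⟩ := Finset.exists_min_image Finset.univ (fun i => (x i : ℚ) / a i) ⟨0, by simp⟩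
  have hle : ∀ i, 0 ≤ a j * x i - x j * a i := fun i => by
    have h1 : (0 : ℚ) < a i := by exact_mod_cast ha.pos i
    have h2 : (0 : ℚ) < a j := by exact_mod_cast ha.pos j
    have := hj i (Finset.mem_univ i)
    rw [div_le_div_iff₀ h2 h1] at this
    have : x j * a i ≤ x i * a j := by exact_mod_cast this
    linarith
  refine ⟨j, fun i => (a j * x i - x j * a i).toNat, by simp [mul_comm], ?_⟩
  have h : ∀ i, (a j * x i - x j * a i).toNat • wpsVec a ha i =
      (a j : ℤ) • x i • wpsVec a ha i - x j • (a i : ℤ) • wpsVec a ha i := fun i => by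
    rw [← natCast_zsmul, Int.toNat_of_nonneg (hle i), sub_smul, mul_smul, mul_smul]
  rw [Finset.sum_congr rfl fun i _ => h i, Finset.sum_sub_distrib, ← Finset.smul_sum,
    ← Finset.smul_sum, wps_sum_weights, smul_zero, sub_zero, natCast_zsmul]

lemma wps_exists_dual {x : Fin (n + 1) → ℤ} (hx : ∑ i, x i * a i = 0) :
    ∃ m : Module.Dual ℤ (wps a ha).N, ∀ i, m (wpsVec a ha i) = x i := by
  let l : (Fin (n + 1) → ℤ) →ₗ[ℤ] ℤ := ∑ i, x i • LinearMap.proj i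
  have hl : wpsRel a ≤ LinearMap.ker l := by
    rw [wpsRel, Submodule.span_singleton_le_iff_mem, LinearMap.mem_ker]
    simpa [l] using hx
  refine ⟨(wpsRel a).liftQ l hl, fun i => ?_⟩
  have : (wpsRel a).liftQ l hl (wpsRay a i) = x i := by simp [wpsRay, l, Pi.single_apply]
  exact this

lemma wpsVec_ne_zero (i : Fin (n + 1)) : wpsVec a ha i ≠ 0 := by
  intro h
  have h1 : ∑ l, (if l = i then (1 : ℤ) else 0) • wpsVec a ha l = 0 := by simp [h]
  obtain ⟨α, hα⟩ := (wps_sum_eq_zero_iff _).1 h1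
  have hn : Nontrivial (Fin (n + 1)) := by
    by_contra hn
    rw [not_nontrivial_iff_subsingleton] at hn
    have := ha.gcd_eq_one i
    rw [Finset.eq_empty_of_forall_notMem (s := Finset.univ.erase i) fun j hj =>
      (Finset.mem_erase.1 hj).1 (Subsingleton.elim _ _), Finset.gcd_empty] at this
    exact zero_ne_one this
  obtain ⟨l, hl⟩ := exists_ne i
  have h2 := hα l
  have h3 := hα i
  rw [if_neg hl, eq_comm, mul_eq_zero] at h2
  rcases h2 with h2 | h2
  · rw [h2, if_pos rfl, zero_mul] at h3
    exact one_ne_zero h3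
  · exact (ha.pos l).ne' (by exact_mod_cast h2)

/-- The `u_i` are primitive, because the weights other than `a_i` have greatest common divisor
`1`. -/
lemma wpsVec_primitive {i : Fin (n + 1)} {c : ℤ} {w : (wps a ha).N}
    (h : wpsVec a ha i = c • w) : c = 1 ∨ c = -1 := by
  obtain ⟨x, rfl⟩ := wps_span w
  have h1 : ∑ l, ((if l = i then (1 : ℤ) else 0) - c * x l) • wpsVec a ha l = 0 := by
    simp only [sub_smul, Finset.sum_sub_distrib, mul_smul, ← Finset.smul_sum, ← h]
    simp
  obtain ⟨α, hα⟩ := (wps_sum_eq_zero_iff _).1 h1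
  have h2 : c.natAbs ∣ (Finset.univ.erase i).gcd fun l => α.natAbs * a l := by
    refine Finset.dvd_gcd fun l hl => ?_
    have h3 := hα l
    rw [if_neg (Finset.mem_erase.1 hl).1] at h3
    have := Int.natAbs_dvd_natAbs.2 (show c ∣ α * a l from ⟨-x l, by rw [← h3]; ring⟩)
    rwa [Int.natAbs_mul, Int.natAbs_natCast] at this
  rw [Finset.gcd_mul_left, ha.gcd_eq_one i, mul_one, normalize_eq] at h2
  obtain ⟨β, hβ⟩ := Int.natAbs_dvd_natAbs.1 h2
  have h4 := hα i
  rw [if_pos rfl, hβ] at h4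
  exact Int.isUnit_iff.1 (IsUnit.of_mul_eq_one (x i + β * a i) (by linear_combination -h4))

end Wps

section ProjectiveSpace

variable {k : ℕ} {hk : 0 < k}

variable (hk) in
/-- The primitive generators `f_0, …, f_k` of the rays of the fan of `ℙ^k`. -/
noncomputable def projVec (l : Fin (k + 1)) : (projectiveSpace k hk).N :=
  wpsVec (fun _ => 1) (wellFormed_one hk) l

lemma proj_sum : ∑ l, projVec hk l = 0 := by
  have h : ∑ l, wpsVec (fun _ : Fin (k + 1) => 1) (wellFormed_one hk) l = 0 := by
    simpa using wps_sum_weights (a := fun _ : Fin (k + 1) => 1) (ha := wellFormed_one hk)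
  exact h

lemma proj_complete (w : (projectiveSpace k hk).N) :
    ∃ (j : Fin (k + 1)) (c : Fin (k + 1) → ℕ), c j = 0 ∧ w = ∑ i, c i • projVec hk i := by
  have h (w : (wps (fun _ : Fin (k + 1) => 1) (wellFormed_one hk)).N) :
      ∃ (j : Fin (k + 1)) (c : Fin (k + 1) → ℕ), c j = 0 ∧ w = ∑ i, c i • wpsVec _ _ i := by
    obtain ⟨j, c, hj, h⟩ := wps_complete w
    exact ⟨j, c, hj, by simpa using h⟩
  exact h w

lemma proj_coneSpan_mem {T : Set (Fin (k + 1))} (hT : ∃ l, l ∉ T) :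
    coneSpan (projVec hk '' T) ∈ (projectiveSpace k hk).cones := wps_coneSpan_mem hT

lemma proj_exists_of_mem {σ : PointedCone ℝ (RealSpace (projectiveSpace k hk).N)}
    (hσ : σ ∈ (projectiveSpace k hk).cones) :
    ∃ T : Set (Fin (k + 1)), (∃ l, l ∉ T) ∧ σ = coneSpan (projVec hk '' T) := wps_exists_of_mem hσ

/-- The linear form on the lattice of `ℙ^k` given by the difference of the coordinates `l`
and `j`. -/
lemma proj_exists_dual (j l : Fin (k + 1)) : ∃ m : Module.Dual ℤ (projectiveSpace k hk).N,
    ∀ i, m (projVec hk i) = (if i = l then 1 else 0) - (if i = j then 1 else 0) :=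
  wps_exists_dual (ha := wellFormed_one hk)
    (x := fun i => (if i = l then 1 else 0) - (if i = j then 1 else 0))
    (by simp [Finset.sum_sub_distrib])

end ProjectiveSpace

/-! ### Laurent polynomials, power series and Laurent series -/

section Series

open PowerSeries LaurentSeries

/-- The inclusion of the power series in the Laurent series. -/
noncomputable abbrev seriesIncl : ℂ⟦X⟧ →+* ℂ⸨X⸩ := HahnSeries.ofPowerSeries ℤ ℂ

lemma seriesIncl_injective : Function.Injective seriesIncl :=
  HahnSeries.ofPowerSeries_injective (Γ := ℤ) (R := ℂ)

lemma seriesIncl_algebraMap (c : ℂ) :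
    seriesIncl (algebraMap ℂ ℂ⟦X⟧ c) = algebraMap ℂ ℂ⸨X⸩ c := rfl

/-- The expansion of Laurent polynomials as Laurent series. -/
noncomputable def laurentExpand : AddMonoidAlgebra ℂ ℤ →ₐ[ℂ] ℂ⸨X⸩ :=
  AddMonoidAlgebra.lift ℂ _ ℤ
    { toFun := fun m => HahnSeries.single m.toAdd 1
      map_one' := rfl
      map_mul' := fun x y => by simp [HahnSeries.single_mul_single] }

lemma laurentExpand_single (m : ℤ) (c : ℂ) :
    laurentExpand (AddMonoidAlgebra.single m c) = HahnSeries.single m c := by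
  rw [laurentExpand, AddMonoidAlgebra.lift_single]
  rw [Algebra.smul_def, ← seriesIncl_algebraMap]
  change HahnSeries.ofPowerSeries ℤ ℂ (PowerSeries.C c) * HahnSeries.single m 1 = _
  rw [HahnSeries.ofPowerSeries_C, HahnSeries.C_mul_eq_smul]
  ext i
  simp [HahnSeries.coeff_single]

/-- Evaluation of Laurent polynomials at `1`. -/
noncomputable def laurentEvalOne : AddMonoidAlgebra ℂ ℤ →ₐ[ℂ] ℂ := AddMonoidAlgebra.lift ℂ _ ℤ 1

lemma laurentEvalOne_single (m : ℤ) (c : ℂ) :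
    laurentEvalOne (AddMonoidAlgebra.single m c) = c := by
  rw [laurentEvalOne, AddMonoidAlgebra.lift_single]
  simp

lemma laurentExpand_coeff (f : AddMonoidAlgebra ℂ ℤ) (i : ℤ) :
    (laurentExpand f).coeff i = AddMonoidAlgebra.coeff f i := by
  induction f using AddMonoidAlgebra.induction_linear with
  | zero => simp
  | add f g hf hg => simp [hf, hg]
  | single m c => 
    rw [laurentExpand_single, HahnSeries.coeff_single, AddMonoidAlgebra.coeff_single,
      Finsupp.single_apply]
    congr 1
    exact propext eq_comm

lemma laurentExpand_injective : Function.Injective laurentExpand := by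
  intro f g h
  ext i
  rw [← laurentExpand_coeff, h, laurentExpand_coeff]

lemma seriesIncl_X_pow (c : ℕ) : seriesIncl (PowerSeries.X ^ c) = HahnSeries.single (c : ℤ) 1 := by
  exact HahnSeries.ofPowerSeries_X_pow (Γ := ℤ) c

lemma exists_seriesIncl_eq {x : ℂ⸨X⸩} (h : 0 ≤ x.order) : ∃ p, seriesIncl p = x := by
  refine ⟨PowerSeries.X ^ x.order.toNat * x.powerSeriesPart, ?_⟩
  exact LaurentSeries.X_order_mul_powerSeriesPart (Int.toNat_of_nonneg h)

lemma order_seriesIncl_nonneg (p : ℂ⟦X⟧) : 0 ≤ (seriesIncl p).order := by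
  by_cases hp : seriesIncl p = 0
  · rw [hp, HahnSeries.order_zero]
  · by_contra! h
    refine HahnSeries.leadingCoeff_ne_zero.2 hp ?_
    rw [HahnSeries.leadingCoeff_eq]
    obtain ⟨n, hn⟩ : ∃ n : ℤ, n = (seriesIncl p).order := ⟨_, rfl⟩
    rw [← hn] at h ⊢
    rw [seriesIncl, PowerSeries.coeff_coe, if_pos h]

end Series

/-! ### Points of charts with values in rings -/

section Factor

open IsLocalRing

/-- A morphism from the spectrum of a local ring whose closed point lands in an open subscheme
factors through that subscheme. -/
lemma exists_factor_of_closedPoint {R : Type} [CommRing R] [IsLocalRing R] {Z U : Scheme.{0}}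
    (g : Spec (CommRingCat.of R) ⟶ Z) (u : U ⟶ Z) [IsOpenImmersion u]
    (h : g (closedPoint R) ∈ u.opensRange) : ∃ g' : Spec (CommRingCat.of R) ⟶ U, g' ≫ u = g := by
  have h' := Scheme.preimage_eq_top_of_closedPoint_mem (R := CommRingCat.of R) (f := g) h
  refine ⟨IsOpenImmersion.lift u g ?_, IsOpenImmersion.lift_fac _ _ _⟩
  rintro _ ⟨x, rfl⟩
  have hx : x ∈ g ⁻¹ᵁ u.opensRange := h' ▸ trivial
  exact hx

/-- A curve germ whose special point lies in an open subscheme factors through that subscheme. -/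
lemma exists_factor_of_special {R k : Type} [CommRing R] [IsLocalRing R] [Field k] (ε : R →+* k)
    [IsLocalHom ε] {Z U : Scheme.{0}} (g : Spec (CommRingCat.of R) ⟶ Z) (u : U ⟶ Z)
    [IsOpenImmersion u] (y : Spec (CommRingCat.of k) ⟶ U)
    (h : Spec.map (CommRingCat.ofHom ε) ≫ g = y ≫ u) :
    ∃ g' : Spec (CommRingCat.of R) ⟶ U, g' ≫ u = g ∧ Spec.map (CommRingCat.ofHom ε) ≫ g' = y := by
  have hc : Spec.map (CommRingCat.ofHom ε) (closedPoint k) = closedPoint R :=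
    comap_closedPoint ε
  have hz : g (closedPoint R) = u (y (closedPoint k)) :=
    (congrArg g hc.symm).trans (congrArg (fun f : _ ⟶ Z => f (closedPoint k)) h)
  obtain ⟨g', hg'⟩ := exists_factor_of_closedPoint g u ⟨_, hz.symm⟩
  refine ⟨g', hg', ?_⟩
  rw [← cancel_mono u, Category.assoc, hg', h]

/-- If a morphism from the spectrum of a domain sends some point into an open subscheme, then it
sends the generic point there. -/
lemma exists_factor_of_generic {D K k : Type} [CommRing D] [IsDomain D] [Field K] [Field k]
    (j : D →+* K) (hj : Function.Injective j) (e : D →+* k) {Z U : Scheme.{0}}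
    (g : Spec (CommRingCat.of D) ⟶ Z) (u : U ⟶ Z) [IsOpenImmersion u]
    (y : Spec (CommRingCat.of k) ⟶ U) (h : Spec.map (CommRingCat.ofHom e) ≫ g = y ≫ u) :
    ∃ g' : Spec (CommRingCat.of K) ⟶ U, g' ≫ u = Spec.map (CommRingCat.ofHom j) ≫ g := by
  refine exists_factor_of_closedPoint _ u ?_
  have hs : Spec.map (CommRingCat.ofHom j) (closedPoint K) ⤳
      Spec.map (CommRingCat.ofHom e) (closedPoint k) := by
    refine (PrimeSpectrum.le_iff_specializes _ _).1 ?_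
    intro x hx
    have hx' : j x ∈ (closedPoint K).asIdeal := hx
    rw [closedPoint, mem_maximalIdeal, mem_nonunits_iff, isUnit_iff_ne_zero, not_not,
      map_eq_zero_iff j hj] at hx'
    rw [hx']
    exact Ideal.zero_mem _
  have hs' := hs.map g.continuous
  have hz : g (Spec.map (CommRingCat.ofHom e) (closedPoint k)) = u (y (closedPoint k)) :=
    congrArg (fun f : _ ⟶ Z => f (closedPoint k)) h
  exact hs'.mem_open u.opensRange.isOpen ⟨_, hz.symm⟩

end Factor

section Coord

variable {N : Type} [AddCommGroup N] {N' : Type} [AddCommGroup N']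
  {σ : PointedCone ℝ (RealSpace N)} {τ : PointedCone ℝ (RealSpace N')}

/-- The character `χ^m` as a regular function on the chart `U_σ`. -/
noncomputable def chi (m : dualMonoid σ) : CoordRing σ := AddMonoidAlgebra.single m 1

lemma chi_add (m m' : dualMonoid σ) : chi (m + m') = chi m * chi m' := by
  rw [chi, chi, chi, AddMonoidAlgebra.single_mul_single, one_mul]

lemma chi_zero : chi (0 : dualMonoid σ) = 1 := rfl

lemma chi_nsmul (c : ℕ) (m : dualMonoid σ) : chi (c • m) = chi m ^ c := by
  rw [chi, chi, AddMonoidAlgebra.single_pow, one_pow]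

lemma coordMap_chi (f : N →ₗ[ℤ] N') (h : ∀ x ∈ σ, f.baseChange ℝ x ∈ τ) (m : dualMonoid τ) :
    coordMap f h (chi m) = chi (dualMonoidMap f h m) := by
  simp [coordMap, chi]

lemma coordHom_ext {A : Type} [CommRing A] {θ θ' : CoordRing σ →+* A}
    (h : ∀ m, θ (chi m) = θ' (chi m))
    (h' : θ.comp (algebraMap ℂ _) = θ'.comp (algebraMap ℂ _)) : θ = θ' := by
  refine AddMonoidAlgebra.ringHom_ext (fun r => RingHom.congr_fun h' r) fun m => h m

/-- The `A`-point of `U_σ` given by a ring homomorphism `ℂ[S_σ] → A`. -/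
noncomputable abbrev point {A : Type} [CommRing A] (θ : CoordRing σ →+* A) :
    Spec (CommRingCat.of A) ⟶ chart σ :=
  Spec.map (CommRingCat.ofHom θ)

lemma exists_point {A : Type} [CommRing A] (g : Spec (CommRingCat.of A) ⟶ chart σ) :
    ∃ θ : CoordRing σ →+* A, g = point θ :=
  ⟨(Spec.preimage g).hom, (Spec.map_preimage g).symm⟩

lemma point_injective {A : Type} [CommRing A] {θ θ' : CoordRing σ →+* A}
    (h : point θ = point θ') : θ = θ' := by
  have := Spec.map_injective h
  exact congrArg CommRingCat.Hom.hom this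

lemma map_point {A A' : Type} [CommRing A] [CommRing A'] (f : A →+* A') (θ : CoordRing σ →+* A) :
    Spec.map (CommRingCat.ofHom f) ≫ point θ = point (f.comp θ) := by
  rw [point, point, ← Spec.map_comp, ← CommRingCat.ofHom_comp]

lemma point_chartMap {A : Type} [CommRing A] (θ : CoordRing σ →+* A) (f : N →ₗ[ℤ] N')
    (h : ∀ x ∈ σ, f.baseChange ℝ x ∈ τ) :
    point θ ≫ chartMap f h = point (θ.comp (coordMap f h)) := by
  rw [point, point, chartMap, ← Spec.map_comp, ← CommRingCat.ofHom_comp]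

lemma point_chartStr {A : Type} [CommRing A] (θ : CoordRing σ →+* A) :
    point θ ≫ chartStr σ = Spec.map (CommRingCat.ofHom (θ.comp (algebraMap ℂ _))) := by
  rw [point, chartStr, ← Spec.map_comp, ← CommRingCat.ofHom_comp]

/-- The structure morphism `Spec A ⟶ Spec ℂ` of a `ℂ`-algebra. -/
noncomputable abbrev algStr (A : Type) [CommRing A] [Algebra ℂ A] :
    Spec (CommRingCat.of A) ⟶ Spec (CommRingCat.of ℂ) :=
  Spec.map (CommRingCat.ofHom (algebraMap ℂ A))

lemma point_algHom_chartStr {A : Type} [CommRing A] [Algebra ℂ A] (θ : CoordRing σ →ₐ[ℂ] A) :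
    point θ.toRingHom ≫ chartStr σ = algStr A := by
  rw [point_chartStr]
  congr 2
  exact θ.comp_algebraMap

/-- A ring homomorphism whose point lies over the structure morphism is `ℂ`-linear. -/
lemma comp_algebraMap_of_point {A : Type} [CommRing A] [Algebra ℂ A] {θ : CoordRing σ →+* A}
    (h : point θ ≫ chartStr σ = algStr A) : θ.comp (algebraMap ℂ _) = algebraMap ℂ A := by
  rw [point_chartStr] at h
  exact congrArg CommRingCat.Hom.hom (Spec.map_injective h)

lemma map_algStr {A A' : Type} [CommRing A] [CommRing A'] [Algebra ℂ A] [Algebra ℂ A']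
    (f : A →+* A') (hf : f.comp (algebraMap ℂ A) = algebraMap ℂ A') :
    Spec.map (CommRingCat.ofHom f) ≫ algStr A = algStr A' := by
  rw [algStr, ← Spec.map_comp, ← CommRingCat.ofHom_comp, hf]

lemma algStr_self : algStr ℂ = 𝟙 _ := Spec.map_id _

/-- The algebra homomorphism `ℂ[S_σ] → A` with given values on the characters. -/
noncomputable def evalHom {A : Type} [CommRing A] [Algebra ℂ A]
    (φ : Multiplicative (dualMonoid σ) →* A) : CoordRing σ →ₐ[ℂ] A :=
  AddMonoidAlgebra.lift ℂ A _ φ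

lemma evalHom_chi {A : Type} [CommRing A] [Algebra ℂ A] (φ : Multiplicative (dualMonoid σ) →* A)
    (m : dualMonoid σ) : (evalHom φ).toRingHom (chi m) = φ (Multiplicative.ofAdd m) := by
  change AddMonoidAlgebra.lift ℂ A _ φ (AddMonoidAlgebra.single m 1) = _
  rw [AddMonoidAlgebra.lift_single, one_smul]

/-- The homomorphism `ℂ[S_σ] → ℂ`, `χ^m ↦ 1`, of the identity element of the torus. -/
noncomputable def oneHom (σ : PointedCone ℝ (RealSpace N)) : CoordRing σ →ₐ[ℂ] ℂ := evalHom 1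

lemma oneHom_chi (m : dualMonoid σ) : (oneHom σ).toRingHom (chi m) = 1 := evalHom_chi _ _

/-- The homomorphism `χ^m ↦ X^(m w)` to Laurent polynomials: the one-parameter subgroup of `w`. -/
noncomputable def subgroupHom (σ : PointedCone ℝ (RealSpace N)) (w : N) :
    CoordRing σ →ₐ[ℂ] AddMonoidAlgebra ℂ ℤ :=
  evalHom
    { toFun := fun m => AddMonoidAlgebra.single (m.toAdd.1 w) 1
      map_one' := rfl
      map_mul' := fun m m' => by
        rw [AddMonoidAlgebra.single_mul_single, one_mul]
        rfl }

lemma subgroupHom_chi (w : N) (m : dualMonoid σ) :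
    (subgroupHom σ w).toRingHom (chi m) = AddMonoidAlgebra.single (m.1 w) 1 := evalHom_chi _ _

/-- If `w` is nonnegative on `S_σ`, its one-parameter subgroup extends to the curve germ
`χ^m ↦ X^(m w)` in `U_σ`. -/
noncomputable def germHom (σ : PointedCone ℝ (RealSpace N)) {w : N}
    (hw : ∀ m ∈ dualMonoid σ, 0 ≤ m w) : CoordRing σ →ₐ[ℂ] PowerSeries ℂ :=
  evalHom
    { toFun := fun m => PowerSeries.X ^ (m.toAdd.1 w).toNat
      map_one' := by simp
      map_mul' := fun m m' => by
        rw [← pow_add, ← Int.toNat_add (hw _ m.toAdd.2) (hw _ m'.toAdd.2)]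
        rfl }

lemma germHom_chi {w : N} (hw : ∀ m ∈ dualMonoid σ, 0 ≤ m w) (m : dualMonoid σ) :
    (germHom σ hw).toRingHom (chi m) = PowerSeries.X ^ (m.1 w).toNat := evalHom_chi _ _

open Classical in
/-- The distinguished point `χ^m ↦ 1` if `m` vanishes on `v`, `χ^m ↦ 0` otherwise, for a vector `v`
that is nonnegative on `S_σ`. -/
noncomputable def limitHom (σ : PointedCone ℝ (RealSpace N)) {v : N}
    (hv : ∀ m ∈ dualMonoid σ, 0 ≤ m v) : CoordRing σ →ₐ[ℂ] ℂ :=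
  evalHom
    { toFun := fun m => if m.toAdd.1 v = 0 then 1 else 0
      map_one' := by simp
      map_mul' := fun m m' => by
        have h1 := hv _ m.toAdd.2
        have h2 := hv _ m'.toAdd.2
        have h3 : (m * m').toAdd.1 v = m.toAdd.1 v + m'.toAdd.1 v := rfl
        rw [h3]
        split_ifs <;> first | omega | simp }

open Classical in
lemma limitHom_chi {v : N} (hv : ∀ m ∈ dualMonoid σ, 0 ≤ m v) (m : dualMonoid σ) :
    (limitHom σ hv).toRingHom (chi m) = if m.1 v = 0 then 1 else 0 := evalHom_chi _ _

end Coord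

/-! ### Points of toric varieties -/

/-- A homomorphism from the coordinate ring of the torus to Laurent series has an order of
vanishing, which is a one-parameter subgroup. -/
lemma exists_order {N : Type} [AddCommGroup N] [Module.Free ℤ N] [Module.Finite ℤ N]
    (θ : CoordRing (⊥ : PointedCone ℝ (RealSpace N)) →+* LaurentSeries ℂ) :
    ∃ w : N, ∀ m, θ (chi m) ≠ 0 ∧ (θ (chi m)).order = m.1 w := by
  have hne : ∀ m, θ (chi m) ≠ 0 := fun m h0 => by
    have h1 : θ (chi (m + ⟨-m.1, mem_dualMonoid_bot _⟩)) = 1 := by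
      rw [show m + ⟨-m.1, mem_dualMonoid_bot _⟩ = 0 from Subtype.ext (add_neg_cancel _), chi_zero,
        map_one]
    rw [chi_add, map_mul, h0, zero_mul] at h1
    exact zero_ne_one h1
  let o : Module.Dual ℤ N →+ ℤ :=
    { toFun := fun m => (θ (chi ⟨m, mem_dualMonoid_bot m⟩)).order
      map_zero' := by
        rw [show (⟨0, mem_dualMonoid_bot 0⟩ : dualMonoid (⊥ : PointedCone ℝ (RealSpace N))) = 0
          from rfl, chi_zero, map_one, HahnSeries.order_one]
      map_add' := fun m m' => by
        rw [← HahnSeries.order_mul (hne _) (hne _), ← map_mul, ← chi_add]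
        rfl }
  obtain ⟨w, hw⟩ := (Module.evalEquiv ℤ N).surjective o.toIntLinearMap
  refine ⟨w, fun m => ⟨hne m, ?_⟩⟩
  have := LinearMap.congr_fun hw m.1
  rw [Module.evalEquiv_apply] at this
  exact this.symm

namespace Fan

variable (X : Fan) {Y : Fan}

lemma mem_dualMonoid_zeroCone (m : Module.Dual ℤ X.N) : m ∈ dualMonoid X.zeroCone.1 :=
  mem_dualMonoid_bot m

/-- The character `χ^m` on the torus. -/
noncomputable def torusChi (m : Module.Dual ℤ X.N) : CoordRing X.zeroCone.1 :=
  chi ⟨m, X.mem_dualMonoid_zeroCone m⟩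

lemma exists_torus_order (θ : CoordRing X.zeroCone.1 →+* LaurentSeries ℂ) :
    ∃ w : X.N, ∀ m, θ (X.torusChi m) ≠ 0 ∧ (θ (X.torusChi m)).order = m w := by
  obtain ⟨w, hw⟩ := exists_order θ
  exact ⟨w, fun m => hw _⟩

lemma zeroCone_le (σ : X.cones) : X.zeroCone.1 ≤ σ.1 := bot_le

lemma torusι_eq (σ : X.cones) : X.torusι = chartIncl (X.zeroCone_le σ) ≫ X.chartι σ :=
  (X.chartIncl_chartι (X.zeroCone_le σ)).symm

lemma exists_chart (x : X.variety) : ∃ (σ : X.cones) (y : chart σ.1), X.chartι σ y = x :=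
  Scheme.IsLocallyDirected.ι_jointly_surjective X.diagram x

lemma exists_of_chartι_eq {σ τ : X.cones} {x : chart σ.1} {y : chart τ.1}
    (h : X.chartι σ x = X.chartι τ y) :
    ∃ (ρ : X.cones) (hσ : ρ.1 ≤ σ.1) (_ : ρ.1 ≤ τ.1) (z : chart ρ.1), chartIncl hσ z = x := by
  obtain ⟨ρ, f, g, z, hz, -⟩ := Scheme.IsLocallyDirected.ι_eq_ι_iff (F := X.diagram) |>.1 h
  exact ⟨ρ, f.le, g.le, z, hz⟩

/-- A point with values in a local ring lies in an affine chart. -/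
lemma exists_chart_of_local {R : Type} [CommRing R] [IsLocalRing R]
    (g : Spec (CommRingCat.of R) ⟶ X.variety) :
    ∃ (σ : X.cones) (θ : CoordRing σ.1 →+* R), g = point θ ≫ X.chartι σ := by
  obtain ⟨σ, y, hy⟩ := X.exists_chart (g (IsLocalRing.closedPoint R))
  obtain ⟨g', hg'⟩ := exists_factor_of_closedPoint g (X.chartι σ) ⟨y, hy⟩
  obtain ⟨θ, rfl⟩ := exists_point g'
  exact ⟨σ, θ, hg'.symm⟩

/-- Characters evaluated at a point of a chart that restricts to a point of the torus. -/
lemma apply_chi_of_torus {R K : Type} [CommRing R] [CommRing K] (ι : R →+* K) {σ : X.cones}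
    {θ : CoordRing σ.1 →+* R} {θ₀ : CoordRing X.zeroCone.1 →+* K}
    (h : Spec.map (CommRingCat.ofHom ι) ≫ point θ ≫ X.chartι σ = point θ₀ ≫ X.torusι)
    (m : dualMonoid σ.1) : ι (θ (chi m)) = θ₀ (X.torusChi m.1) := by
  rw [X.torusι_eq σ, ← Category.assoc, ← Category.assoc, cancel_mono, map_point, chartIncl,
    point_chartMap] at h
  have := RingHom.congr_fun (point_injective h) (chi m)
  rw [RingHom.comp_apply, RingHom.comp_apply, coordMap_chi] at this
  exact this

lemma point_torusι {A : Type} [CommRing A] {σ : X.cones} (θ : CoordRing σ.1 →+* A)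
    {θ₀ : CoordRing X.zeroCone.1 →+* A} (h : ∀ m : dualMonoid σ.1, θ₀ (X.torusChi m.1) = θ (chi m))
    (h' : θ₀.comp (algebraMap ℂ _) = θ.comp (algebraMap ℂ _)) :
    point θ₀ ≫ X.torusι = point θ ≫ X.chartι σ := by
  rw [X.torusι_eq σ, ← Category.assoc, chartIncl, point_chartMap]
  congr 2
  refine coordHom_ext (fun m => ?_) ?_
  · rw [RingHom.comp_apply, coordMap_chi]
    exact h m
  · rw [RingHom.comp_assoc, coordMap, AddMonoidAlgebra.mapDomainRingHom_comp_algebraMap, h']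

variable {X}

lemma point_toricMap {A : Type} [CommRing A] (f : X ⟶ Y) {σ : X.cones} {τ : Y.cones}
    (h : ∀ x ∈ σ.1, f.lin.baseChange ℝ x ∈ τ.1) (θ : CoordRing σ.1 →+* A) :
    (point θ ≫ X.chartι σ) ≫ toricMap f = point (θ.comp (coordMap f.lin h)) ≫ Y.chartι τ := by
  rw [Category.assoc, chartι_toricMap f σ τ h, ← Category.assoc, point_chartMap]

lemma zeroCone_map (f : X ⟶ Y) : ∀ x ∈ X.zeroCone.1, f.lin.baseChange ℝ x ∈ Y.zeroCone.1 := by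
  intro x hx
  rw [(Submodule.mem_bot _).1 hx, map_zero]
  exact Submodule.zero_mem _

lemma point_torus_toricMap {A : Type} [CommRing A] (f : X ⟶ Y)
    (θ : CoordRing X.zeroCone.1 →+* A) : (point θ ≫ X.torusι) ≫ toricMap f =
      point (θ.comp (coordMap f.lin (zeroCone_map f))) ≫ Y.torusι :=
  point_toricMap f (zeroCone_map f) θ

lemma coordMap_torusChi (f : X ⟶ Y) (m : Module.Dual ℤ Y.N) :
    coordMap f.lin (zeroCone_map f) (Y.torusChi m) = X.torusChi (m ∘ₗ f.lin) :=
  coordMap_chi _ _ _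

lemma point_str {A : Type} [CommRing A] {σ : X.cones} (θ : CoordRing σ.1 →+* A) :
    (point θ ≫ X.chartι σ) ≫ X.str = point θ ≫ chartStr σ.1 := by
  rw [Category.assoc, chartι_str]

lemma torusChi_mul (m m' : Module.Dual ℤ X.N) :
    X.torusChi (m + m') = X.torusChi m * X.torusChi m' := by
  rw [torusChi, torusChi, torusChi, ← chi_add]
  rfl

lemma coordMap_algebraMap {N N' : Type} [AddCommGroup N] [AddCommGroup N'] (f : N →ₗ[ℤ] N')
    {σ : PointedCone ℝ (RealSpace N)} {τ : PointedCone ℝ (RealSpace N')}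
    (h : ∀ x ∈ σ, f.baseChange ℝ x ∈ τ) :
    (coordMap f h).comp (algebraMap ℂ _) = algebraMap ℂ _ := by
  rw [coordMap, AddMonoidAlgebra.mapDomainRingHom_comp_algebraMap]

end Fan

/-- The semigroup algebra of a cone is a domain, as its semigroup lies in a lattice. -/
instance {N : Type} [AddCommGroup N] [Module.Free ℤ N] [Module.Finite ℤ N]
    (σ : PointedCone ℝ (RealSpace N)) : IsDomain (CoordRing σ) := by
  have h : TwoUniqueSums (dualMonoid σ) := by
    let b := Module.Free.chooseBasis ℤ (Module.Dual ℤ N)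
    refine TwoUniqueSums.of_injective_addHom
      (b.repr.toAddMonoidHom.comp (dualMonoid σ).subtype : _ →+ _).toAddHom ?_
      inferInstance
    exact b.repr.injective.comp Subtype.val_injective
  infer_instance

namespace Fan

variable (X : Fan)

/-- The generic point of the torus. -/
noncomputable def torusGenericPoint : X.torus :=
  (⟨⊥, Ideal.isPrime_bot⟩ : PrimeSpectrum (CoordRing X.zeroCone.1))

/-- The variety of a fan is irreducible: the generic point of its torus is dense. -/
lemma torusGenericPoint_specializes (x : X.variety) : X.torusι X.torusGenericPoint ⤳ x := by
  obtain ⟨σ, y, rfl⟩ := X.exists_chart x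
  have h : chartIncl (X.zeroCone_le σ) X.torusGenericPoint ⤳ y := by
    refine (PrimeSpectrum.le_iff_specializes _ _).1 ?_
    intro f hf
    have hf' : coordMap LinearMap.id _ f = 0 := hf
    have hinj : Function.Injective (coordMap (σ := X.zeroCone.1) (τ := σ.1) LinearMap.id
        fun x hx => by simpa using X.zeroCone_le σ hx) :=
      AddMonoidAlgebra.mapDomain_injective fun m₁ m₂ h =>
        Subtype.ext (congrArg (fun x : dualMonoid X.zeroCone.1 => x.1) h)
    rw [(map_eq_zero_iff _ hinj).1 hf']
    exact Ideal.zero_mem _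
  rw [X.torusι_eq σ]
  exact h.map (X.chartι σ).continuous

end Fan

namespace Fan

/-! ### One-parameter subgroups and the fibre over the identity -/

section OneParam

variable (X : Fan) {Y : Fan}

/-- The one-parameter subgroup of a lattice vector, as a curve `𝔾_m → X`. -/
noncomputable def oneParam (w : X.N) :
    Spec (CommRingCat.of (AddMonoidAlgebra ℂ ℤ)) ⟶ X.variety :=
  point (subgroupHom X.zeroCone.1 w).toRingHom ≫ X.torusι

lemma identityPoint_eq :
    X.identityPoint = point (oneHom X.zeroCone.1).toRingHom ≫ X.torusι := rfl

lemma identityPoint_eq_chart (σ : X.cones) :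
    X.identityPoint = point (oneHom σ.1).toRingHom ≫ X.chartι σ := by
  refine X.point_torusι _ (fun m => (oneHom_chi _).trans (oneHom_chi _).symm) ?_
  exact (oneHom X.zeroCone.1).comp_algebraMap.trans (oneHom σ.1).comp_algebraMap.symm

lemma oneParam_eq_chart (σ : X.cones) (w : X.N) :
    X.oneParam w = point (subgroupHom σ.1 w).toRingHom ≫ X.chartι σ := by
  refine X.point_torusι _ (fun m => (subgroupHom_chi w _).trans (subgroupHom_chi w m).symm) ?_
  exact (subgroupHom X.zeroCone.1 w).comp_algebraMap.trans
    (subgroupHom σ.1 w).comp_algebraMap.symm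

lemma identityPoint_str : X.identityPoint ≫ X.str = 𝟙 _ := by
  rw [identityPoint_eq, point_str, point_algHom_chartStr, algStr_self]

lemma oneParam_str (w : X.N) : X.oneParam w ≫ X.str = algStr _ := by
  rw [oneParam, point_str, point_algHom_chartStr]

lemma oneParam_zero : X.oneParam 0 = algStr _ ≫ X.identityPoint := by
  rw [oneParam, identityPoint_eq, ← Category.assoc, map_point]
  congr 2
  refine coordHom_ext (fun m => ?_) ?_
  · rw [RingHom.comp_apply, oneHom_chi, map_one, subgroupHom_chi, map_zero]
    rfl
  · rw [RingHom.comp_assoc]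
    refine (subgroupHom X.zeroCone.1 0).comp_algebraMap.trans ?_
    have : (oneHom X.zeroCone.1).toRingHom.comp (algebraMap ℂ _) = RingHom.id ℂ :=
      (oneHom X.zeroCone.1).comp_algebraMap
    rw [this, RingHom.comp_id]

lemma evalOne_oneParam (w : X.N) :
    Spec.map (CommRingCat.ofHom laurentEvalOne.toRingHom) ≫ X.oneParam w = X.identityPoint := by
  rw [oneParam, identityPoint_eq, ← Category.assoc, map_point]
  congr 2
  refine coordHom_ext (fun m => ?_) ?_
  · rw [RingHom.comp_apply, oneHom_chi, subgroupHom_chi]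
    exact laurentEvalOne_single _ _
  · exact (laurentEvalOne.comp (subgroupHom X.zeroCone.1 w)).comp_algebraMap.trans
      (oneHom X.zeroCone.1).comp_algebraMap.symm

lemma oneParam_injective {w w' : X.N} (h : X.oneParam w = X.oneParam w') : w = w' := by
  refine eq_of_forall_dual fun m => ?_
  rw [oneParam, oneParam, cancel_mono] at h
  have := RingHom.congr_fun (point_injective h) (X.torusChi m)
  rw [torusChi, subgroupHom_chi, subgroupHom_chi] at this
  exact (AddMonoidAlgebra.single_left_inj one_ne_zero).1 this

variable {X}

lemma oneParam_toricMap (f : X ⟶ Y) (w : X.N) :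
    X.oneParam w ≫ toricMap f = Y.oneParam (f.lin w) := by
  rw [oneParam, point_torus_toricMap, oneParam]
  congr 2
  refine coordHom_ext (fun m => ?_) ?_
  · rw [RingHom.comp_apply, coordMap_chi, subgroupHom_chi, subgroupHom_chi]
    rfl
  · rw [RingHom.comp_assoc, coordMap_algebraMap]
    exact (subgroupHom X.zeroCone.1 w).comp_algebraMap.trans
      (subgroupHom Y.zeroCone.1 (f.lin w)).comp_algebraMap.symm

lemma identityPoint_toricMap (f : X ⟶ Y) : X.identityPoint ≫ toricMap f = Y.identityPoint := by
  rw [← X.evalOne_oneParam 0, Category.assoc, oneParam_toricMap, evalOne_oneParam]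

/-- The Laurent series point of the one-parameter subgroup of `w`. -/
lemma expand_oneParam (w : X.N) :
    Spec.map (CommRingCat.ofHom laurentExpand.toRingHom) ≫ X.oneParam w =
      point (laurentExpand.toRingHom.comp (subgroupHom X.zeroCone.1 w).toRingHom) ≫ X.torusι := by
  rw [oneParam, ← Category.assoc, map_point]

lemma expand_subgroupHom_torusChi (w : X.N) (m : Module.Dual ℤ X.N) :
    laurentExpand.toRingHom.comp (subgroupHom X.zeroCone.1 w).toRingHom (X.torusChi m) =
      HahnSeries.single (m w) 1 := by
  rw [RingHom.comp_apply, torusChi, subgroupHom_chi]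
  exact laurentExpand_single _ _

end OneParam

namespace IsLocallyTrivialFibration

variable {F X B : Fan} {i : F ⟶ X} {π : X ⟶ B}

lemma proj_incl (h : IsLocallyTrivialFibration i π) (w : F.N) : π.lin (i.lin w) = 0 := by
  refine B.oneParam_injective ?_
  rw [← oneParam_toricMap, ← oneParam_toricMap, Category.assoc, h.fiber.w, ← Category.assoc,
    oneParam_str, oneParam_zero]

lemma mono_incl (h : IsLocallyTrivialFibration i π) : Mono (toricMap i) where
  right_cancellation a b hab := by
    refine h.fiber.hom_ext hab ?_
    rw [← toricMap_str i, ← Category.assoc, hab, Category.assoc]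

lemma incl_injective (h : IsLocallyTrivialFibration i π) : Function.Injective i.lin := by
  intro v w hvw
  have := h.mono_incl
  refine F.oneParam_injective ?_
  rw [← cancel_mono (toricMap i), oneParam_toricMap, oneParam_toricMap, hvw]

/-- The one-parameter subgroup of a vector of the kernel lifts to the fibre, where its generic
point lies in the torus because the image of `1` does. -/
lemma exists_of_proj_eq_zero (h : IsLocallyTrivialFibration i π) {w : X.N} (hw : π.lin w = 0) :
    ∃ v, i.lin v = w := by
  have := h.mono_incl
  have hlift : X.oneParam w ≫ toricMap π = algStr _ ≫ B.identityPoint := by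
    rw [oneParam_toricMap, hw, oneParam_zero]
  have h1 : Spec.map (CommRingCat.ofHom laurentEvalOne.toRingHom) ≫ h.fiber.lift _ _ hlift =
      point (oneHom F.zeroCone.1).toRingHom ≫ F.torusι := by
    rw [← cancel_mono (toricMap i), Category.assoc, h.fiber.lift_fst, evalOne_oneParam,
      ← identityPoint_eq, identityPoint_toricMap]
  obtain ⟨g, hg⟩ := exists_factor_of_generic laurentExpand.toRingHom laurentExpand_injective
    laurentEvalOne.toRingHom _ F.torusι _ h1
  obtain ⟨θ, rfl⟩ := exists_point g
  have h2 := congrArg (· ≫ toricMap i) hg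
  simp only [Category.assoc, h.fiber.lift_fst] at h2
  rw [expand_oneParam, ← Category.assoc, point_torus_toricMap, cancel_mono] at h2
  obtain ⟨v, hv⟩ := F.exists_torus_order θ
  refine ⟨v, eq_of_forall_dual fun m => ?_⟩
  have h3 := RingHom.congr_fun (point_injective h2) (X.torusChi m)
  rw [expand_subgroupHom_torusChi, RingHom.comp_apply, coordMap_torusChi] at h3
  have h4 := (hv (m ∘ₗ i.lin)).2
  rw [h3, HahnSeries.order_single one_ne_zero] at h4
  exact h4.symm

end IsLocallyTrivialFibration

end Fan

namespace Fan

/-! ### Local trivializations -/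

/-- A trivialization over the chart `U_τ` of the base of the toric morphism induced by `π`: the
preimage `P` of `U_τ`, exhibited by `r` and `q` as the product of the variety of `F` and `U_τ`. -/
structure LocalTriv {X B : Fan} (F : Fan) (π : X ⟶ B) (τ : B.cones) where
  /-- the preimage of the chart -/
  P : Scheme.{0}
  /-- the inclusion of the preimage -/
  j : P ⟶ X.variety
  /-- the projection to the chart -/
  q : P ⟶ chart τ.1
  /-- the projection to the fibre -/
  r : P ⟶ F.variety
  isOpenImmersion : IsOpenImmersion j
  preimage : IsPullback j q (toricMap π) (B.chartι τ)
  product : IsPullback r q F.str (chartStr τ.1)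

lemma IsLocallyTrivialFibration.nonempty_localTriv {F X B : Fan} {i : F ⟶ X} {π : X ⟶ B}
    (h : IsLocallyTrivialFibration i π) (τ : B.cones) : Nonempty (LocalTriv F π τ) := by
  obtain ⟨r, hr⟩ := h.locally_trivial τ
  let e : chart τ.1 ≅ (B.affineOpen τ).toScheme := (B.chartι τ).isoOpensRange
  have he : e.inv ≫ B.chartι τ = (B.affineOpen τ).ι := (B.chartι τ).isoOpensRange_inv_comp
  refine ⟨⟨_, (toricMap π ⁻¹ᵁ B.affineOpen τ).ι, (toricMap π ∣_ B.affineOpen τ) ≫ e.inv, r,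
    inferInstance, ?_, ?_⟩⟩
  · refine (isPullback_morphismRestrict (toricMap π) (B.affineOpen τ)).flip.of_iso (Iso.refl _)
      (Iso.refl _) e.symm (Iso.refl _) ?_ ?_ ?_ ?_ <;> simp [he]
  · refine hr.of_iso (Iso.refl _) (Iso.refl _) e.symm (Iso.refl _) ?_ ?_ ?_ ?_
    · simp
    · simp
    · simp
    · simp [← he, chartι_str]

namespace LocalTriv

variable {F X B : Fan} {π : X ⟶ B} {τ : B.cones} (t : LocalTriv F π τ)

attribute [instance] LocalTriv.isOpenImmersion

/-- The point of `P` with given image in `X`. -/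
lemma exists_lift {Z : Scheme.{0}} (x : Z ⟶ X.variety) (b : Z ⟶ chart τ.1)
    (hx : x ≫ toricMap π = b ≫ B.chartι τ) : ∃ y : Z ⟶ t.P, y ≫ t.j = x ∧ y ≫ t.q = b :=
  ⟨t.preimage.lift x b hx, t.preimage.lift_fst _ _ _, t.preimage.lift_snd _ _ _⟩

/-- The point of `P` with given components in the fibre and in the base. -/
lemma exists_glue {Z : Scheme.{0}} (f : Z ⟶ F.variety) (b : Z ⟶ chart τ.1)
    (hf : f ≫ F.str = b ≫ chartStr τ.1) : ∃ y : Z ⟶ t.P, y ≫ t.r = f ∧ y ≫ t.q = b :=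
  ⟨t.product.lift f b hf, t.product.lift_fst _ _ _, t.product.lift_snd _ _ _⟩

lemma j_toricMap {Z : Scheme.{0}} (y : Z ⟶ t.P) :
    (y ≫ t.j) ≫ toricMap π = (y ≫ t.q) ≫ B.chartι τ := by
  rw [Category.assoc, t.preimage.w, Category.assoc]

lemma r_str {Z : Scheme.{0}} (y : Z ⟶ t.P) :
    (y ≫ t.r) ≫ F.str = (y ≫ t.q) ≫ chartStr τ.1 := by
  rw [Category.assoc, t.product.w, Category.assoc]

lemma hom_ext {Z : Scheme.{0}} {y y' : Z ⟶ t.P} (hr : y ≫ t.r = y' ≫ t.r)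
    (hq : y ≫ t.q = y' ≫ t.q) : y = y' := t.product.hom_ext hr hq

end LocalTriv

/-- A trivialization can be changed by an automorphism of the fibre so that it restricts to the
identity on the fibre over the identity element. -/
lemma IsLocallyTrivialFibration.exists_normalized {F X B : Fan} {i : F ⟶ X} {π : X ⟶ B}
    (h : IsLocallyTrivialFibration i π) (τ : B.cones) :
    ∃ (t : LocalTriv F π τ) (s : F.variety ⟶ t.P), s ≫ t.j = toricMap i ∧ s ≫ t.r = 𝟙 _ := by
  obtain ⟨t⟩ := h.nonempty_localTriv τ
  have hm := h.mono_incl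
  have hone : point (oneHom τ.1).toRingHom ≫ chartStr τ.1 = 𝟙 _ := by
    rw [point_algHom_chartStr, algStr_self]
  obtain ⟨s, hsj, hsq⟩ := t.exists_lift (toricMap i) (F.str ≫ point (oneHom τ.1).toRingHom) <| by
    rw [h.fiber.w, B.identityPoint_eq_chart τ, Category.assoc]
  obtain ⟨u, hur, huq⟩ := t.exists_glue (𝟙 F.variety) (F.str ≫ point (oneHom τ.1).toRingHom) <| by
    rw [Category.assoc, hone, Category.id_comp, Category.comp_id]
  -- `β` expresses the section `u` through the fibre; it is inverse to `s ≫ t.r`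
  obtain ⟨β, hβ, hβs⟩ : ∃ β : F.variety ⟶ F.variety, β ≫ toricMap i = u ≫ t.j ∧
      β ≫ F.str = F.str := by
    have hw : (u ≫ t.j) ≫ toricMap π = F.str ≫ B.identityPoint := by
      rw [t.j_toricMap, huq, Category.assoc, B.identityPoint_eq_chart τ]
    exact ⟨h.fiber.lift _ _ hw, h.fiber.lift_fst _ _ _, h.fiber.lift_snd _ _ _⟩
  have h1 : β ≫ s ≫ t.r = 𝟙 _ := by
    have : β ≫ s = u := by rw [← cancel_mono t.j, Category.assoc, hsj, hβ]
    rw [← Category.assoc, this, hur]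
  have h2 : (s ≫ t.r) ≫ β = 𝟙 _ := by
    have hsu : (s ≫ t.r) ≫ u = s := by
      refine t.hom_ext ?_ ?_
      · rw [Category.assoc, hur, Category.comp_id]
      · rw [Category.assoc, huq, ← Category.assoc, t.r_str, hsq, Category.assoc, Category.assoc,
          reassoc_of% hone]
    rw [← cancel_mono (toricMap i), Category.assoc, hβ, ← Category.assoc, hsu, hsj,
      Category.id_comp]
  let e : F.variety ≅ F.variety := ⟨β, s ≫ t.r, h1, h2⟩
  refine ⟨⟨t.P, t.j, t.q, t.r ≫ β, t.isOpenImmersion, t.preimage, ?_⟩, s, hsj, ?_⟩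
  · refine t.product.of_iso (Iso.refl _) e (Iso.refl _) (Iso.refl _) ?_ ?_ ?_ ?_ <;> simp [e, hβs]
  · rw [← Category.assoc]
    exact h2

end Fan

namespace Fan

/-! ### Curve germs in a locally trivial fibration -/

section Germs

variable {N : Type} [AddCommGroup N] {σ : PointedCone ℝ (RealSpace N)}

lemma constantCoeff_X_pow_toNat {c : ℤ} (hc : 0 ≤ c) [Decidable (c = 0)] :
    PowerSeries.constantCoeff (R := ℂ) (PowerSeries.X ^ c.toNat) = if c = 0 then 1 else 0 := by
  rw [map_pow, PowerSeries.constantCoeff_X]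
  split_ifs with h
  · rw [h, Int.toNat_zero, pow_zero]
  · exact zero_pow (by omega)

/-- The special point of the curve germ of `w` is the distinguished point. -/
lemma special_germHom {w v : N} (hw : ∀ m ∈ dualMonoid σ, 0 ≤ m w)
    (hv : ∀ m ∈ dualMonoid σ, 0 ≤ m v) (hwv : ∀ m ∈ dualMonoid σ, m w = 0 ↔ m v = 0) :
    (PowerSeries.constantCoeff (R := ℂ)).comp (germHom σ hw).toRingHom =
      (limitHom σ hv).toRingHom := by
  classical
  refine coordHom_ext (fun m => ?_) ?_
  · rw [RingHom.comp_apply, germHom_chi, limitHom_chi, constantCoeff_X_pow_toNat (hw _ m.2)]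
    simp only [hwv _ m.2]
  · rw [RingHom.comp_assoc]
    have h1 : (germHom σ hw).toRingHom.comp (algebraMap ℂ _) = algebraMap ℂ (PowerSeries ℂ) :=
      (germHom σ hw).comp_algebraMap
    have h2 : (limitHom σ hv).toRingHom.comp (algebraMap ℂ _) = algebraMap ℂ ℂ :=
      (limitHom σ hv).comp_algebraMap
    rw [h1, h2]
    ext c
    exact PowerSeries.constantCoeff_C c

/-- The generic point of the curve germ of `w` lies on the one-parameter subgroup of `w`. -/
lemma seriesIncl_germHom {w : N} (hw : ∀ m ∈ dualMonoid σ, 0 ≤ m w) :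
    seriesIncl.comp (germHom σ hw).toRingHom =
      laurentExpand.toRingHom.comp (subgroupHom σ w).toRingHom := by
  refine coordHom_ext (fun m => ?_) ?_
  · rw [RingHom.comp_apply, RingHom.comp_apply, germHom_chi, subgroupHom_chi, seriesIncl_X_pow,
      Int.toNat_of_nonneg (hw _ m.2)]
    exact (laurentExpand_single _ _).symm
  · rw [RingHom.comp_assoc]
    have h1 : (germHom σ hw).toRingHom.comp (algebraMap ℂ _) = algebraMap ℂ (PowerSeries ℂ) :=
      (germHom σ hw).comp_algebraMap
    rw [h1]
    exact (laurentExpand.comp (subgroupHom σ w)).comp_algebraMap.symm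

/-- A Laurent series point of a chart extends to a power series point as soon as the characters
take values without pole. -/
lemma exists_series_lift {θ : CoordRing σ →+* LaurentSeries ℂ}
    (hθ : θ.comp (algebraMap ℂ _) = algebraMap ℂ _) (h : ∀ m, 0 ≤ (θ (chi m)).order) :
    ∃ ψ : CoordRing σ →ₐ[ℂ] PowerSeries ℂ, seriesIncl.comp ψ.toRingHom = θ := by
  choose φ hφ using fun m => exists_seriesIncl_eq (h m)
  refine ⟨evalHom
    { toFun := fun m => φ m.toAdd
      map_one' := seriesIncl_injective <|
        (hφ _).trans ((map_one θ).trans (map_one seriesIncl).symm)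
      map_mul' := fun m m' => seriesIncl_injective <| by
        rw [RingHom.map_mul seriesIncl, hφ, hφ, hφ, ← map_mul, ← chi_add]
        rfl }, ?_⟩
  refine coordHom_ext (fun m => ?_) ?_
  · rw [RingHom.comp_apply, evalHom_chi]
    exact hφ m
  · rw [RingHom.comp_assoc, hθ]
    exact RingHom.ext fun c => congrArg seriesIncl ((evalHom _).commutes c)

end Germs

variable {F X B : Fan} {i : F ⟶ X} {π : X ⟶ B}

lemma special_algStr : Spec.map (CommRingCat.ofHom (PowerSeries.constantCoeff (R := ℂ))) ≫
    algStr (PowerSeries ℂ) = 𝟙 _ := by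
  rw [map_algStr _ (A' := ℂ), algStr_self]
  ext c
  exact PowerSeries.constantCoeff_C c

lemma isRay_nonneg {v : X.N} {m : Module.Dual ℤ X.N} (hm : m ∈ dualMonoid (coneSpan {v})) :
    0 ≤ m v := mem_dualMonoid_coneSpan.1 hm v rfl

/-- The distinguished point of a ray lies over the distinguished point of `f` if the image of the
ray and `f` vanish on the same elements of `S_τ`. -/
lemma limit_toricMap {τ : B.cones} {v : X.N} (hv : X.IsRay v) {f : B.N}
    (hτ : vec (π.lin v) ∈ τ.1) (hf : ∀ m ∈ dualMonoid τ.1, 0 ≤ m f)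
    (hfv : ∀ m ∈ dualMonoid τ.1, m f = 0 ↔ m (π.lin v) = 0) :
    (point (limitHom (coneSpan {v}) fun _ => isRay_nonneg).toRingHom ≫
      X.chartι ⟨coneSpan {v}, hv.1⟩) ≫ toricMap π =
      point (limitHom τ.1 hf).toRingHom ≫ B.chartι τ := by
  classical
  have h : ∀ x ∈ coneSpan {v}, π.lin.baseChange ℝ x ∈ τ.1 := fun x hx => by
    obtain ⟨r, hr, rfl⟩ := mem_coneSpan_singleton.1 hx
    rw [map_smul, baseChange_vec]
    exact PointedCone.smul_mem _ hr hτ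
  rw [point_toricMap π (σ := ⟨coneSpan {v}, hv.1⟩) h]
  congr 2
  refine coordHom_ext (fun m => ?_) ?_
  · rw [RingHom.comp_apply, coordMap_chi, limitHom_chi, limitHom_chi]
    simp only [hfv _ m.2]
    rfl
  · rw [RingHom.comp_assoc, coordMap_algebraMap]
    exact (limitHom (coneSpan {v}) fun _ => isRay_nonneg).comp_algebraMap.trans
      (limitHom τ.1 hf).comp_algebraMap.symm

namespace LocalTriv

/-- A curve germ in the base through the image of the distinguished point of a ray `v` of `X` lifts
to a curve germ in `X` through that point. The lift lies in the chart of `v`, where its position is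
determined up to units by one order of vanishing; hence the germ of `f` is a reparametrization of
the image of the one of `v`. -/
theorem exists_mul_of_ray {τ : B.cones} (t : LocalTriv F π τ) {v : X.N} (hv : X.IsRay v)
    {f : B.N} (hτ : vec (π.lin v) ∈ τ.1) (hf : ∀ m ∈ dualMonoid τ.1, 0 ≤ m f)
    (hfv : ∀ m ∈ dualMonoid τ.1, m f = 0 ↔ m (π.lin v) = 0) :
    ∃ c : ℤ, ∀ m ∈ dualMonoid τ.1, m f = c * m (π.lin v) := by
  classical
  let ρ : X.cones := ⟨coneSpan {v}, hv.1⟩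
  obtain ⟨y, hyj, hyq⟩ := t.exists_lift _ _ (limit_toricMap hv hτ hf hfv)
  obtain ⟨g, hgr, hgq⟩ := t.exists_glue (algStr (PowerSeries ℂ) ≫ y ≫ t.r)
    (point (germHom τ.1 hf).toRingHom) (by
      rw [Category.assoc, t.r_str, hyq, point_algHom_chartStr, point_algHom_chartStr, algStr_self,
        Category.comp_id])
  have hs : Spec.map (CommRingCat.ofHom (PowerSeries.constantCoeff (R := ℂ))) ≫ g = y := by
    refine t.hom_ext ?_ ?_
    · rw [Category.assoc, hgr, ← Category.assoc, special_algStr, Category.id_comp]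
    · rw [Category.assoc, hgq, map_point, special_germHom hf hf fun _ _ => Iff.rfl, hyq]
  have hloc : IsLocalHom (PowerSeries.constantCoeff (R := ℂ)) :=
    ⟨fun p hp => PowerSeries.isUnit_iff_constantCoeff.2 hp⟩
  obtain ⟨g', hg', hgs⟩ := exists_factor_of_special (PowerSeries.constantCoeff (R := ℂ)) (g ≫ t.j)
    (X.chartι ρ) (point (limitHom (coneSpan {v}) fun _ => isRay_nonneg).toRingHom) (by
      rw [← Category.assoc, hs, hyj])
  obtain ⟨ψ, rfl⟩ := exists_point g'
  rw [map_point] at hgs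
  have hψ0 := point_injective hgs
  have hρ : ∀ x ∈ ρ.1, π.lin.baseChange ℝ x ∈ τ.1 := fun x hx => by
    obtain ⟨r, hr, rfl⟩ := mem_coneSpan_singleton.1 hx
    rw [map_smul, baseChange_vec]
    exact PointedCone.smul_mem _ hr hτ
  have hψ1 : ψ.comp (coordMap π.lin hρ) = (germHom τ.1 hf).toRingHom := by
    have h1 := congrArg (· ≫ toricMap π) hg'
    simp only [t.j_toricMap, hgq] at h1
    rw [point_toricMap π hρ, cancel_mono] at h1
    exact point_injective h1
  obtain ⟨m₁, hm₁⟩ := hv.2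
  have hmem : ∀ m : Module.Dual ℤ X.N, 0 ≤ m v → m ∈ dualMonoid ρ.1 := fun m hm =>
    mem_dualMonoid_coneSpan.2 fun u hu => by rw [Set.mem_singleton_iff.1 hu]; exact hm
  set M₁ : dualMonoid ρ.1 := ⟨m₁, hmem m₁ (by rw [hm₁]; exact zero_le_one)⟩
  refine ⟨((ψ (chi M₁)).order).toNat, fun m hm => ?_⟩
  have hnn : 0 ≤ m (π.lin v) := apply_nonneg_of_mem hm hτ
  set d := (m (π.lin v)).toNat with hd
  have hd' : (d : ℤ) = m (π.lin v) := Int.toNat_of_nonneg hnn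
  have h0 : (m ∘ₗ π.lin - d • m₁) v = 0 := by
    rw [LinearMap.sub_apply, LinearMap.smul_apply, hm₁, LinearMap.comp_apply, ← hd']
    simp
  set M₀ : dualMonoid ρ.1 := ⟨m ∘ₗ π.lin - d • m₁, hmem _ h0.ge⟩
  have hunit : (ψ (chi M₀)).order = 0 := by
    have := RingHom.congr_fun hψ0 (chi M₀)
    rw [limitHom_chi, if_pos h0, RingHom.comp_apply] at this
    refine PowerSeries.order_zero_of_unit ?_
    rw [PowerSeries.isUnit_iff_constantCoeff, this]
    exact isUnit_one
  have hprod : PowerSeries.X ^ (m f).toNat = ψ (chi M₁) ^ d * ψ (chi M₀) := by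
    have := RingHom.congr_fun hψ1 (chi ⟨m, hm⟩)
    rw [germHom_chi, RingHom.comp_apply, coordMap_chi] at this
    rw [← this, ← map_pow, ← map_mul, ← chi_nsmul, ← chi_add]
    congr 2
    exact Subtype.ext (by
      change m ∘ₗ π.lin = d • m₁ + (m ∘ₗ π.lin - d • m₁)
      abel)
  have hord := congrArg PowerSeries.order hprod
  rw [PowerSeries.order_X_pow, PowerSeries.order_mul, PowerSeries.order_pow, hunit, add_zero]
    at hord
  have hmf := hf m hm
  by_cases hd0 : d = 0
  · have h1 : m (π.lin v) = 0 := by omega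
    rw [(hfv m hm).2 h1, h1, mul_zero]
  · have hfin : (ψ (chi M₁)).order ≠ ⊤ := by
      intro htop
      rw [htop, nsmul_eq_mul, ENat.mul_top (by exact_mod_cast hd0)] at hord
      exact ENat.natCast_ne_top _ hord
    obtain ⟨o, ho⟩ := ENat.ne_top_iff_exists.1 hfin
    rw [← ho, nsmul_eq_mul] at hord
    rw [← ho, ENat.toNat_natCast]
    have h2 : (m f).toNat = d * o := by exact_mod_cast hord
    rw [← hd', mul_comm, ← Int.toNat_of_nonneg hmf, h2]
    push_cast
    ring

end LocalTriv

end Fan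

namespace Fan

variable {F X B : Fan} {i : F ⟶ X} {π : X ⟶ B}

namespace LocalTriv

/-- The germ of a one-parameter subgroup of the base lifts to a curve germ in `X`, constant in the
direction of the fibre; its special point lies in some chart of `X`. -/
theorem exists_germ {τ : B.cones} (t : LocalTriv F π τ) {f : B.N}
    (hf : ∀ m ∈ dualMonoid τ.1, 0 ≤ m f) :
    ∃ (σ : X.cones) (τ' : B.cones) (h : ∀ x ∈ σ.1, π.lin.baseChange ℝ x ∈ τ'.1)
      (ψ : CoordRing σ.1 →+* PowerSeries ℂ), ∀ m : dualMonoid τ'.1,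
        0 ≤ m.1 f ∧ ψ (chi (dualMonoidMap π.lin h m)) = PowerSeries.X ^ (m.1 f).toNat := by
  obtain ⟨g, -, hgq⟩ := t.exists_glue (algStr (PowerSeries ℂ) ≫ F.identityPoint)
    (point (germHom τ.1 hf).toRingHom) (by
      rw [Category.assoc, identityPoint_str, point_algHom_chartStr, Category.comp_id])
  obtain ⟨σ, ψ, hψ⟩ := X.exists_chart_of_local (g ≫ t.j)
  refine ⟨σ, targetCone π σ, map_mem_targetCone π σ, ψ, fun m => ?_⟩
  have h1 := t.j_toricMap g
  rw [hψ, hgq, point_toricMap π (map_mem_targetCone π σ)] at h1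
  have h2 : Spec.map (CommRingCat.ofHom seriesIncl) ≫
      point (ψ.comp (coordMap π.lin (map_mem_targetCone π σ))) ≫ B.chartι (targetCone π σ) =
      point (laurentExpand.toRingHom.comp (subgroupHom B.zeroCone.1 f).toRingHom) ≫ B.torusι := by
    rw [h1, ← expand_oneParam, B.oneParam_eq_chart τ, ← Category.assoc, ← Category.assoc,
      map_point, map_point, seriesIncl_germHom]
  have h3 := B.apply_chi_of_torus seriesIncl h2 m
  rw [expand_subgroupHom_torusChi, RingHom.comp_apply, coordMap_chi] at h3
  have h4 : 0 ≤ m.1 f := by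
    have := order_seriesIncl_nonneg (ψ (chi (dualMonoidMap π.lin (map_mem_targetCone π σ) m)))
    rwa [h3, HahnSeries.order_single one_ne_zero] at this
  refine ⟨h4, seriesIncl_injective ?_⟩
  rw [h3, seriesIncl_X_pow, Int.toNat_of_nonneg h4]

/-- Two rays of `X` with the same image `f ≠ 0` in the base agree: their charts meet the fibre over
the distinguished point of `f` in nonempty open sets, which intersect because the fibre is
irreducible, whereas the intersection of the charts is the torus. -/
theorem ray_unique {τ : B.cones} (t : LocalTriv F π τ) {v v' : X.N} (hv : X.IsRay v)
    (hv' : X.IsRay v') (hvv : π.lin v = π.lin v') (hτ : vec (π.lin v) ∈ τ.1)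
    {m₀ : Module.Dual ℤ B.N} (hm₀ : m₀ ∈ dualMonoid τ.1) (hpos : 0 < m₀ (π.lin v)) : v = v' := by
  classical
  by_contra hne
  have hf : ∀ m ∈ dualMonoid τ.1, 0 ≤ m (π.lin v) := fun m hm => apply_nonneg_of_mem hm hτ
  set b := point (limitHom τ.1 hf).toRingHom with hb
  have hbstr : b ≫ chartStr τ.1 = 𝟙 _ := by rw [hb, point_algHom_chartStr, algStr_self]
  -- the section `s` identifies `F` with the fibre over the distinguished point
  obtain ⟨s, hsr, hsq⟩ := t.exists_glue (𝟙 F.variety) (F.str ≫ b) (by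
    rw [Category.assoc, hbstr, Category.id_comp, Category.comp_id])
  have key : ∀ u (hu : X.IsRay u), π.lin u = π.lin v →
      (s ≫ t.j) (F.torusι F.torusGenericPoint) ∈ (X.chartι ⟨coneSpan {u}, hu.1⟩).opensRange := by
    intro u hu huv
    obtain ⟨y, hyj, hyq⟩ := t.exists_lift _ _ (limit_toricMap (π := π) (τ := τ) hu (f := π.lin v)
      (huv ▸ hτ) hf fun m _ => by rw [huv])
    have hys : (y ≫ t.r) ≫ s = y := by
      refine t.hom_ext ?_ ?_
      · rw [Category.assoc, hsr, Category.comp_id]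
      · rw [Category.assoc, hsq, ← Category.assoc, t.r_str, hyq, Category.assoc, ← hb,
          ← Category.assoc, hbstr, Category.id_comp]
    let p : Spec (CommRingCat.of ℂ) := IsLocalRing.closedPoint ℂ
    have hsp := (F.torusGenericPoint_specializes ((y ≫ t.r) p)).map (s ≫ t.j).continuous
    refine hsp.mem_open (X.chartι ⟨coneSpan {u}, hu.1⟩).opensRange.isOpen ?_
    have h1 : (y ≫ t.r) ≫ s ≫ t.j =
        point (limitHom (coneSpan {u}) fun _ => isRay_nonneg).toRingHom ≫
          X.chartι ⟨coneSpan {u}, hu.1⟩ := by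
      rw [← Category.assoc, hys, hyj]
    have h2 := congrArg (fun g : Spec (CommRingCat.of ℂ) ⟶ X.variety => g p) h1
    exact ⟨_, h2.symm⟩
  obtain ⟨x, hx⟩ := key v hv rfl
  obtain ⟨x', hx'⟩ := key v' hv' hvv.symm
  obtain ⟨ρ, hρ, hρ', z, hz⟩ := X.exists_of_chartι_eq (hx.trans hx'.symm)
  have hρ0 : ρ = X.zeroCone := by
    obtain ⟨S, hS, hray⟩ := X.exists_rays ρ.2
    refine Subtype.ext (hS.trans ?_)
    rcases S.eq_empty_or_nonempty with h | ⟨u, hu⟩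
    · rw [h, coneSpan_empty]; rfl
    · have hmem : vec u ∈ ρ.1 := hS ▸ vec_mem_coneSpan hu
      exact absurd ((hv.eq_of_vec_mem (hray u hu) (hρ hmem)).symm.trans
        (hv'.eq_of_vec_mem (hray u hu) (hρ' hmem))) hne
  subst hρ0
  have hz' : X.torusι z = (s ≫ t.j) (F.torusι F.torusGenericPoint) := by
    rw [X.torusι_eq ⟨coneSpan {v}, hv.1⟩, ← hx, ← hz]
    rfl
  -- the image of this point in the base lies in the torus and is the distinguished point of `f`
  have h1 : chartMap π.lin (zeroCone_map π) ≫ B.torusι = X.torusι ≫ toricMap π :=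
    (chartι_toricMap π _ _ _).symm
  have h2 : (s ≫ t.j) ≫ toricMap π = F.str ≫ b ≫ B.chartι τ := by
    rw [t.j_toricMap, hsq, Category.assoc]
  have h3 : B.torusι (chartMap π.lin (zeroCone_map π) z) =
      B.chartι τ (b (F.str (F.torusι F.torusGenericPoint))) := by
    have e1 := congrArg (fun g : X.torus ⟶ B.variety => g z) h1
    have e2 := congrArg (fun g : F.variety ⟶ B.variety => g (F.torusι F.torusGenericPoint)) h2
    exact e1.trans ((congrArg (toricMap π) hz').trans e2)
  rw [B.torusι_eq τ] at h3
  have h4 := (B.chartι τ).isOpenEmbedding.injective h3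
  set P := F.str (F.torusι F.torusGenericPoint)
  have hP : chi ⟨m₀, hm₀⟩ ∈ (b P).asIdeal := by
    change (limitHom τ.1 hf).toRingHom (chi ⟨m₀, hm₀⟩) ∈ P.asIdeal
    rw [limitHom_chi, if_neg hpos.ne']
    exact Ideal.zero_mem _
  rw [← h4] at hP
  set Q := chartMap π.lin (zeroCone_map π) z
  have hQ : B.torusChi m₀ ∈ Q.asIdeal := by
    have : coordMap LinearMap.id _ (chi ⟨m₀, hm₀⟩) ∈ Q.asIdeal := hP
    rwa [coordMap_chi] at this
  refine Q.isPrime.ne_top ((Ideal.eq_top_iff_one _).2 ?_)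
  have h5 : B.torusChi (-m₀) * B.torusChi m₀ = 1 := by
    rw [← torusChi_mul, neg_add_cancel]
    rfl
  rw [← h5]
  exact Ideal.mul_mem_left _ _ hQ

end LocalTriv

/-- If the fans of the fibre and of the base are complete, then so is the fan of the total space of
a locally trivial fibration. The one-parameter subgroup of `w` is generically, as a Laurent series
point, a pair of torus points of the fibre and the base; both extend to curve germs, hence so does
the pair, and the special point of its image in `X` lies in a chart whose cone contains `w`. -/
theorem IsLocallyTrivialFibration.complete (h : IsLocallyTrivialFibration i π)
    (hF : ∀ w : F.N, ∃ σ ∈ F.cones, ∀ m ∈ dualMonoid σ, 0 ≤ m w)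
    (hB : ∀ w : B.N, ∃ τ ∈ B.cones, ∀ m ∈ dualMonoid τ, 0 ≤ m w) (w : X.N) :
    ∃ σ ∈ X.cones, ∀ m ∈ dualMonoid σ, 0 ≤ m w := by
  obtain ⟨τ, hτw⟩ : ∃ τ : B.cones, ∀ m ∈ dualMonoid τ.1, 0 ≤ m (π.lin w) :=
    ⟨⟨_, (hB _).choose_spec.1⟩, (hB _).choose_spec.2⟩
  obtain ⟨t, s, hsj, hsr⟩ := h.exists_normalized τ
  obtain ⟨y, hyj, hyq⟩ := t.exists_lift (X.oneParam w) (point (subgroupHom τ.1 (π.lin w)).toRingHom)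
    (by rw [oneParam_toricMap, B.oneParam_eq_chart τ])
  -- at `1` the component in the fibre is the identity of its torus
  have h1 : Spec.map (CommRingCat.ofHom laurentEvalOne.toRingHom) ≫ y ≫ t.r =
      point (oneHom F.zeroCone.1).toRingHom ≫ F.torusι := by
    have : Spec.map (CommRingCat.ofHom laurentEvalOne.toRingHom) ≫ y = F.identityPoint ≫ s := by
      rw [← cancel_mono t.j, Category.assoc, hyj, evalOne_oneParam, Category.assoc, hsj,
        identityPoint_toricMap]
    rw [← Category.assoc, this, Category.assoc, hsr, Category.comp_id, identityPoint_eq]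
  obtain ⟨g, hg⟩ := exists_factor_of_generic laurentExpand.toRingHom laurentExpand_injective
    laurentEvalOne.toRingHom _ F.torusι _ h1
  obtain ⟨θ, rfl⟩ := exists_point g
  have hexp : Spec.map (CommRingCat.ofHom laurentExpand.toRingHom) ≫
      algStr (AddMonoidAlgebra ℂ ℤ) = algStr (LaurentSeries ℂ) :=
    map_algStr _ laurentExpand.comp_algebraMap
  have hθ : θ.comp (algebraMap ℂ _) = algebraMap ℂ _ := by
    refine comp_algebraMap_of_point ?_
    rw [← point_str, hg, Category.assoc, t.r_str, hyq, point_algHom_chartStr, hexp]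
  obtain ⟨v, hv⟩ := F.exists_torus_order θ
  obtain ⟨σ, hσv⟩ : ∃ σ : F.cones, ∀ m ∈ dualMonoid σ.1, 0 ≤ m v :=
    ⟨⟨_, (hF v).choose_spec.1⟩, (hF v).choose_spec.2⟩
  have hle := F.zeroCone_le σ
  obtain ⟨ψ, hψ⟩ := exists_series_lift (σ := σ.1)
    (θ := θ.comp (coordMap LinearMap.id fun x hx => by simpa using hle hx))
    (by rw [RingHom.comp_assoc, coordMap_algebraMap, hθ]) (fun m => by
      rw [RingHom.comp_apply, coordMap_chi]
      exact (hσv m.1 m.2).trans_eq (hv m.1).2.symm)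
  obtain ⟨u, hur, huq⟩ := t.exists_glue (point ψ.toRingHom ≫ F.chartι σ)
    (point (germHom τ.1 hτw).toRingHom) (by
      rw [point_str, point_algHom_chartStr, point_algHom_chartStr])
  have hu : Spec.map (CommRingCat.ofHom seriesIncl) ≫ u =
      Spec.map (CommRingCat.ofHom laurentExpand.toRingHom) ≫ y := by
    refine t.hom_ext ?_ ?_
    · rw [Category.assoc, hur, Category.assoc, ← hg, ← Category.assoc, map_point, hψ,
        F.torusι_eq σ, chartIncl, ← Category.assoc, point_chartMap]
    · rw [Category.assoc, huq, Category.assoc, hyq, map_point, map_point, seriesIncl_germHom]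
  obtain ⟨ρ, χ, hχ⟩ := X.exists_chart_of_local (u ≫ t.j)
  refine ⟨ρ.1, ρ.2, fun m hm => ?_⟩
  have h2 := X.apply_chi_of_torus seriesIncl (σ := ρ) (θ := χ)
    (θ₀ := laurentExpand.toRingHom.comp (subgroupHom X.zeroCone.1 w).toRingHom) (by
      rw [← hχ, ← Category.assoc, hu, Category.assoc, hyj, expand_oneParam]) ⟨m, hm⟩
  have h3 := order_seriesIncl_nonneg (χ (chi ⟨m, hm⟩))
  rwa [h2, expand_subgroupHom_torusChi, HahnSeries.order_single one_ne_zero] at h3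

end Fan

/-! ### Rays of a fibration over projective space -/

section Combination

variable {N ι : Type} [AddCommGroup N] [Fintype ι]

lemma vec_sum_mem_coneSpan (c : ι → ℕ) (f : ι → N) :
    vec (∑ l, c l • f l) ∈ coneSpan (f '' {l | 0 < c l}) := by
  classical
  have : ∑ l, c l • f l = ∑ l ∈ Finset.univ.filter fun l => 0 < c l, c l • f l := by
    refine (Finset.sum_subset (Finset.filter_subset _ _) fun l _ hl => ?_).symm
    simp only [Finset.mem_filter, Finset.mem_univ, true_and, not_lt, Nat.le_zero] at hl
    rw [hl, zero_smul]
  rw [this]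
  exact vec_sum_mem _ _ _ fun l hl => vec_mem_coneSpan ⟨l, (Finset.mem_filter.1 hl).2, rfl⟩

lemma dual_sum (c : ι → ℕ) (f : ι → N) (m : Module.Dual ℤ N) :
    m (∑ l, c l • f l) = ∑ l, c l * m (f l) := by
  simp [map_sum]

lemma dual_sum_nonneg {c : ι → ℕ} {f : ι → N} {m : Module.Dual ℤ N}
    (h : ∀ l, 0 < c l → 0 ≤ m (f l)) : 0 ≤ m (∑ l, c l • f l) := by
  rw [dual_sum]
  refine Finset.sum_nonneg fun l _ => ?_
  rcases Nat.eq_zero_or_pos (c l) with h0 | h0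
  · simp [h0]
  · exact mul_nonneg (by positivity) (h l h0)

lemma dual_sum_eq_zero_iff {c : ι → ℕ} {f : ι → N} {m : Module.Dual ℤ N}
    (h : ∀ l, 0 < c l → 0 ≤ m (f l)) :
    m (∑ l, c l • f l) = 0 ↔ ∀ l, 0 < c l → m (f l) = 0 := by
  rw [dual_sum, Finset.sum_eq_zero_iff_of_nonneg]
  · constructor
    · intro h0 l hl
      have := h0 l (Finset.mem_univ l)
      rcases mul_eq_zero.1 this with h1 | h1
      · exact absurd h1 (by exact_mod_cast hl.ne')
      · exact h1
    · intro h0 l _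
      rcases Nat.eq_zero_or_pos (c l) with h1 | h1
      · simp [h1]
      · rw [h0 l h1, mul_zero]
  · intro l _
    rcases Nat.eq_zero_or_pos (c l) with h0 | h0
    · simp [h0]
    · exact mul_nonneg (by positivity) (h l h0)

end Combination

lemma wps_exists_nonneg {n : ℕ} {a : Fin (n + 1) → ℕ} {ha : WellFormed a} (w : (wps a ha).N) :
    ∃ σ ∈ (wps a ha).cones, ∀ m ∈ dualMonoid σ, 0 ≤ m w := by
  obtain ⟨j, c, hj, hw⟩ := wps_complete w
  refine ⟨_, wps_coneSpan_mem (S := {l | 0 < c l}) ⟨j, by simp [hj]⟩, fun m hm => ?_⟩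
  have h1 : 0 ≤ m (a j • w) := by
    rw [hw]
    exact dual_sum_nonneg fun l hl => mem_dualMonoid_coneSpan.1 hm _ ⟨l, hl, rfl⟩
  rw [map_nsmul, nsmul_eq_mul] at h1
  exact nonneg_of_mul_nonneg_right h1 (by exact_mod_cast ha.pos j)

namespace Fan

variable {k : ℕ} {hk : 0 < k} {F X : Fan}

/-- The image of a ray in the fan of projective space is zero or one of the `f_l`: by
`LocalTriv.exists_mul_of_ray`, every vector in the interior of the cone of the base that contains
the image of the ray in its interior is an integral multiple of this image. -/
lemma IsLocallyTrivialFibration.ray_proj {i : F ⟶ X} {π : X ⟶ projectiveSpace k hk}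
    (h : IsLocallyTrivialFibration i π) {v : X.N} (hv : X.IsRay v) :
    π.lin v = 0 ∨ ∃ l, π.lin v = projVec hk l := by
  classical
  obtain ⟨j, c, hj, hc⟩ := proj_complete (π.lin v)
  by_cases hc0 : ∀ l, c l = 0
  · left
    rw [hc]
    exact Finset.sum_eq_zero fun l _ => by rw [hc0 l, zero_smul]
  right
  push Not at hc0
  obtain ⟨l₀, hl₀⟩ := hc0
  let τ : (projectiveSpace k hk).cones :=
    ⟨coneSpan (projVec hk '' {l | 0 < c l}), proj_coneSpan_mem ⟨j, by simp [hj]⟩⟩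
  obtain ⟨t⟩ := h.nonempty_localTriv τ
  have hτ : vec (π.lin v) ∈ τ.1 := by
    rw [hc]
    exact vec_sum_mem_coneSpan c _
  have key : ∀ c' : Fin (k + 1) → ℕ, (∀ l, 0 < c' l ↔ 0 < c l) →
      ∃ e : ℤ, ∀ l, l ≠ j → (c' l : ℤ) = e * c l := by
    intro c' hc'
    have hm : ∀ m ∈ dualMonoid τ.1, ∀ l, 0 < c l → 0 ≤ m (projVec hk l) := fun m hm l hl =>
      mem_dualMonoid_coneSpan.1 hm _ ⟨l, hl, rfl⟩
    have hm' : ∀ m ∈ dualMonoid τ.1, ∀ l, 0 < c' l → 0 ≤ m (projVec hk l) := fun m h l hl =>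
      hm m h l ((hc' l).1 hl)
    obtain ⟨e, he⟩ := t.exists_mul_of_ray hv (f := ∑ l, c' l • projVec hk l) hτ
      (fun m hm => dual_sum_nonneg (hm' m hm)) (fun m h => by
        rw [hc, dual_sum_eq_zero_iff (hm m h), dual_sum_eq_zero_iff (hm' m h)]
        simp only [hc'])
    refine ⟨e, fun l hl => ?_⟩
    obtain ⟨m, hml⟩ := proj_exists_dual (hk := hk) j l
    have h1 := he m (mem_dualMonoid_coneSpan.2 (by
      rintro _ ⟨p, hp, rfl⟩
      have hpj : p ≠ j := by
        rintro rfl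
        exact hp.ne' hj
      rw [hml, if_neg hpj]
      split_ifs <;> simp))
    have hc'j : c' j = 0 := by
      have := hc' j
      omega
    rw [hc, dual_sum, dual_sum] at h1
    simpa [hml, mul_sub, Finset.sum_sub_distrib, hj, hc'j] using h1
  have hone : ∀ l, 0 < c l → c l = 1 := by
    intro l hl
    obtain ⟨e, he⟩ := key (fun l => if 0 < c l then 1 else 0) fun l => by
      split_ifs with h1
      · simp [h1]
      · simp; omega
    have h1 := he l (by rintro rfl; omega)
    rw [if_pos hl, Nat.cast_one] at h1
    have := Int.isUnit_iff.1 (IsUnit.of_mul_eq_one e (by rw [mul_comm]; exact h1.symm))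
    omega
  refine ⟨l₀, ?_⟩
  have hrest : ∀ l, l ≠ l₀ → c l = 0 := by
    intro l hl
    by_contra hcl
    have hcl := Nat.pos_of_ne_zero hcl
    obtain ⟨e, he⟩ := key (fun l => (if 0 < c l then 1 else 0) + if l = l₀ then 1 else 0)
      fun l => by
        by_cases h1 : l = l₀
        · subst h1; simp; omega
        · simp only [h1, if_false, add_zero]
          split_ifs with h2
          · simp [h2]
          · simp; omega
    have h1 := he l (by rintro rfl; omega)
    have h2 := he l₀ (by rintro rfl; omega)
    have h3 := hone l hcl
    have h4 := hone l₀ (Nat.pos_of_ne_zero hl₀)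
    simp [h3, hl] at h1
    simp [h4] at h2
    omega
  rw [hc, Finset.sum_eq_single l₀ (fun l _ hl => by rw [hrest l hl, zero_smul]) (by simp),
    hone l₀ (Nat.pos_of_ne_zero hl₀), one_smul]

/-- Every `f_l` is the image of a ray: otherwise the coordinate of the base vanishing on the divisor
of `f_l` would be invertible along a curve germ lifting the germ of `f_l`. -/
lemma IsLocallyTrivialFibration.exists_ray {i : F ⟶ X} {π : X ⟶ projectiveSpace k hk}
    (h : IsLocallyTrivialFibration i π) (l : Fin (k + 1)) :
    ∃ v, X.IsRay v ∧ π.lin v = projVec hk l := by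
  classical
  have hnt : Nontrivial (Fin (k + 1)) := Fin.nontrivial_iff_two_le.2 (by omega)
  obtain ⟨p, hp⟩ := exists_ne l
  let τ : (projectiveSpace k hk).cones :=
    ⟨coneSpan (projVec hk '' {l}), proj_coneSpan_mem ⟨p, hp⟩⟩
  obtain ⟨t⟩ := h.nonempty_localTriv τ
  obtain ⟨σ, τ', hστ, ψ, hψ⟩ := t.exists_germ (f := projVec hk l) fun m hm =>
    mem_dualMonoid_coneSpan.1 hm _ ⟨l, rfl, rfl⟩
  obtain ⟨T, ⟨j, hj⟩, hT⟩ := proj_exists_of_mem τ'.2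
  have hmem : ∀ q (m : Module.Dual ℤ (projectiveSpace k hk).N),
      (∀ i, m (projVec hk i) = (if i = q then 1 else 0) - (if i = j then 1 else 0)) →
      m ∈ dualMonoid τ'.1 := by
    intro q m hm
    rw [hT]
    refine mem_dualMonoid_coneSpan.2 ?_
    rintro _ ⟨s, hs, rfl⟩
    rw [hm, if_neg (fun h => hj (h ▸ hs) : s ≠ j)]
    split_ifs <;> simp
  have hlj : l ≠ j := by
    rintro rfl
    obtain ⟨m, hm⟩ := proj_exists_dual (hk := hk) l p
    have := (hψ ⟨m, hmem p m hm⟩).1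
    rw [hm, if_neg hp.symm, if_pos rfl] at this
    omega
  obtain ⟨m, hm⟩ := proj_exists_dual (hk := hk) j l
  have hmτ := hmem l m hm
  have h1 := (hψ ⟨m, hmτ⟩).2
  have hml : m (projVec hk l) = 1 := by rw [hm, if_pos rfl, if_neg hlj, sub_zero]
  rw [hml, Int.toNat_one, pow_one] at h1
  by_contra! hno
  have hinv : -(m ∘ₗ π.lin) ∈ dualMonoid σ.1 := by
    obtain ⟨S, hS, hray⟩ := X.exists_rays σ.2
    rw [hS]
    refine mem_dualMonoid_coneSpan.2 fun u hu => ?_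
    rw [LinearMap.neg_apply, LinearMap.comp_apply]
    rcases h.ray_proj (hray u hu) with h0 | ⟨q, hq⟩
    · rw [h0, map_zero, neg_zero]
    · have hql : q ≠ l := by
        rintro rfl
        exact hno u (hray u hu) hq
      rw [hq, hm, if_neg hql]
      split_ifs <;> simp
  have h2 : chi (dualMonoidMap π.lin hστ ⟨m, hmτ⟩) * chi ⟨_, hinv⟩ = 1 := by
    rw [← chi_add, ← chi_zero]
    congr 1
    exact Subtype.ext (add_neg_cancel (m ∘ₗ π.lin))
  have h3 := congrArg ψ h2
  rw [map_mul, h1, map_one] at h3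
  have h4 := congrArg (PowerSeries.constantCoeff (R := ℂ)) h3
  rw [map_mul, PowerSeries.constantCoeff_X, zero_mul, map_one] at h4
  exact zero_ne_one h4

lemma IsLocallyTrivialFibration.ray_unique {i : F ⟶ X} {π : X ⟶ projectiveSpace k hk}
    (h : IsLocallyTrivialFibration i π) {v v' : X.N} (hv : X.IsRay v) (hv' : X.IsRay v')
    {l : Fin (k + 1)} (hl : π.lin v = projVec hk l) (hl' : π.lin v' = projVec hk l) : v = v' := by
  have hnt : Nontrivial (Fin (k + 1)) := Fin.nontrivial_iff_two_le.2 (by omega)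
  obtain ⟨p, hp⟩ := exists_ne l
  let τ : (projectiveSpace k hk).cones :=
    ⟨coneSpan (projVec hk '' {l}), proj_coneSpan_mem ⟨p, hp⟩⟩
  obtain ⟨t⟩ := h.nonempty_localTriv τ
  obtain ⟨m, hm⟩ := proj_exists_dual (hk := hk) p l
  have hml : m (projVec hk l) = 1 := by rw [hm, if_pos rfl, if_neg hp.symm, sub_zero]
  refine t.ray_unique hv hv' (hl.trans hl'.symm) (hl ▸ vec_mem_coneSpan ⟨l, rfl, rfl⟩) (m₀ := m)
    (mem_dualMonoid_coneSpan.2 ?_) (by rw [hl, hml]; exact one_pos)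
  rintro _ ⟨_, rfl, rfl⟩
  rw [hml]
  exact zero_le_one

/-- A ray of `X` in the kernel of the projection comes from a ray of the weighted projective space:
since the latter is complete, the ray lies in the image of a cone of the fibre, and it is a face of
the cone of `X` containing that image. -/
lemma IsLocallyTrivialFibration.ray_kernel {n : ℕ} {a : Fin (n + 1) → ℕ} {ha : WellFormed a}
    {B : Fan} {i : wps a ha ⟶ X} {π : X ⟶ B} (h : IsLocallyTrivialFibration i π) {v : X.N}
    (hv : X.IsRay v) (hπ : π.lin v = 0) : ∃ s, v = i.lin (wpsVec a ha s) := by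
  obtain ⟨w, rfl⟩ := h.exists_of_proj_eq_zero hπ
  obtain ⟨j, c, hj, hw⟩ := wps_complete w
  obtain ⟨σ, hσ, hiσ⟩ := i.map_cone _ (wps_coneSpan_mem (ha := ha) (S := {l | 0 < c l})
    ⟨j, by simp [hj]⟩)
  have hwσ : vec (i.lin w) ∈ σ := by
    rw [← baseChange_vec]
    refine hiσ _ (vec_mem_of_nsmul_mem (ha.pos j) ?_)
    rw [hw]
    exact vec_sum_mem_coneSpan c _
  obtain ⟨m, hm, hface⟩ := hv.isFace hσ hwσ
  have hmw : m (i.lin w) = 0 := by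
    have := ((hface _).1 (vec_mem_coneSpan rfl)).2
    rw [realForm_vec] at this
    exact_mod_cast this
  have hgen : ∀ l, 0 < c l → vec (i.lin (wpsVec a ha l)) ∈ σ := fun l hl => by
    rw [← baseChange_vec]
    exact hiσ _ (vec_mem_coneSpan ⟨l, hl, rfl⟩)
  have hzero : ∀ l, 0 < c l → (m ∘ₗ i.lin) (wpsVec a ha l) = 0 := by
    refine (dual_sum_eq_zero_iff (f := wpsVec a ha) (m := m ∘ₗ i.lin) (c := c)
      fun l hl => apply_nonneg_of_mem (m := m) hm (hgen l hl)).1 ?_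
    rw [← hw, map_nsmul, LinearMap.comp_apply, hmw, smul_zero]
  obtain ⟨l, hl⟩ : ∃ l, 0 < c l := by
    by_contra! hc
    rw [Finset.sum_eq_zero fun l _ => by rw [Nat.le_zero.1 (hc l), zero_smul]] at hw
    rw [← natCast_zsmul] at hw
    have := (smul_eq_zero.1 hw).resolve_left (by exact_mod_cast (ha.pos j).ne')
    exact hv.ne_zero (by rw [this, map_zero])
  have hlv : vec (i.lin (wpsVec a ha l)) ∈ coneSpan {i.lin w} := by
    refine (hface _).2 ⟨hgen l hl, ?_⟩
    have := hzero l hl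
    rw [LinearMap.comp_apply] at this
    rw [realForm_vec, this, Int.cast_zero]
  obtain ⟨r, hr, hr'⟩ := mem_coneSpan_singleton.1 hlv
  obtain ⟨m₁, hm₁⟩ := hv.2
  have h1 : (m₁ (i.lin (wpsVec a ha l)) : ℝ) = r := by
    rw [← realForm_vec, hr', map_smul, realForm_vec, hm₁]
    simp
  have h2 : wpsVec a ha l = m₁ (i.lin (wpsVec a ha l)) • w := by
    refine h.incl_injective (vec_injective ?_)
    rw [map_smul, vec_zsmul, h1, hr']
  have h3 : 0 ≤ m₁ (i.lin (wpsVec a ha l)) := by exact_mod_cast h1 ▸ hr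
  refine ⟨l, ?_⟩
  rcases wpsVec_primitive h2 with h4 | h4
  · rw [h2, h4, one_smul]
  · omega

end Fan

/-! ### The isomorphism with a toric weighted projective bundle -/

lemma baseChange_mem_of_forall {N N' : Type} [AddCommGroup N] [AddCommGroup N'] {f : N →ₗ[ℤ] N'}
    {s : Set N} {τ : PointedCone ℝ (RealSpace N')} (h : ∀ v ∈ s, vec (f v) ∈ τ) :
    ∀ x ∈ coneSpan s, f.baseChange ℝ x ∈ τ := by
  have hle : coneSpan (f '' s) ≤ τ := coneSpan_le (by rintro _ ⟨v, hv, rfl⟩; exact h v hv)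
  exact fun x hx => hle (baseChange_mem_coneSpan f
    (fun _ hv => Or.inl (Set.mem_image_of_mem f hv)) x hx)

namespace Fan

/-- An isomorphism of lattices that maps cones into cones in both directions, as an isomorphism of
fans. -/
def isoOfEquiv {X Y : Fan} (e : X.N ≃ₗ[ℤ] Y.N)
    (h : ∀ σ ∈ X.cones, ∃ τ ∈ Y.cones, ∀ x ∈ σ, e.toLinearMap.baseChange ℝ x ∈ τ)
    (h' : ∀ τ ∈ Y.cones, ∃ σ ∈ X.cones, ∀ x ∈ τ, e.symm.toLinearMap.baseChange ℝ x ∈ σ) :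
    X ≅ Y where
  hom := ⟨e.toLinearMap, h⟩
  inv := ⟨e.symm.toLinearMap, h'⟩
  hom_inv_id := hom_ext (LinearMap.ext e.symm_apply_apply)
  inv_hom_id := hom_ext (LinearMap.ext e.apply_symm_apply)

lemma eq_zero_of_sum_eq_zero {ι : Type} [Fintype ι] {X : Fan} {σ : PointedCone ℝ (RealSpace X.N)}
    (hσ : σ ∈ X.cones) {f : ι → X.N} (hf : ∀ l, vec (f l) ∈ σ) {c : ι → ℕ} (hc : ∀ l, 0 < c l)
    (h : ∑ l, c l • f l = 0) (l : ι) : f l = 0 := by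
  classical
  rw [← Finset.add_sum_erase _ _ (Finset.mem_univ l)] at h
  have hmem := vec_sum_mem (σ := σ) (Finset.univ.erase l) c f fun l _ => hf l
  have h1 : (c l : ℝ) • vec (f l) = 0 := by
    refine X.strongly_convex σ hσ _ (PointedCone.smul_mem _ (by positivity) (hf l)) ?_
    rwa [← vec_nsmul, ← vec_neg, neg_eq_of_add_eq_zero_right h]
  have h2 := (smul_eq_zero.1 h1).resolve_left (by exact_mod_cast (hc l).ne')
  exact vec_injective (h2.trans vec_zero.symm)

section

variable {n k : ℕ} {hk : 0 < k} {a : Fin (n + 1) → ℕ} {ha : WellFormed a} {X : Fan}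
  {i : wps a ha ⟶ X} {π : X ⟶ projectiveSpace k hk}

lemma proj_sum_eq_zero_iff (y : Fin (k + 1) → ℤ) :
    ∑ l, y l • projVec hk l = 0 ↔ ∃ β : ℤ, ∀ l, y l = β := by
  have := wps_sum_eq_zero_iff (ha := wellFormed_one hk) y
  simp only [Nat.cast_one, mul_one] at this
  exact this

/-- Over lifts `v_l` of the `f_l` with `∑ v_l = ∑ d_s u_s`, the lattice of `X` is the quotient of
`ℤ^(n+1) ⊕ ℤ^(k+1)` defining the bundle with twists `d`: this is the exactness of the sequence of
lattices of fibre, total space and base. -/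
lemma IsLocallyTrivialFibration.exists_equiv (h : IsLocallyTrivialFibration i π)
    {v : Fin (k + 1) → X.N} (hv : ∀ l, π.lin (v l) = projVec hk l) {d : Fin (n + 1) → ℤ}
    (hd : ∑ l, v l = i.lin (∑ s, d s • wpsVec a ha s)) :
    ∃ e : (bundle a ha k d).N ≃ₗ[ℤ] X.N,
      (∀ s, e (bundleRay a k d (Sum.inl s)) = i.lin (wpsVec a ha s)) ∧
      ∀ l, e (bundleRay a k d (Sum.inr l)) = v l := by
  let L : ((Fin (n + 1) → ℤ) × (Fin (k + 1) → ℤ)) →ₗ[ℤ] X.N :=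
    (Fintype.linearCombination ℤ fun s => i.lin (wpsVec a ha s)).coprod
      (Fintype.linearCombination ℤ v)
  have hL : ∀ x, L x = i.lin (∑ s, x.1 s • wpsVec a ha s) + ∑ l, x.2 l • v l := fun x => by
    simp [L, Fintype.linearCombination_apply]
  have hπL : ∀ x, π.lin (L x) = ∑ l, x.2 l • projVec hk l := fun x => by
    simp [hL, h.proj_incl, hv]
  have hker : bundleRel a k d = LinearMap.ker L := by
    ext x
    have key : ∀ β : ℤ, (∀ l, x.2 l = β) →
        L x = i.lin (∑ s, (x.1 s + β * d s) • wpsVec a ha s) := fun β hβ => by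
      simp only [hL, hβ, ← Finset.smul_sum, hd, add_smul, mul_smul, Finset.sum_add_distrib,
        map_add, map_smul]
    rw [mem_bundleRel, LinearMap.mem_ker]
    constructor
    · rintro ⟨α, β, h1, h2⟩
      rw [key β h2, (wps_sum_eq_zero_iff _).2 ⟨α, fun s => by rw [h1]; ring⟩, map_zero]
    · intro hx
      obtain ⟨β, hβ⟩ := (proj_sum_eq_zero_iff (hk := hk) x.2).1 (by rw [← hπL, hx, map_zero])
      rw [key β hβ] at hx
      obtain ⟨α, hα⟩ := (wps_sum_eq_zero_iff _).1 (h.incl_injective (hx.trans (map_zero _).symm))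
      exact ⟨α, β, fun s => by rw [← hα]; ring, hβ⟩
  have hsurj : Function.Surjective L := fun w => by
    obtain ⟨-, c, -, hc⟩ := proj_complete (π.lin w)
    obtain ⟨z, hz⟩ := h.exists_of_proj_eq_zero (w := w - ∑ l, c l • v l) (by
      simp [hc, hv])
    obtain ⟨x, rfl⟩ := wps_span z
    refine ⟨(x, fun l => c l), ?_⟩
    rw [hL, hz]
    simp
  let e := (Submodule.quotEquivOfEq _ _ hker).trans (L.quotKerEquivOfSurjective hsurj)
  refine ⟨e, fun s => ?_, fun l => ?_⟩
  · change L (Pi.single s 1, 0) = _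
    simp [L]
  · change L (0, Pi.single l 1) = _
    simp [L]

/-- If the rays of a complete fan are among the images `e r_p` of the rays of a bundle and its cones
are spanned by images of rays of a single cone of the bundle, then it contains the images of all
cones of the bundle: a cone `σ` through the sum of the `e r_p` with `p ∈ T` contains each of these,
as otherwise the form separating `T` from the rays of `σ` would be negative on the sum. -/
lemma exists_cone_of_complete {d : Fin (n + 1) → ℤ} (e : (bundle a ha k d).N ≃ₗ[ℤ] X.N)
    (hD : ∀ w, ∃ σ ∈ X.cones, ∀ m ∈ dualMonoid σ, 0 ≤ m w)
    (hσ : ∀ σ ∈ X.cones, ∃ S : Set (Fin (n + 1) ⊕ Fin (k + 1)),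
      ((∃ s, Sum.inl s ∉ S) ∧ ∃ l, Sum.inr l ∉ S) ∧
      σ = coneSpan ((fun p => e (bundleRay a k d p)) '' S))
    {T : Set (Fin (n + 1) ⊕ Fin (k + 1))} (hT : (∃ s, Sum.inl s ∉ T) ∧ ∃ l, Sum.inr l ∉ T) :
    ∃ σ ∈ X.cones, ∀ p ∈ T, vec (e (bundleRay a k d p)) ∈ σ := by
  classical
  obtain ⟨σ, hσX, hw⟩ := hD (∑ p ∈ Finset.univ.filter (· ∈ T), e (bundleRay a k d p))
  obtain ⟨S, hS, rfl⟩ := hσ σ hσX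
  refine ⟨_, hσX, fun p hp => vec_mem_coneSpan ⟨p, ?_, rfl⟩⟩
  obtain ⟨m, h1, h2, h3⟩ := bundle_separating ha.pos k d hS hT
  let m' : Module.Dual ℤ X.N := LinearMap.comp (M₂ := (bundle a ha k d).N) m e.symm.toLinearMap
  have hm' : ∀ q, m' (e (bundleRay a k d q)) = m (bundleRay a k d q) := fun q =>
    congrArg m (e.symm_apply_apply _)
  by_contra hpS
  have h4 := hw m' (mem_dualMonoid_coneSpan.2 (by
    rintro _ ⟨q, hq, rfl⟩
    rw [hm']
    by_cases hqT : q ∈ T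
    exacts [(h3 q hq hqT).ge, (h1 q hq hqT).le]))
  rw [map_sum] at h4
  refine h4.not_gt (Finset.sum_neg' (fun q hq => ?_) ⟨p, by simpa using hp, ?_⟩)
  · rw [hm']
    by_cases hqS : q ∈ S
    exacts [(h3 q hqS (Finset.mem_filter.1 hq).2).le, (h2 q (Finset.mem_filter.1 hq).2 hqS).le]
  · rw [hm']
    exact h2 p hp hpS

/-- The cones of `X` are spanned by sets of vectors `u_s`, `v_l` containing neither all `u_s` nor
all `v_l`, because of the relations `∑ a_s u_s = 0` in the fibre and `∑ f_l = 0` in the base. -/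
lemma exists_eq_coneSpan {u : Fin (n + 1) ⊕ Fin (k + 1) → X.N}
    (hu : ∀ s, u (Sum.inl s) = i.lin (wpsVec a ha s))
    (hv : ∀ l, π.lin (u (Sum.inr l)) = projVec hk l)
    (hray : ∀ v, X.IsRay v → ∃ p, v = u p) (hne : ∀ s, i.lin (wpsVec a ha s) ≠ 0)
    {σ : PointedCone ℝ (RealSpace X.N)} (hσ : σ ∈ X.cones) :
    ∃ S : Set (Fin (n + 1) ⊕ Fin (k + 1)),
      ((∃ s, Sum.inl s ∉ S) ∧ ∃ l, Sum.inr l ∉ S) ∧ σ = coneSpan (u '' S) := by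
  refine ⟨{p | vec (u p) ∈ σ}, ⟨?_, ?_⟩, le_antisymm ?_ (coneSpan_le ?_)⟩
  · by_contra! hall
    refine hne 0 (eq_zero_of_sum_eq_zero hσ (f := fun s => i.lin (wpsVec a ha s))
      (fun s => hu s ▸ hall s) ha.pos ?_ 0)
    have h := congrArg i.lin (wps_sum_weights (a := a) (ha := ha))
    simpa only [map_sum, natCast_zsmul, map_nsmul, map_zero] using h
  · by_contra! hall
    obtain ⟨τ, hτ, hστ⟩ := π.map_cone σ hσ
    have h0 : ∀ l, projVec hk l = 0 := eq_zero_of_sum_eq_zero hτ (c := fun _ => 1)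
      (fun l => by rw [← hv, ← baseChange_vec]; exact hστ _ (hall l)) (fun _ => one_pos)
      (by simpa only [one_smul] using proj_sum)
    exact wpsVec_ne_zero (ha := wellFormed_one hk) 0 (h0 0)
  · obtain ⟨R, rfl, hR⟩ := X.exists_rays hσ
    refine coneSpan_mono fun w hw => ?_
    obtain ⟨p, rfl⟩ := hray w (hR w hw)
    exact ⟨p, vec_mem_coneSpan hw, rfl⟩
  · rintro _ ⟨p, hp, rfl⟩
    exact hp

end

end Fan

end Toric

theorem theoremT (n k : ℕ) (hk : 0 < k) (a : Fin (n + 1) → ℕ) (ha : Toric.WellFormed a)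
    (X : Toric.Fan) (i : Toric.wps a ha ⟶ X) (π : X ⟶ Toric.projectiveSpace k hk)
    (h : Toric.Fan.IsLocallyTrivialFibration i π) :
    ∃ (d : Fin (n + 1) → ℤ) (Φ : X ≅ Toric.bundle a ha k d),
      i ≫ Φ.hom = Toric.bundleIncl a ha k d ∧ Φ.hom ≫ Toric.bundleProj a ha k hk d = π := by
  open Toric in
  choose v hvray hv using h.exists_ray
  obtain ⟨z, hz⟩ := h.exists_of_proj_eq_zero (w := ∑ l, v l) (by
    rw [map_sum, Finset.sum_congr rfl fun l _ => hv l, proj_sum])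
  obtain ⟨d, rfl⟩ := wps_span z
  obtain ⟨e, heu, hev⟩ := h.exists_equiv hv hz.symm
  have hσ := fun σ (hσ : σ ∈ X.cones) => Fan.exists_eq_coneSpan
    (u := fun p => e (bundleRay a k d p)) heu (fun l => by rw [hev, hv]) (fun w hw => by
      rcases h.ray_proj hw with h0 | ⟨l, hl⟩
      · obtain ⟨s, rfl⟩ := h.ray_kernel hw h0
        exact ⟨Sum.inl s, (heu s).symm⟩
      · exact ⟨Sum.inr l, (h.ray_unique hw (hvray l) hl (hv l)).trans (hev l).symm⟩)
    (fun s h0 => wpsVec_ne_zero s (h.incl_injective (h0.trans (map_zero _).symm))) hσ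
  have hD := h.complete (fun w => wps_exists_nonneg w)
    fun w => wps_exists_nonneg (ha := wellFormed_one hk) w
  refine ⟨d, Fan.isoOfEquiv e.symm ?_ ?_, ?_, ?_⟩
  · intro σ hσX
    obtain ⟨S, hS, rfl⟩ := hσ σ hσX
    refine ⟨coneSpan (bundleRay a k d '' S), ⟨S, hS, rfl⟩, baseChange_mem_of_forall ?_⟩
    rintro _ ⟨p, hp, rfl⟩
    have h1 : e.symm (e (bundleRay a k d p)) = bundleRay a k d p := e.symm_apply_apply _
    exact vec_mem_coneSpan ⟨p, hp, h1.symm⟩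
  · rintro _ ⟨T, hT, rfl⟩
    obtain ⟨σ, hσX, hTσ⟩ := Fan.exists_cone_of_complete e hD hσ hT
    refine ⟨σ, hσX, baseChange_mem_of_forall ?_⟩
    rintro _ ⟨p, hp, rfl⟩
    exact hTσ p hp
  · refine Fan.hom_ext (LinearMap.ext fun w => ?_)
    obtain ⟨x, rfl⟩ := wps_span w
    rw [map_sum, map_sum]
    refine Finset.sum_congr rfl fun s _ => ?_
    rw [map_smul, map_smul]
    congr 1
    refine (e.symm_apply_eq).2 (heu s).symm
  · have hproj : bundleProjLin a k d =
        LinearMap.comp (M₂ := X.N) (M₃ := (projectiveSpace k hk).N) π.lin e.toLinearMap := by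
      refine Submodule.linearMap_qext _ (LinearMap.prod_ext (LinearMap.pi_ext' fun s =>
        LinearMap.ext_ring ?_) (LinearMap.pi_ext' fun l => LinearMap.ext_ring ?_))
      · have h1 : π.lin (e (bundleRay a k d (Sum.inl s))) = 0 := by rw [heu, h.proj_incl]
        exact (map_zero (wpsRel fun _ : Fin (k + 1) => 1).mkQ).trans h1.symm
      · have h1 : π.lin (e (bundleRay a k d (Sum.inr l))) = projVec hk l := by rw [hev, hv]
        exact h1.symm
    refine Fan.hom_ext (LinearMap.ext fun w => ?_)
    exact (LinearMap.congr_fun hproj (e.symm w)).trans (congrArg π.lin (e.apply_symm_apply w))
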